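/- Let $p_{jk},P_{jl},\beta_j$ ($j,k=1,2$, $l=1,2,3$) be real functions of $\delta=(\delta_1,\delta_2)\in\mathbb R^2$, with $p_{jk},P_{jl}$ of class $C^1$ near $\delta=0$, and with $p_{12}(0)=2p_{11}(0)$, $p_{21}(0)=2p_{22}(0)$. Consider the truncated normal form on $\mathbb R^2\times(\mathbb R/2\pi\mathbb Z)^2$ $$\begin{aligned}\dot r_1&=r_1\left(\delta_1+p_{11}(\delta)r_1^2+p_{12}(\delta)r_2^2+P_{11}(\delta)r_1^4+P_{12}(\delta)r_1^2r_2^2+P_{13}(\delta)r_2^4\right),&\dot\varphi_1&=\beta_1(\delta),\\ \dot r_2&=r_2\left(\delta_2+p_{21}(\delta)r_1^2+p_{22}(\delta)r_2^2+P_{21}(\delta)r_1^4+P_{22}(\delta)r_1^2r_2^2+P_{23}(\delta)r_2^4\right),&\dot\varphi_2&=\beta_2(\delta),\end{aligned}$$ and the amplitude system that it induces for $\rho_j=r_j^2$. Assume (H3): $p_{jk}(0)\ne0$ for $j,k=1,2$ and $\det(p_{jk}(0))\neq0$. Put $$\gamma=\frac{p_{12}}{p_{22}},\quad \sigma=\frac{p_{21}}{p_{11}},\quad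 \Gamma_1=\frac{P_{11}}{p_{11}^2},\ \Gamma_2=\frac{P_{12}}{p_{11}p_{22}},\ \Gamma_3=\frac{P_{13}}{p_{22}^2},\quad \Sigma_1=\frac{P_{21}}{p_{11}^2},\ \Sigma_2=\frac{P_{22}}{p_{11}p_{22}},\ \Sigma_3=\frac{P_{23}}{p_{22}^2},$$ $\eta_j=|p_{jj}(\delta)|\rho_j$, and $s=\operatorname{sign}p_{11}(0)$. An invariant $k$-torus is a $C^1$-embedded $k$-torus consisting of complete trajectories. For $\delta$ near $0$ the amplitude system has near the origin exactly one nontrivial equilibrium $E_3(\delta)$, i.e. one common zero of the two brackets on the right-hand side (written in $\rho$), and $E_3(\delta)\to0$ as $\delta\to0$. (i) If $p_{11}(0)p_{22}(0)>0$, then in the coordinates $\eta$ $$E_3=-s\left(-\frac{\delta_1-\gamma\delta_2}{\gamma\sigma-1},\ \frac{\sigma\delta_1-\delta_2}{\gamma\sigma-1}\right)+O(\|\delta\|^2).$$ There are arbitrarily small $\delta$ for which $E_3(\delta)$ lies in the open positive quadrant, and for every sufficiently small such $\delta$ the set $\{r_j=\sqrt{\rho_j},\ j=1,2\}$ with $(\rho_1,\rho_2)=E_3(\delta)$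 is an invariant 2-torus of the truncated normal form. (ii) If $p_{11}(0)p_{22}(0)<0$, the same holds with $$E_3=s\left(\frac{\delta_1-\gamma\delta_2}{\gamma\sigma-1},\ \frac{\sigma\delta_1-\delta_2}{\gamma\sigma-1}\right)+O(\|\delta\|^2).$$ Suppose moreover that $\gamma(0)\neq1$, $\sigma(0)\ne1$ and $l_{10}\neq0$, where, all quantities being evaluated at $\delta=0$, $$l_{10}=-\frac{\sigma-1}{\gamma-1}\Big(-4(\Gamma_1+\Gamma_2+\Sigma_2+\Sigma_3)+(7\Gamma_1+\Sigma_1+\Sigma_2-\gamma\Sigma_1)\gamma+(\Gamma_2+\Gamma_3+7\Sigma_3-\sigma\Gamma_3)\sigma\Big).$$ Then there is a function $h$, of class $C^1$ near $0$, with $h(\delta_1)=-\frac{\sigma(0)-1}{\gamma(0)-1}\delta_1+O(\delta_1^2)$, such that, near the origin, the parameters at which $E_3$ lies in the positive quadrant and the amplitude system linearized at $E_3$ has eigenvalues $\pm i\omega$ with $\omega>0$ form exactly the Hopf curve $$H=\{\delta:\ \delta_2=h(\delta_1),\ s(\delta_1-\gamma\delta_2)>0,\ s(\sigma\delta_1-\delta_2)>0\},$$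 which has points arbitrarily close to the origin. For every $\delta^0\in H$ sufficiently close to the origin, with $T$ the invariant 2-torus of $E_3(\delta^0)$: * if $l_{10}<0$, an asymptotically stable invariant 3-torus appears out of $T$ as $\delta$ crosses $H$ at $\delta^0$ from $\delta_2\le h(\delta_1)$ to $\delta_2>h(\delta_1)$; * if $l_{10}>0$, an unstable (not Lyapunov stable) invariant 3-torus appears out of $T$ as $\delta$ crosses $H$ at $\delta^0$ from $\delta_2\ge h(\delta_1)$ to $\delta_2<h(\delta_1)$. Here "appears out of $T$" means: every neighbourhood of $T$ contains such a 3-torus for all $\delta$ sufficiently close to $\delta^0$ on the second side, while some fixed neighbourhood of $T$ contains no invariant 3-torus at all for $\delta$ sufficiently close to $\delta^0$ on the first side. -/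

import Mathlib

open Set Filter Topology Asymptotics

noncomputable section

/-- The coefficient functions of the truncated normal form, as functions of the unfolding
parameter `δ = (δ₁, δ₂)`. Indices are shifted by one: `p 0 0, p 0 1, p 1 0, p 1 1` are
`p₁₁, p₁₂, p₂₁, p₂₂`, and `P j 0, P j 1, P j 2` are `P_{j+1,1}, P_{j+1,2}, P_{j+1,3}`. -/
structure TruncatedNormalForm where
  p : Fin 2 → Fin 2 → ℝ × ℝ → ℝ
  P : Fin 2 → Fin 3 → ℝ × ℝ → ℝ
  β : Fin 2 → ℝ × ℝ → ℝ

/-- The phase space of the truncated normal form: `(r₁, r₂, φ₁, φ₂)`, angles modulo `2π`. -/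
abbrev PhaseSpace : Type := ℝ × ℝ × Real.Angle × Real.Angle

/-- Reduction of the angles modulo `2π`. -/
def toPhase (x : ℝ × ℝ × ℝ × ℝ) : PhaseSpace :=
  (x.1, x.2.1, (x.2.2.1 : Real.Angle), (x.2.2.2 : Real.Angle))

/-- The realization of the phase space in `ℝ² × ℂ²` by `(r₁, r₂, e^{iφ₁}, e^{iφ₂})`. -/
def phaseEmb (q : PhaseSpace) : ℝ × ℝ × ℂ × ℂ :=
  (q.1, q.2.1, (q.2.2.1.toCircle : ℂ), (q.2.2.2.toCircle : ℂ))

/-- `S` is an embedded `k`-dimensional `C¹` torus: the image of a `C¹` map on `ℝᵏ` that is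
`2π`-periodic in each variable, injective modulo periods, and an immersion. -/
def IsEmbeddedTorus (k : ℕ) (S : Set PhaseSpace) : Prop :=
  ∃ Ψ : (Fin k → ℝ) → ℝ × ℝ × ℂ × ℂ,
    ContDiff ℝ 1 Ψ ∧
    (∀ x y, Ψ x = Ψ y ↔ ∀ i, (x i : Real.Angle) = (y i : Real.Angle)) ∧
    (∀ x, Function.Injective (fderiv ℝ Ψ x)) ∧
    range Ψ = phaseEmb '' S

namespace TruncatedNormalForm

variable (N : TruncatedNormalForm) (δ : ℝ × ℝ)

/-- `δ₁ + p₁₁ρ₁ + p₁₂ρ₂ + P₁₁ρ₁² + P₁₂ρ₁ρ₂ + P₁₃ρ₂²`. -/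
def bracket₁ (ρ : ℝ × ℝ) : ℝ :=
  δ.1 + N.p 0 0 δ * ρ.1 + N.p 0 1 δ * ρ.2
    + N.P 0 0 δ * ρ.1 ^ 2 + N.P 0 1 δ * ρ.1 * ρ.2 + N.P 0 2 δ * ρ.2 ^ 2

/-- `δ₂ + p₂₁ρ₁ + p₂₂ρ₂ + P₂₁ρ₁² + P₂₂ρ₁ρ₂ + P₂₃ρ₂²`. -/
def bracket₂ (ρ : ℝ × ℝ) : ℝ :=
  δ.2 + N.p 1 0 δ * ρ.1 + N.p 1 1 δ * ρ.2
    + N.P 1 0 δ * ρ.1 ^ 2 + N.P 1 1 δ * ρ.1 * ρ.2 + N.P 1 2 δ * ρ.2 ^ 2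

/-- The right-hand side of the truncated normal form, angles lifted to `ℝ`. -/
def field (x : ℝ × ℝ × ℝ × ℝ) : ℝ × ℝ × ℝ × ℝ :=
  (x.1 * N.bracket₁ δ (x.1 ^ 2, x.2.1 ^ 2), x.2.1 * N.bracket₂ δ (x.1 ^ 2, x.2.1 ^ 2),
    N.β 0 δ, N.β 1 δ)

/-- The right-hand side of the truncated amplitude system, in `ρ_j = r_j²`. -/
def ampField (ρ : ℝ × ℝ) : ℝ × ℝ :=
  (2 * ρ.1 * N.bracket₁ δ ρ, 2 * ρ.2 * N.bracket₂ δ ρ)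

/-- `x` solves the truncated normal form on the time set `I`. -/
def IsSolutionOn (I : Set ℝ) (x : ℝ → ℝ × ℝ × ℝ × ℝ) : Prop :=
  ∀ t ∈ I, HasDerivWithinAt x (N.field δ (x t)) I t

/-- `S` is invariant: the trajectory through each point of `S` exists for all positive and
negative times and stays in `S`. -/
def IsInvariant (S : Set PhaseSpace) : Prop :=
  ∀ x₀, toPhase x₀ ∈ S → ∃ x, N.IsSolutionOn δ univ x ∧ x 0 = x₀ ∧ ∀ t, toPhase (x t) ∈ S

def IsInvariantTorus (k : ℕ) (S : Set PhaseSpace) : Prop :=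
  IsEmbeddedTorus k S ∧ N.IsInvariant δ S

/-- Lyapunov stability of a set. -/
def IsLyapunovStable (S : Set PhaseSpace) : Prop :=
  ∀ V ∈ 𝓝ˢ S, ∃ W ∈ 𝓝ˢ S, ∀ x₀, toPhase x₀ ∈ W →
    ∃ x, N.IsSolutionOn δ (Ici 0) x ∧ x 0 = x₀ ∧ ∀ t ∈ Ici (0 : ℝ), toPhase (x t) ∈ V

/-- Asymptotic stability of a set. -/
def IsAsymptoticallyStable (S : Set PhaseSpace) : Prop :=
  N.IsLyapunovStable δ S ∧
    ∃ W ∈ 𝓝ˢ S, ∀ x₀, toPhase x₀ ∈ W →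
      ∃ x, N.IsSolutionOn δ (Ici 0) x ∧ x 0 = x₀ ∧ Tendsto (fun t => toPhase (x t)) atTop (𝓝ˢ S)

def γ : ℝ := N.p 0 1 δ / N.p 1 1 δ
def σ : ℝ := N.p 1 0 δ / N.p 0 0 δ
def Γ₁ : ℝ := N.P 0 0 δ / N.p 0 0 δ ^ 2
def Γ₂ : ℝ := N.P 0 1 δ / (N.p 0 0 δ * N.p 1 1 δ)
def Γ₃ : ℝ := N.P 0 2 δ / N.p 1 1 δ ^ 2
def S₁ : ℝ := N.P 1 0 δ / N.p 0 0 δ ^ 2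
def S₂ : ℝ := N.P 1 1 δ / (N.p 0 0 δ * N.p 1 1 δ)
def S₃ : ℝ := N.P 1 2 δ / N.p 1 1 δ ^ 2

/-- The leading coefficient `l₁₀` of the first Lyapunov coefficient along the Hopf curve. -/
def l₁₀ : ℝ :=
  -((N.σ 0 - 1) / (N.γ 0 - 1)) *
    (-4 * (N.Γ₁ 0 + N.Γ₂ 0 + N.S₂ 0 + N.S₃ 0)
      + (7 * N.Γ₁ 0 + N.S₁ 0 + N.S₂ 0 - N.γ 0 * N.S₁ 0) * N.γ 0
      + (N.Γ₂ 0 + N.Γ₃ 0 + 7 * N.S₃ 0 - N.σ 0 * N.Γ₃ 0) * N.σ 0)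

/-- The nondegeneracy condition on the cubic coefficients. -/
def H3 : Prop :=
  (∀ j k, N.p j k 0 ≠ 0) ∧ N.p 0 0 0 * N.p 1 1 0 - N.p 0 1 0 * N.p 1 0 0 ≠ 0

/-- `E` is the branch of nontrivial equilibria `E₃` of the amplitude system, in the
coordinates `ρ`: it tends to the origin, and near the origin it gives exactly the common zeros
of the two brackets. -/
def IsNontrivialBranch (E : ℝ × ℝ → ℝ × ℝ) : Prop :=
  Tendsto E (𝓝 0) (𝓝 0) ∧
    ∃ V ∈ 𝓝 (0 : ℝ × ℝ), ∀ᶠ δ in 𝓝 (0 : ℝ × ℝ), ∀ ρ ∈ V,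
      (N.bracket₁ δ ρ = 0 ∧ N.bracket₂ δ ρ = 0) ↔ ρ = E δ

/-- The scaled coordinates `η_j = |p_jj(δ)| ρ_j`. -/
def scaled (ρ : ℝ × ℝ) : ℝ × ℝ := (|N.p 0 0 δ| * ρ.1, |N.p 1 1 δ| * ρ.2)

/-- Leading part of `E₃` in the case `p₁₁(0) < 0`, `p₂₂(0) < 0`. -/
def leadSimple : ℝ × ℝ :=
  (-((δ.1 - N.γ δ * δ.2) / (N.γ δ * N.σ δ - 1)), (N.σ δ * δ.1 - δ.2) / (N.γ δ * N.σ δ - 1))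

/-- Leading part of `E₃` in the case `p₁₁(0) > 0`, `p₂₂(0) < 0`. -/
def leadDifficult : ℝ × ℝ :=
  ((δ.1 - N.γ δ * δ.2) / (N.γ δ * N.σ δ - 1), (N.σ δ * δ.1 - δ.2) / (N.γ δ * N.σ δ - 1))

/-- The open positive quadrant. -/
def posQuadrant : Set (ℝ × ℝ) := {ρ | 0 < ρ.1 ∧ 0 < ρ.2}

/-- The set of states with amplitudes `r_j = √ρ_j` and arbitrary phases. -/
def torusOver (ρ : ℝ × ℝ) : Set PhaseSpace := {q | q.1 = √ρ.1 ∧ q.2.1 = √ρ.2}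

/-- The 2-torus statement about a branch `E`: the equilibrium is in the positive quadrant for
some arbitrarily small `δ`, and for every small such `δ` its torus is an invariant 2-torus. -/
def HasInvariantTwoTori (E : ℝ × ℝ → ℝ × ℝ) : Prop :=
  (∃ᶠ δ in 𝓝 (0 : ℝ × ℝ), E δ ∈ posQuadrant) ∧
    ∀ᶠ δ in 𝓝 (0 : ℝ × ℝ), E δ ∈ posQuadrant → N.IsInvariantTorus δ 2 (torusOver (E δ))

/-- `ρ` lies in the positive quadrant and the linearization of the amplitude system there has a
pair of nonzero purely imaginary eigenvalues `± iω`. -/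
def IsHopfPoint (ρ : ℝ × ℝ) : Prop :=
  ρ ∈ posQuadrant ∧ ∃ ω : ℝ, 0 < ω ∧
    ((fderiv ℝ (N.ampField δ) ρ : ℝ × ℝ →L[ℝ] ℝ × ℝ) : ℝ × ℝ →ₗ[ℝ] ℝ × ℝ).charpoly
      = Polynomial.X ^ 2 + Polynomial.C (ω ^ 2)

/-- The curve `δ₂ = h(δ₁)` inside the sector `s(δ₁ - γδ₂) > 0`, `s(σδ₁ - δ₂) > 0`. -/
def hopfCurve (s : ℝ) (h : ℝ → ℝ) : Set (ℝ × ℝ) :=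
  {δ | δ.2 = h δ.1 ∧ 0 < s * (δ.1 - N.γ δ * δ.2) ∧ 0 < s * (N.σ δ * δ.1 - δ.2)}

/-- At the parameter value `δ₀` an invariant 3-torus with property `Q` appears out of the set
`T` on passing from the parameter set `B` to the parameter set `A`: for `δ ∈ A` near `δ₀` there
is one in any prescribed neighbourhood of `T`, while a fixed neighbourhood of `T` contains no
invariant 3-torus when `δ ∈ B` is near `δ₀`. -/
def ThreeTorusAppears (T : Set PhaseSpace) (δ₀ : ℝ × ℝ) (B A : Set (ℝ × ℝ))
    (Q : ℝ × ℝ → Set PhaseSpace → Prop) : Prop :=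
  (∀ U ∈ 𝓝ˢ T, ∀ᶠ δ in 𝓝[A] δ₀, ∃ S ⊆ U, N.IsInvariantTorus δ 3 S ∧ Q δ S) ∧
    ∃ U ∈ 𝓝ˢ T, ∀ᶠ δ in 𝓝[B] δ₀, ∀ S ⊆ U, ¬ N.IsInvariantTorus δ 3 S

end TruncatedNormalForm

end

/-!
The amplitude system is `ρ₁' = 2 ρ₁ F₁`, `ρ₂' = 2 ρ₂ F₂` with quadratic polynomials `F₁`, `F₂` in
`ρ`. Since `det p(0) ≠ 0`, the implicit function theorem solves `F₁ = F₂ = 0` near the origin by a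
unique `C¹` branch `E` (`exists_branch`), and neglecting quadratic terms in the two equations gives
its first-order expansion (`isBigO_scaled`). Where `E` lies in the open quadrant, the set of states
with amplitudes `√E` is an invariant two-torus.

Suppose `p₁₁ p₂₂ < 0` at `δ = 0`. Then the Jacobian determinant of `(F₁, F₂)` is positive, so on the
part of the branch in the quadrant the eigenvalues are purely imaginary exactly where the trace
vanishes. Half the trace (`halfTrace`) is a `C¹` function of `δ` whose derivative at the origin
does not vanish in the direction of `δ₂`; its zero set is the graph of `h` (`exists_trace_curve`).

At a point of the Hopf curve the amplitude field in a linear frame at `E` is a planar cubic field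
with linear part `z ↦ (μ + i ω) z`, whose coefficients depend continuously on `δ`. For such fields
the bifurcation is proved directly, uniformly in the coefficients, and so continuity of the
coefficients suffices. In polar coordinates there are periodic functions `H₁`, `H₂` of the angle for
which `log r + r H₁ + r² H₂` has the derivative `μ (1 + O(r)) + lyap r² + O(r³)` along the field.
Let `lyap < 0`. If `μ ≤ 0` this function decreases strictly along orbits near the origin, and a
small compact invariant set consists of the equilibrium alone (`compact_invariant_subset`). If
`μ > 0` is small, the averaged function traps the orbits in an annulus in which the rate is strongly
decreasing in `r`; as a periodic scalar equation in the angle the system then is contracting, and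
its unique periodic solution is an attracting cycle (`ContractingStrip.exists_periodic_attractor`,
`exists_attractingCycle`). The case `lyap > 0` follows by reversing time and reflecting a
coordinate.

A cycle of the amplitude system lifts to an invariant three-torus with the same stability
(`isInvariantTorus_torusLift`, `isAsymptoticallyStable_torusLift`,
`not_isLyapunovStable_torusLift`).
Conversely, the squared amplitudes on any invariant three-torus near the two-torus form a compact
invariant set near `E`; when this is `E` alone, the three-torus would be contained in the two-torus,
which is impossible because a nonsingular `C¹` parametrization has three independent derivatives
(`not_isEmbeddedTorus_of_subset_torusOver`).

It remains to find the sign of `lyap` on the Hopf curve. For a field multiplied by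
`ρ₁ ^ (a - 1) ρ₂ ^ (b - 1)`, with `a` and `b` chosen so that the divergence has no linear term at
`E`, the coefficient is read off from the quadratic terms of the divergence
(`IsNormalFrame.lyap_eq`). On the curve this agrees with a function `focalValue` that is continuous
at `δ = 0`, and its value there is a positive multiple of `l₁₀` (`focalValue_zero`).
-/

noncomputable section

/-! ### Global solutions and reparametrization of time -/

/-- A bounded time-dependent vector field that is uniformly Lipschitz in the state has a global
solution through every initial condition. -/
theorem exists_global_solution {f : ℝ → ℝ → ℝ} {L M : NNReal}
    (hL : ∀ t, LipschitzWith L (f t)) (hc : ∀ x, Continuous fun t => f t x)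
    (hM : ∀ t x, ‖f t x‖ ≤ M) (t₀ x₀ : ℝ) :
    ∃ x : ℝ → ℝ, x t₀ = x₀ ∧ ∀ t, HasDerivAt x (f t (x t)) t := by
  have loc : ∀ T : NNReal, ∃ x : ℝ → ℝ, x t₀ = x₀ ∧
      ∀ t ∈ Ioo (t₀ - T) (t₀ + T), HasDerivAt x (f t (x t)) t := by
    intro T
    have hmem : t₀ ∈ Icc (t₀ - T) (t₀ + T) := by
      constructor <;> linarith [T.2, show (T : ℝ) = T.1 from rfl]
    have hpl : IsPicardLindelof f (⟨t₀, hmem⟩ : Icc (t₀ - T) (t₀ + (T : ℝ))) x₀ (M * T) 0 M L :=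
      { lipschitzOnWith := fun t _ => (hL t).lipschitzOnWith
        continuousOn := fun x _ => (hc x).continuousOn
        norm_le := fun t _ x _ => hM t x
        mul_max_le := by simp }
    obtain ⟨α, h0, hα⟩ := hpl.exists_eq_forall_mem_Icc_hasDerivWithinAt₀
    exact ⟨α, h0, fun t ht => (hα t (Ioo_subset_Icc_self ht)).hasDerivAt (Icc_mem_nhds ht.1 ht.2)⟩
  choose α h0 hα using loc
  have agree : ∀ S T : NNReal, ∀ t, |t - t₀| < S → |t - t₀| < T → α S t = α T t := by
    intro S T t hS hT
    have hsub : ∀ R : NNReal, min S T ≤ R → Ioo (t₀ - (min S T : NNReal)) (t₀ + (min S T : NNReal)) ⊆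
        Ioo (t₀ - R) (t₀ + R) := by
      intro R hR
      have : ((min S T : NNReal) : ℝ) ≤ R := by exact_mod_cast hR
      exact Ioo_subset_Ioo (by linarith) (by linarith)
    have hlt : |t - t₀| < (min S T : NNReal) := by
      rw [NNReal.coe_min]; exact lt_min hS hT
    have hpos := (abs_nonneg _).trans_lt hlt
    refine ODE_solution_unique_of_mem_Ioo (v := f) (s := fun _ => univ) (K := L) (t₀ := t₀)
      (fun t _ => (hL t).lipschitzOnWith) ⟨by linarith, by linarith⟩
      (fun t ht => ⟨hα S t (hsub S (min_le_left _ _) ht), trivial⟩)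
      (fun t ht => ⟨hα T t (hsub T (min_le_right _ _) ht), trivial⟩) (by rw [h0, h0]) ?_
    rw [abs_lt] at hlt
    exact ⟨by linarith, by linarith⟩
  have hR : ∀ t : ℝ, |t - t₀| < (‖t - t₀‖₊ + 1 : NNReal) := fun t => by
    simp [Real.norm_eq_abs]
  refine ⟨fun t => α (‖t - t₀‖₊ + 1) t, by simp [h0], fun t => ?_⟩
  have hd := hα (‖t - t₀‖₊ + 1) t (by
    have := hR t; rw [abs_lt] at this; exact ⟨by linarith, by linarith⟩)
  refine hd.congr_of_eventuallyEq ?_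
  have : ∀ᶠ s in 𝓝 t, |s - t₀| < (‖t - t₀‖₊ + 1 : NNReal) :=
    (continuous_abs.comp (continuous_id.sub continuous_const)).continuousAt.eventually_lt_const (hR t)
  exact this.mono fun s hs => agree _ _ _ (hR s) hs

/-- The autonomous scalar equation `θ' = B θ` with `B` continuous and bounded between two positive
constants has a global increasing solution; uniqueness of solutions is not needed, since `θ` is the
inverse of the travel time `∫ 1 / B`. -/
theorem exists_angle_solution {B : ℝ → ℝ} (hB : Continuous B) {m M : ℝ} (hm : 0 < m)
    (hmB : ∀ θ, m ≤ B θ) (hBM : ∀ θ, B θ ≤ M) (θ₀ : ℝ) :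
    ∃ θ : ℝ → ℝ, θ 0 = θ₀ ∧ (∀ t, HasDerivAt θ (B (θ t)) t) ∧ Function.Bijective θ ∧
      Tendsto θ atTop atTop ∧ ∀ t, ∫ s in θ₀..θ t, (B s)⁻¹ = t := by
  have hpos : ∀ θ, 0 < B θ := fun θ => hm.trans_le (hmB θ)
  have hM : 0 < M := (hpos 0).trans_le (hBM 0)
  set T : ℝ → ℝ := fun θ => ∫ s in θ₀..θ, (B s)⁻¹ with hT
  have hcinv : Continuous fun s => (B s)⁻¹ := hB.inv₀ fun s => (hpos s).ne'
  have hTd : ∀ θ, HasDerivAt T (B θ)⁻¹ θ := fun θ => hcinv.integral_hasStrictDerivAt θ₀ θ |>.hasDerivAt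
  have hTc : Continuous T := continuous_iff_continuousAt.2 fun θ => (hTd θ).continuousAt
  have hTm : StrictMono T := strictMono_of_deriv_pos fun θ => by
    rw [(hTd θ).deriv]; exact inv_pos.2 (hpos θ)
  have hT0 : T θ₀ = 0 := by simp [hT]
  have hgrow : ∀ x y, x ≤ y → (y - x) / M ≤ T y - T x := by
    intro x y hxy
    have h1 : Monotone fun θ => T θ - θ / M := by
      have hd : ∀ θ, HasDerivAt (fun θ => T θ - θ / M) ((B θ)⁻¹ - 1 / M) θ := fun θ =>
        (hTd θ).sub ((hasDerivAt_id θ).div_const M)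
      refine monotone_of_deriv_nonneg (fun θ => (hd θ).differentiableAt) fun θ => ?_
      rw [(hd θ).deriv, one_div, sub_nonneg]
      exact inv_anti₀ (hpos θ) (hBM θ)
    have := h1 hxy
    simp only at this
    rw [sub_div]; linarith
  have htop : Tendsto T atTop atTop := by
    refine tendsto_atTop_mono' atTop (f₁ := fun θ => (θ - θ₀) / M) ?_ ?_
    · filter_upwards [eventually_ge_atTop θ₀] with θ h
      have := hgrow _ _ h; rw [hT0] at this; linarith
    · exact (tendsto_atTop_add_const_right _ _ tendsto_id).atTop_div_const hM
  have hbot : Tendsto T atBot atBot := by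
    refine tendsto_atBot_mono' atBot
      (show T ≤ᶠ[atBot] fun θ => (θ - θ₀) / M from ?_) ?_
    · filter_upwards [eventually_le_atBot θ₀] with θ h
      have := hgrow _ _ h; rw [hT0] at this
      have h2 : (θ - θ₀) / M = -((θ₀ - θ) / M) := by ring
      rw [h2]; linarith
    · exact (tendsto_atBot_add_const_right _ _ tendsto_id).atBot_div_const hM
  let e : ℝ ≃o ℝ := StrictMono.orderIsoOfSurjective T hTm (hTc.surjective htop hbot)
  have he : ∀ x, e x = T x := fun x => rfl
  have hder : ∀ t, HasDerivAt e.symm (B (e.symm t)) t := by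
    intro t
    have := (hTd (e.symm t)).of_local_left_inverse (f := T) (g := e.symm) (a := t)
      e.symm.continuous.continuousAt (inv_ne_zero (hpos _).ne')
      (Eventually.of_forall fun s => by rw [← he]; simp)
    simpa using this
  have h0 : e.symm 0 = θ₀ := by rw [← hT0, ← he]; simp
  refine ⟨e.symm, h0, hder, e.symm.bijective, e.symm.tendsto_atTop,
    fun t => by
      have : T (e.symm t) = t := by rw [← he]; simp
      exact this⟩

/-- For a periodic speed `B` the solution of `θ' = B θ` advances by a multiple of the period of `B`
exactly after the same multiple of one turn time. -/
theorem angle_solution_periodic {B : ℝ → ℝ} (hB : Continuous B) (hpos : ∀ θ, 0 < B θ) {p : ℝ}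
    (hp : 0 < p) (hper : ∀ θ, B (θ + p) = B θ) {θ₀ : ℝ} {θ : ℝ → ℝ} (hbij : Function.Bijective θ)
    (hT : ∀ t, ∫ s in θ₀..θ t, (B s)⁻¹ = t) :
    ∃ τ > 0, ∀ s t, (∃ n : ℤ, θ s - θ t = n * p) ↔ ∃ n : ℤ, s - t = n * τ := by
  have hcinv : Continuous fun s => (B s)⁻¹ := hB.inv₀ fun s => (hpos s).ne'
  have hi : ∀ a b, IntervalIntegrable (fun s => (B s)⁻¹) MeasureTheory.volume a b := fun a b =>
    hcinv.intervalIntegrable a b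
  have hP : Function.Periodic (fun s => (B s)⁻¹) p := fun s => by simp only [hper]
  have key : ∀ s t : ℝ, ∀ n : ℤ, θ s - θ t = n * p → s - t = n * ∫ x in (0:ℝ)..p, (B x)⁻¹ := by
    intro s t n h
    have h1 : s - t = ∫ x in θ t..θ s, (B x)⁻¹ := by
      rw [← hT s, ← hT t, intervalIntegral.integral_interval_sub_left (hi _ _) (hi _ _), hT, hT]
    have h2 := hP.intervalIntegral_add_zsmul_eq n (θ t) hi
    rw [h1, show θ s = θ t + n • p by rw [zsmul_eq_mul]; linarith, h2, zsmul_eq_mul,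
      hP.intervalIntegral_add_eq (θ t) 0, zero_add]
  refine ⟨∫ x in (0:ℝ)..p, (B x)⁻¹, ?_, fun s t => ⟨fun ⟨n, h⟩ => ⟨n, key s t n h⟩, fun ⟨n, h⟩ => ?_⟩⟩
  · exact intervalIntegral.intervalIntegral_pos_of_pos (hi _ _) (fun x => inv_pos.2 (hpos x)) hp
  · obtain ⟨s', hs'⟩ := hbij.2 (θ t + n * p)
    have := key s' t n (by rw [hs']; ring)
    have hss : s' = s := by linarith
    exact ⟨n, by rw [← hss, hs']; ring⟩

/-! ### Contracting periodic scalar equations -/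

/-- A `2π`-periodic scalar equation `u' = G θ u` on the strip `U₁ ≤ u ≤ U₂`, together with a
periodic change of variable `Φ θ u` which along solutions has derivative `K θ u`. The rate `K` is
strongly decreasing in `u`, positive where `Φ ≤ A₁` and negative where `Φ ≥ B₀`. The levels
`A₀ < A₁` and `B₀ < B₁` leave room for solutions starting near the periodic one. -/
structure ContractingStrip (G Φ K : ℝ → ℝ → ℝ) (U₁ U₂ A₀ A₁ B₀ B₁ κ : ℝ) : Prop where
  G_periodic : ∀ θ u, G (θ + 2 * Real.pi) u = G θ u
  Φ_periodic : ∀ θ u, Φ (θ + 2 * Real.pi) u = Φ θ u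
  U_lt : U₁ < U₂
  G_lipschitz : ∃ L : NNReal, ∀ θ, LipschitzOnWith L (G θ) (Icc U₁ U₂)
  G_continuous : ∀ u ∈ Icc U₁ U₂, Continuous fun θ => G θ u
  G_bounded : ∃ M : NNReal, ∀ θ, ∀ u ∈ Icc U₁ U₂, ‖G θ u‖ ≤ M
  Φ_deriv : ∀ (u : ℝ → ℝ) (θ : ℝ), HasDerivAt u (G θ (u θ)) θ → u θ ∈ Icc U₁ U₂ →
    HasDerivAt (fun s => Φ s (u s)) (K θ (u θ)) θ
  Φ_lower : ∀ θ, ∀ u ∈ Icc U₁ U₂, ∀ v ∈ Icc U₁ U₂, u ≤ v → (v - u) / 2 ≤ Φ θ v - Φ θ u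
  Φ_upper : ∀ θ, ∀ u ∈ Icc U₁ U₂, ∀ v ∈ Icc U₁ U₂, u ≤ v → Φ θ v - Φ θ u ≤ 2 * (v - u)
  κ_pos : 0 < κ
  K_decreasing : ∀ θ, ∀ u ∈ Icc U₁ U₂, ∀ v ∈ Icc U₁ U₂, u ≤ v → K θ v - K θ u ≤ -κ * (v - u)
  K_pos : ∀ θ, ∀ u ∈ Icc U₁ U₂, Φ θ u ≤ A₁ → 0 < K θ u
  K_neg : ∀ θ, ∀ u ∈ Icc U₁ U₂, B₀ ≤ Φ θ u → K θ u < 0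
  Φ_left : ∀ θ, Φ θ U₁ < A₀
  Φ_right : ∀ θ, B₁ < Φ θ U₂
  A_lt : A₀ < A₁
  A_lt_B : A₁ < B₀
  B_lt : B₀ < B₁

namespace ContractingStrip

variable {G Φ K : ℝ → ℝ → ℝ} {U₁ U₂ A₀ A₁ B₀ B₁ κ : ℝ}

/-- The part of the strip at phase `θ` between the levels `A` and `B` of `Φ`. -/
def fiber (Φ : ℝ → ℝ → ℝ) (U₁ U₂ A B θ : ℝ) : Set ℝ := {u | u ∈ Icc U₁ U₂ ∧ Φ θ u ∈ Icc A B}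

theorem continuousOn_Φ (h : ContractingStrip G Φ K U₁ U₂ A₀ A₁ B₀ B₁ κ) (θ : ℝ) :
    ContinuousOn (Φ θ) (Icc U₁ U₂) := by
  have : LipschitzOnWith 2 (Φ θ) (Icc U₁ U₂) := by
    refine LipschitzOnWith.of_dist_le_mul fun u hu v hv => ?_
    rw [Real.dist_eq, Real.dist_eq]
    rcases le_total u v with huv | huv
    · have h1 := h.Φ_lower θ u hu v hv huv
      have h2 := h.Φ_upper θ u hu v hv huv
      rw [abs_sub_comm, abs_of_nonneg (by linarith), abs_sub_comm, abs_of_nonneg (by linarith)]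
      simpa using h2
    · have h1 := h.Φ_lower θ v hv u hu huv
      have h2 := h.Φ_upper θ v hv u hu huv
      rw [abs_of_nonneg (by linarith), abs_of_nonneg (by linarith)]
      simpa using h2
  exact this.continuousOn

/-- The field `G` with the state clamped to `[U₁, U₂]`, that is, extended constantly in `u` beyond
the strip. It is globally Lipschitz and bounded, hence has global solutions. -/
def Clamped (G : ℝ → ℝ → ℝ) (U₁ U₂ : ℝ) (hU : U₁ ≤ U₂) (θ u : ℝ) : ℝ := G θ (projIcc U₁ U₂ hU u)

theorem exists_clamped (h : ContractingStrip G Φ K U₁ U₂ A₀ A₁ B₀ B₁ κ) :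
    ∃ L : NNReal, (∀ θ, LipschitzWith L (Clamped G U₁ U₂ h.U_lt.le θ)) ∧
      ∀ θ₀ u₀, ∃ u : ℝ → ℝ, u θ₀ = u₀ ∧
        ∀ θ, HasDerivAt u (Clamped G U₁ U₂ h.U_lt.le θ (u θ)) θ := by
  obtain ⟨L, hL⟩ := h.G_lipschitz
  obtain ⟨M, hM⟩ := h.G_bounded
  have hLip : ∀ θ, LipschitzWith L (Clamped G U₁ U₂ h.U_lt.le θ) := by
    intro θ
    have h1 := (hL θ).to_restrict.comp (LipschitzWith.projIcc h.U_lt.le)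
    rw [mul_one] at h1
    exact h1
  exact ⟨L, hLip, fun θ₀ u₀ => exists_global_solution hLip
    (fun x => h.G_continuous _ (projIcc U₁ U₂ h.U_lt.le x).2)
    (fun t x => hM t _ (projIcc U₁ U₂ h.U_lt.le x).2) θ₀ u₀⟩

theorem clamped_eq {hU : U₁ ≤ U₂} {θ u : ℝ} (hu : u ∈ Icc U₁ U₂) :
    Clamped G U₁ U₂ hU θ u = G θ u := by
  simp [Clamped, projIcc_of_mem hU hu]

/-- The region between a level `A` of positive rate and a level `B` of negative rate is positively
invariant. -/
theorem mem_fiber (h : ContractingStrip G Φ K U₁ U₂ A₀ A₁ B₀ B₁ κ) {A B : ℝ}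
    (hA₀ : A₀ ≤ A) (hA₁ : A ≤ A₁) (hB₀ : B₀ ≤ B) (hB₁ : B ≤ B₁) {u : ℝ → ℝ}
    (hu : ∀ θ, HasDerivAt u (Clamped G U₁ U₂ h.U_lt.le θ (u θ)) θ) {θ₀ : ℝ}
    (h0 : u θ₀ ∈ fiber Φ U₁ U₂ A B θ₀) {θ : ℝ} (hθ : θ₀ ≤ θ) : u θ ∈ fiber Φ U₁ U₂ A B θ := by
  have hcont : Continuous u := continuous_iff_continuousAt.2 fun s => (hu s).continuousAt
  -- While the solution stays in the strip, it stays between the levels.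
  have step : ∀ b, (∀ s ∈ Icc θ₀ b, u s ∈ Icc U₁ U₂) → ∀ s ∈ Icc θ₀ b, Φ s (u s) ∈ Icc A B := by
    intro b hb s hs
    have hd : ∀ s ∈ Icc θ₀ b, HasDerivAt (fun s => Φ s (u s)) (K s (u s)) s := fun s hs =>
      h.Φ_deriv u s (by have := hu s; rwa [clamped_eq (hb s hs)] at this) (hb s hs)
    have hco : ContinuousOn (fun s => Φ s (u s)) (Icc θ₀ b) := fun s hs =>
      (hd s hs).continuousAt.continuousWithinAt
    constructor
    · have := image_le_of_deriv_right_lt_deriv_boundary' (f := fun s => -Φ s (u s))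
        (f' := fun s => -K s (u s)) (B := fun _ => -A) (B' := fun _ => 0) hco.neg
        (fun s hs => ((hd s (Ico_subset_Icc_self hs)).neg).hasDerivWithinAt)
        (by have := h0.2.1; simpa using this) continuousOn_const
        (fun s _ => hasDerivWithinAt_const _ _ _)
        (fun s hs he => by
          have he' : Φ s (u s) = A := by simpa using he
          have := h.K_pos s _ (hb s (Ico_subset_Icc_self hs)) (he'.le.trans hA₁)
          linarith) hs
      simpa using this
    · exact image_le_of_deriv_right_lt_deriv_boundary' (f := fun s => Φ s (u s))
        (f' := fun s => K s (u s)) (B := fun _ => B) (B' := fun _ => 0) hco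
        (fun s hs => (hd s (Ico_subset_Icc_self hs)).hasDerivWithinAt)
        h0.2.2 continuousOn_const (fun s _ => hasDerivWithinAt_const _ _ _)
        (fun s hs he => h.K_neg s _ (hb s (Ico_subset_Icc_self hs)) (hB₀.trans he.ge)) hs
  -- The levels lie strictly inside the strip, so the solution never leaves the strip.
  have strip : Icc θ₀ θ ⊆ {s | ∀ r ∈ Icc θ₀ s, u r ∈ Icc U₁ U₂} := by
    have hclosed : IsClosed ({s | ∀ r ∈ Icc θ₀ s, u r ∈ Icc U₁ U₂} ∩ Icc θ₀ θ) := by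
      have : {s | ∀ r ∈ Icc θ₀ s, u r ∈ Icc U₁ U₂} ∩ Icc θ₀ θ =
          {s | ∀ r ∈ Icc θ₀ θ, u (min r s) ∈ Icc U₁ U₂} ∩ Icc θ₀ θ := by
        ext s
        refine ⟨fun ⟨h1, h2⟩ => ⟨fun r hr => h1 _ ⟨le_min hr.1 h2.1, min_le_right _ _⟩, h2⟩,
          fun ⟨h1, h2⟩ => ⟨fun r hr => ?_, h2⟩⟩
        have := h1 r ⟨hr.1, hr.2.trans h2.2⟩
        rwa [min_eq_left hr.2] at this
      rw [this]
      refine IsClosed.inter ?_ isClosed_Icc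
      simp only [ofPred_forall]
      refine isClosed_iInter fun r => isClosed_iInter fun _ => ?_
      exact isClosed_Icc.preimage (hcont.comp (continuous_const.min continuous_id))
    refine hclosed.Icc_subset_of_forall_mem_nhdsWithin (fun r hr => ?_) fun s hs => ?_
    · rw [Icc_self, mem_singleton_iff] at hr; rw [hr]; exact h0.1
    · have hs' := step s hs.1 s ⟨hs.2.1, le_rfl⟩
      have hin : u s ∈ Ioo U₁ U₂ := by
        have hmem := hs.1 s ⟨hs.2.1, le_rfl⟩
        refine ⟨lt_of_le_of_ne hmem.1 fun he => ?_, lt_of_le_of_ne hmem.2 fun he => ?_⟩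
        · have := h.Φ_left s; rw [he] at this; linarith [hs'.1]
        · have := h.Φ_right s; rw [← he] at this; linarith [hs'.2]
      have hev : ∀ᶠ r in 𝓝 s, u r ∈ Ioo U₁ U₂ :=
        hcont.continuousAt.eventually_mem (Ioo_mem_nhds hin.1 hin.2)
      obtain ⟨ε, hε, hball⟩ := Metric.eventually_nhds_iff.1 hev
      filter_upwards [Ioo_mem_nhdsGT (show s < s + ε by linarith)] with r hr q hq
      rcases le_or_gt q s with hqs | hqs
      · exact hs.1 q ⟨hq.1, hqs⟩
      · refine Ioo_subset_Icc_self (hball ?_)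
        rw [Real.dist_eq, abs_of_pos (by linarith)]
        linarith [hq.2, hr.2]
  have hall := strip ⟨hθ, le_rfl⟩
  exact ⟨hall θ ⟨hθ, le_rfl⟩, step θ hall θ ⟨hθ, le_rfl⟩⟩

/-- Two solutions that stay in the strip approach each other exponentially. -/
theorem abs_sub_le (h : ContractingStrip G Φ K U₁ U₂ A₀ A₁ B₀ B₁ κ) {u v : ℝ → ℝ} {θ₀ : ℝ}
    (hu : ∀ θ, θ₀ ≤ θ → HasDerivAt u (G θ (u θ)) θ) (hus : ∀ θ, θ₀ ≤ θ → u θ ∈ Icc U₁ U₂)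
    (hv : ∀ θ, θ₀ ≤ θ → HasDerivAt v (G θ (v θ)) θ) (hvs : ∀ θ, θ₀ ≤ θ → v θ ∈ Icc U₁ U₂)
    {θ : ℝ} (hθ : θ₀ ≤ θ) :
    |u θ - v θ| ≤ 4 * |u θ₀ - v θ₀| * Real.exp (-(κ / 2) * (θ - θ₀)) := by
  set D : ℝ → ℝ := fun s => Φ s (u s) - Φ s (v s) with hD
  have hDd : ∀ s, θ₀ ≤ s → HasDerivAt D (K s (u s) - K s (v s)) s := fun s hs =>
    (h.Φ_deriv u s (hu s hs) (hus s hs)).sub (h.Φ_deriv v s (hv s hs) (hvs s hs))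
  have hlow : ∀ s, θ₀ ≤ s → |u s - v s| / 2 ≤ |D s| := by
    intro s hs
    rcases le_total (u s) (v s) with hle | hle
    · have h1 := h.Φ_lower s _ (hus s hs) _ (hvs s hs) hle
      rw [abs_sub_comm, abs_of_nonneg (by linarith)]
      exact h1.trans (by rw [hD]; simp only; rw [abs_sub_comm]; exact le_abs_self _)
    · have h1 := h.Φ_lower s _ (hvs s hs) _ (hus s hs) hle
      rw [abs_of_nonneg (by linarith)]
      exact h1.trans (le_abs_self _)
  have hup : |D θ₀| ≤ 2 * |u θ₀ - v θ₀| := by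
    rcases le_total (u θ₀) (v θ₀) with hle | hle
    · have h1 := h.Φ_upper θ₀ _ (hus θ₀ le_rfl) _ (hvs θ₀ le_rfl) hle
      have h2 := h.Φ_lower θ₀ _ (hus θ₀ le_rfl) _ (hvs θ₀ le_rfl) hle
      rw [abs_sub_comm (u θ₀), abs_of_nonneg (show 0 ≤ v θ₀ - u θ₀ by linarith), hD]
      simp only
      rw [abs_sub_comm, abs_of_nonneg (by linarith)]
      exact h1
    · have h1 := h.Φ_upper θ₀ _ (hvs θ₀ le_rfl) _ (hus θ₀ le_rfl) hle
      have h2 := h.Φ_lower θ₀ _ (hvs θ₀ le_rfl) _ (hus θ₀ le_rfl) hle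
      rw [abs_of_nonneg (show 0 ≤ u θ₀ - v θ₀ by linarith), hD]
      simp only
      rw [abs_of_nonneg (by linarith)]
      exact h1
  -- `D D' ≤ -(κ / 2) D²`
  have hkey : ∀ s, θ₀ ≤ s → D s * (K s (u s) - K s (v s)) ≤ -(κ / 2) * D s ^ 2 := by
    intro s hs
    rcases le_total (u s) (v s) with hle | hle
    · have h1 := h.Φ_upper s _ (hus s hs) _ (hvs s hs) hle
      have h2 := h.Φ_lower s _ (hus s hs) _ (hvs s hs) hle
      have h3 := h.K_decreasing s _ (hus s hs) _ (hvs s hs) hle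
      have h4 : D s ≤ 0 := by simp only [hD]; linarith
      have h5 : -(D s) ≤ 2 * (v s - u s) := by simp only [hD]; linarith
      nlinarith [h.κ_pos, mul_le_mul_of_nonneg_left h5 h.κ_pos.le]
    · have h1 := h.Φ_upper s _ (hvs s hs) _ (hus s hs) hle
      have h2 := h.Φ_lower s _ (hvs s hs) _ (hus s hs) hle
      have h3 := h.K_decreasing s _ (hvs s hs) _ (hus s hs) hle
      have h4 : 0 ≤ D s := by simp only [hD]; linarith
      have h5 : D s ≤ 2 * (u s - v s) := by simp only [hD]; linarith
      nlinarith [h.κ_pos, mul_le_mul_of_nonneg_left h5 h.κ_pos.le]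
  have hE : ∀ s, θ₀ ≤ s → HasDerivAt (fun s => D s ^ 2 * Real.exp (κ * (s - θ₀)))
      (2 * D s * (K s (u s) - K s (v s)) * Real.exp (κ * (s - θ₀)) +
        D s ^ 2 * (Real.exp (κ * (s - θ₀)) * κ)) s := by
    intro s hs
    have h1 := (hDd s hs).pow 2
    have h2 : HasDerivAt (fun s => Real.exp (κ * (s - θ₀))) (Real.exp (κ * (s - θ₀)) * κ) s := by
      have := (((hasDerivAt_id s).sub_const θ₀).const_mul κ).exp
      simpa using this
    have := h1.mul h2
    refine this.congr_deriv ?_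
    simp
  have hanti : AntitoneOn (fun s => D s ^ 2 * Real.exp (κ * (s - θ₀))) (Ici θ₀) := by
    refine antitoneOn_of_deriv_nonpos (convex_Ici θ₀)
      (fun s hs => (hE s hs).continuousAt.continuousWithinAt)
      (fun s hs => (hE s (interior_subset hs)).differentiableAt.differentiableWithinAt)
      fun s hs => ?_
    have hs' : θ₀ ≤ s := interior_subset hs
    rw [(hE s hs').deriv]
    have := hkey s hs'
    have hx := Real.exp_pos (κ * (s - θ₀))
    nlinarith [mul_le_mul_of_nonneg_right this hx.le]
  have hfin := hanti (mem_Ici.2 le_rfl) (mem_Ici.2 hθ) hθ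
  simp only [sub_self, mul_zero, Real.exp_zero, mul_one] at hfin
  have hexp : Real.exp (κ * (θ - θ₀)) = Real.exp (κ / 2 * (θ - θ₀)) ^ 2 := by
    rw [← Real.exp_nat_mul]; congr 1; push_cast; ring
  have hDθ : |D θ| * Real.exp (κ / 2 * (θ - θ₀)) ≤ |D θ₀| := by
    rw [hexp, ← mul_pow] at hfin
    have := sq_le_sq.1 hfin
    rwa [abs_mul, abs_of_pos (Real.exp_pos _)] at this
  have h1 := hlow θ hθ
  have hneg : Real.exp (-(κ / 2) * (θ - θ₀)) * Real.exp (κ / 2 * (θ - θ₀)) = 1 := by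
    rw [← Real.exp_add]; simp
  have hDθ' : |D θ| ≤ |D θ₀| * Real.exp (-(κ / 2) * (θ - θ₀)) := by
    have := mul_le_mul_of_nonneg_right hDθ (Real.exp_pos (-(κ / 2) * (θ - θ₀))).le
    rw [mul_assoc, mul_comm (Real.exp (κ / 2 * (θ - θ₀))), hneg, mul_one] at this
    exact this
  have := mul_le_mul_of_nonneg_right hup (Real.exp_pos (-(κ / 2) * (θ - θ₀))).le
  linarith

/-- A contracting periodic equation has a periodic solution that attracts all nearby solutions
uniformly and exponentially. -/
theorem exists_periodic_attractor (h : ContractingStrip G Φ K U₁ U₂ A₀ A₁ B₀ B₁ κ) :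
    ∃ w : ℝ → ℝ, (∀ θ, w (θ + 2 * Real.pi) = w θ) ∧ (∀ θ, HasDerivAt w (G θ (w θ)) θ) ∧
      (∀ θ, w θ ∈ Icc U₁ U₂) ∧ ∃ ε > 0, ∀ θ₀ u₀, |u₀ - w θ₀| ≤ ε →
        ∃ u : ℝ → ℝ, u θ₀ = u₀ ∧ (∀ θ, θ₀ ≤ θ → u θ ∈ Icc U₁ U₂) ∧
          (Continuous u) ∧ (∀ θ, θ₀ ≤ θ → HasDerivAt u (G θ (u θ)) θ) ∧
          ∀ θ, θ₀ ≤ θ → |u θ - w θ| ≤ 4 * |u₀ - w θ₀| * Real.exp (-(κ / 2) * (θ - θ₀)) := by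
  obtain ⟨L, hLip, hsol⟩ := h.exists_clamped
  choose sol hsol0 hsol using hsol
  have hpi := Real.two_pi_pos
  have huniq : ∀ {u v : ℝ → ℝ}, (∀ θ, HasDerivAt u (Clamped G U₁ U₂ h.U_lt.le θ (u θ)) θ) →
      (∀ θ, HasDerivAt v (Clamped G U₁ U₂ h.U_lt.le θ (v θ)) θ) → u 0 = v 0 → u = v :=
    fun hu hv h0 => ODE_solution_unique_univ (s := fun _ => univ) (t₀ := 0)
      (fun t => (hLip t).lipschitzOnWith) (fun t => ⟨hu t, trivial⟩) (fun t => ⟨hv t, trivial⟩) h0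
  -- a solution of the clamped equation that stays in the strip solves the equation
  have hG : ∀ {u : ℝ → ℝ} {θ : ℝ}, HasDerivAt u (Clamped G U₁ U₂ h.U_lt.le θ (u θ)) θ →
      u θ ∈ Icc U₁ U₂ → HasDerivAt u (G θ (u θ)) θ := fun hu hm => by
    rwa [clamped_eq hm] at hu
  have hmonoΦ : ∀ θ, ∀ u ∈ Icc U₁ U₂, ∀ v ∈ Icc U₁ U₂, Φ θ u ≤ Φ θ v → u ≤ v := by
    intro θ u hu v hv huv
    by_contra! hlt
    have := h.Φ_lower θ v hv u hu hlt.le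
    linarith
  have hivt : ∀ c ∈ Icc A₀ B₁, ∃ x ∈ Icc U₁ U₂, Φ 0 x = c := by
    intro c hc
    have := intermediate_value_Icc h.U_lt.le (h.continuousOn_Φ 0)
    exact this ⟨(h.Φ_left 0).le.trans hc.1, hc.2.trans (h.Φ_right 0).le⟩
  obtain ⟨xA, hxA, hΦA⟩ := hivt A₁ ⟨h.A_lt.le, (h.A_lt_B.trans h.B_lt).le⟩
  obtain ⟨xB, hxB, hΦB⟩ := hivt B₀ ⟨(h.A_lt.trans h.A_lt_B).le, h.B_lt.le⟩
  have hAB : xA ≤ xB := hmonoΦ 0 _ hxA _ hxB (by rw [hΦA, hΦB]; exact h.A_lt_B.le)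
  have hsub : ∀ x, x ∈ Icc xA xB ↔ x ∈ fiber Φ U₁ U₂ A₁ B₀ 0 := by
    intro x
    constructor
    · intro hx
      have hxU : x ∈ Icc U₁ U₂ := ⟨hxA.1.trans hx.1, hx.2.trans hxB.2⟩
      refine ⟨hxU, ?_, ?_⟩
      · have := h.Φ_lower 0 _ hxA _ hxU hx.1; linarith [hx.1]
      · have := h.Φ_lower 0 _ hxU _ hxB hx.2; linarith [hx.2]
    · intro hx
      exact ⟨hmonoΦ 0 _ hxA _ hx.1 (hΦA ▸ hx.2.1), hmonoΦ 0 _ hx.1 _ hxB (hΦB ▸ hx.2.2)⟩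
  have htrap : ∀ x ∈ Icc xA xB, ∀ θ, 0 ≤ θ → sol 0 x θ ∈ fiber Φ U₁ U₂ A₁ B₀ θ := by
    intro x hx θ hθ
    refine h.mem_fiber h.A_lt.le le_rfl le_rfl h.B_lt.le (hsol 0 x) ?_ hθ
    rw [hsol0]; exact (hsub x).1 hx
  have hP : ∀ x ∈ Icc xA xB, sol 0 x (2 * Real.pi) ∈ Icc xA xB := by
    intro x hx
    rw [hsub]
    have := htrap x hx (2 * Real.pi) hpi.le
    refine ⟨this.1, ?_⟩
    have h2 := this.2
    rwa [← zero_add (2 * Real.pi), h.Φ_periodic, zero_add] at h2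
  have hPc : ContinuousOn (fun x => sol 0 x (2 * Real.pi)) (Icc xA xB) := by
    have : LipschitzOnWith 4 (fun x => sol 0 x (2 * Real.pi)) (Icc xA xB) := by
      refine LipschitzOnWith.of_dist_le_mul fun x hx y hy => ?_
      have h1 := h.abs_sub_le (u := sol 0 x) (v := sol 0 y) (θ₀ := 0)
        (fun θ hθ => hG (hsol 0 x θ) (htrap x hx θ hθ).1) (fun θ hθ => (htrap x hx θ hθ).1)
        (fun θ hθ => hG (hsol 0 y θ) (htrap y hy θ hθ).1) (fun θ hθ => (htrap y hy θ hθ).1) hpi.le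
      rw [hsol0, hsol0] at h1
      rw [Real.dist_eq, Real.dist_eq]
      refine h1.trans ?_
      have : Real.exp (-(κ / 2) * (2 * Real.pi - 0)) ≤ 1 := by
        rw [Real.exp_le_one_iff]
        have := h.κ_pos
        nlinarith
      have h4 : 0 ≤ 4 * |x - y| := by positivity
      have := mul_le_mul_of_nonneg_left this h4
      simpa using this
    exact this.continuousOn
  obtain ⟨x, hx, hfix⟩ : ∃ x ∈ Icc xA xB, sol 0 x (2 * Real.pi) = x := by
    have hc : ContinuousOn (fun x => x - sol 0 x (2 * Real.pi)) (Icc xA xB) :=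
      continuousOn_id.sub hPc
    obtain ⟨x, hx, h0⟩ := intermediate_value_Icc hAB hc
      (show (0:ℝ) ∈ _ from ⟨by linarith [(hP xA ⟨le_rfl, hAB⟩).1],
        by linarith [(hP xB ⟨hAB, le_rfl⟩).2]⟩)
    exact ⟨x, hx, by simp only at h0; linarith⟩
  set w := sol 0 x with hw
  have hper : ∀ θ, w (θ + 2 * Real.pi) = w θ := by
    have : (fun θ => w (θ + 2 * Real.pi)) = w := by
      refine huniq (fun θ => ?_) (hsol 0 x) (by simp only [zero_add]; rw [hfix, hw, hsol0])
      have h1 := (hsol 0 x (θ + 2 * Real.pi)).comp_add_const θ (2 * Real.pi)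
      have h2 : ∀ u, Clamped G U₁ U₂ h.U_lt.le (θ + 2 * Real.pi) u =
          Clamped G U₁ U₂ h.U_lt.le θ u := fun u => h.G_periodic θ _
      rw [h2] at h1
      exact h1
    exact fun θ => congrFun this θ
  have hfibw : ∀ θ, w θ ∈ fiber Φ U₁ U₂ A₁ B₀ θ := by
    intro θ
    obtain ⟨n, hn⟩ := exists_nat_gt (-θ / (2 * Real.pi))
    have hpos : 0 ≤ θ + n * (2 * Real.pi) := by
      rw [div_lt_iff₀ hpi] at hn; linarith
    have h1 := htrap x hx _ hpos
    have hw' : w (θ + n * (2 * Real.pi)) = w θ := (show Function.Periodic w (2 * Real.pi) from hper).nat_mul n θ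
    have hΦ' : ∀ u, Φ (θ + n * (2 * Real.pi)) u = Φ θ u := fun u =>
      (show Function.Periodic (fun θ => Φ θ u) (2 * Real.pi) from fun θ => h.Φ_periodic θ u).nat_mul n θ
    rw [← hw, hw'] at h1
    exact ⟨h1.1, by have := h1.2; rwa [hΦ'] at this⟩
  have hwG : ∀ θ, HasDerivAt w (G θ (w θ)) θ := fun θ => hG (hsol 0 x θ) (hfibw θ).1
  have hwI : ∀ θ, w θ ∈ Ioo U₁ U₂ := by
    intro θ
    have hf := hfibw θ
    refine ⟨lt_of_le_of_ne hf.1.1 fun he => ?_, lt_of_le_of_ne hf.1.2 fun he => ?_⟩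
    · have := h.Φ_left θ; rw [he] at this; linarith [hf.2.1, h.A_lt]
    · have := h.Φ_right θ; rw [← he] at this; linarith [hf.2.2, h.B_lt]
  -- The solutions started within `ε` of `w` lie between the outer levels.
  have hlev : ∀ θ u, u ∈ Icc U₁ U₂ → |u - w θ| ≤ min (A₁ - A₀) (B₁ - B₀) / 2 →
      u ∈ fiber Φ U₁ U₂ A₀ B₁ θ := by
    intro θ u hu hd
    have hm1 := min_le_left (A₁ - A₀) (B₁ - B₀)
    have hm2 := min_le_right (A₁ - A₀) (B₁ - B₀)
    have hd' := abs_le.1 hd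
    have hf := hfibw θ
    refine ⟨hu, ?_⟩
    rcases le_total u (w θ) with hle | hle
    · have h1 := h.Φ_upper θ _ hu _ hf.1 hle
      have h2 := h.Φ_lower θ _ hu _ hf.1 hle
      constructor <;> linarith [hf.2.1, hf.2.2, h.B_lt]
    · have h1 := h.Φ_upper θ _ hf.1 _ hu hle
      have h2 := h.Φ_lower θ _ hf.1 _ hu hle
      constructor <;> linarith [hf.2.1, hf.2.2, h.A_lt]
  have hUmargin : ∀ θ, U₁ + (A₁ - A₀) / 2 ≤ w θ ∧ w θ ≤ U₂ - (B₁ - B₀) / 2 := by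
    intro θ
    have hf := hfibw θ
    have h1 := h.Φ_upper θ U₁ ⟨le_rfl, h.U_lt.le⟩ _ hf.1 hf.1.1
    have h2 := h.Φ_upper θ _ hf.1 U₂ ⟨h.U_lt.le, le_rfl⟩ hf.1.2
    have h3 := h.Φ_left θ
    have h4 := h.Φ_right θ
    constructor <;> linarith [hf.2.1, hf.2.2]
  refine ⟨w, hper, hwG, fun θ => Ioo_subset_Icc_self (hwI θ), min (A₁ - A₀) (B₁ - B₀) / 2,
    by have := h.A_lt; have := h.B_lt; exact half_pos (lt_min (by linarith) (by linarith)),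
    fun θ₀ u₀ hu₀ => ?_⟩
  have hmem : u₀ ∈ Icc U₁ U₂ := by
    have hm1 := min_le_left (A₁ - A₀) (B₁ - B₀)
    have hm2 := min_le_right (A₁ - A₀) (B₁ - B₀)
    have hd' := abs_le.1 hu₀
    have := hUmargin θ₀
    constructor <;> linarith [this.1, this.2]
  have hin : ∀ θ, θ₀ ≤ θ → sol θ₀ u₀ θ ∈ Icc U₁ U₂ := fun θ hθ =>
    (h.mem_fiber le_rfl h.A_lt.le h.B_lt.le le_rfl (hsol θ₀ u₀)
      (by rw [hsol0]; exact hlev θ₀ u₀ hmem hu₀) hθ).1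
  refine ⟨sol θ₀ u₀, hsol0 _ _, hin,
    continuous_iff_continuousAt.2 fun s => (hsol θ₀ u₀ s).continuousAt,
    fun θ hθ => hG (hsol θ₀ u₀ θ) (hin θ hθ), fun θ hθ => ?_⟩
  have := h.abs_sub_le (fun θ hθ => hG (hsol θ₀ u₀ θ) (hin θ hθ)) hin (fun θ _ => hwG θ)
    (fun θ _ => (hfibw θ).1) hθ
  rwa [hsol0] at this

end ContractingStrip

/-! ### Planar cubic fields with a focus at the origin -/

/-- The coefficients of a planar polynomial field of degree three with linear part
`(μ x - ω y, ω x + μ y)`; `fij` and `gij` are the coefficients of `x ^ i * y ^ j` in the first and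
second component. -/
structure CubicJet where
  (μ ω f20 f11 f02 g20 g11 g02 f30 f21 f12 f03 g30 g21 g12 g03 : ℝ)

namespace CubicJet

variable (J : CubicJet)

/-- Quadratic part of the first component. -/
def f₂ (x y : ℝ) : ℝ := J.f20 * x ^ 2 + J.f11 * x * y + J.f02 * y ^ 2
/-- Quadratic part of the second component. -/
def g₂ (x y : ℝ) : ℝ := J.g20 * x ^ 2 + J.g11 * x * y + J.g02 * y ^ 2
/-- Cubic part of the first component. -/
def f₃ (x y : ℝ) : ℝ := J.f30 * x ^ 3 + J.f21 * x ^ 2 * y + J.f12 * x * y ^ 2 + J.f03 * y ^ 3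
/-- Cubic part of the second component. -/
def g₃ (x y : ℝ) : ℝ := J.g30 * x ^ 3 + J.g21 * x ^ 2 * y + J.g12 * x * y ^ 2 + J.g03 * y ^ 3

/-- The vector field with the given coefficients. -/
def field (z : ℝ × ℝ) : ℝ × ℝ :=
  (J.μ * z.1 - J.ω * z.2 + J.f₂ z.1 z.2 + J.f₃ z.1 z.2,
    J.ω * z.1 + J.μ * z.2 + J.g₂ z.1 z.2 + J.g₃ z.1 z.2)

/-- In polar coordinates the field reads `r' = r (μ + a₁ r + a₂ r²)`, `θ' = ω + b₁ r + b₂ r²`; this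
is the coefficient `a₁`. -/
def a₁ (θ : ℝ) : ℝ :=
  Real.cos θ * J.f₂ (Real.cos θ) (Real.sin θ) + Real.sin θ * J.g₂ (Real.cos θ) (Real.sin θ)
/-- Second radial coefficient of the field in polar coordinates. -/
def a₂ (θ : ℝ) : ℝ :=
  Real.cos θ * J.f₃ (Real.cos θ) (Real.sin θ) + Real.sin θ * J.g₃ (Real.cos θ) (Real.sin θ)
/-- First angular coefficient of the field in polar coordinates. -/
def b₁ (θ : ℝ) : ℝ :=
  Real.cos θ * J.g₂ (Real.cos θ) (Real.sin θ) - Real.sin θ * J.f₂ (Real.cos θ) (Real.sin θ)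
/-- Second angular coefficient of the field in polar coordinates. -/
def b₂ (θ : ℝ) : ℝ :=
  Real.cos θ * J.g₃ (Real.cos θ) (Real.sin θ) - Real.sin θ * J.f₃ (Real.cos θ) (Real.sin θ)

/-- The first Lyapunov coefficient, the mean of `a₂ - a₁ b₁ / ω` over the circle. -/
def lyap : ℝ :=
  (3 * J.f30 + J.f12 + J.g21 + 3 * J.g03) / 8 +
    (J.f11 * (J.f20 + J.f02) - J.g11 * (J.g20 + J.g02) - 2 * J.f20 * J.g20 + 2 * J.f02 * J.g02) /
      (8 * J.ω)

/-- Radial rate `r' / r`. -/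
def radial (θ r : ℝ) : ℝ := J.μ + r * J.a₁ θ + r ^ 2 * J.a₂ θ
/-- Angular rate `θ'`. -/
def angular (θ r : ℝ) : ℝ := J.ω + r * J.b₁ θ + r ^ 2 * J.b₂ θ

/-- The point with polar coordinates `(r, θ)`. -/
def polar (r θ : ℝ) : ℝ × ℝ := (r * Real.cos θ, r * Real.sin θ)

theorem hasDerivWithinAt_polar {r θ : ℝ → ℝ} {s : Set ℝ} {t : ℝ}
    (hr : HasDerivWithinAt r (r t * J.radial (θ t) (r t)) s t)
    (hθ : HasDerivWithinAt θ (J.angular (θ t) (r t)) s t) :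
    HasDerivWithinAt (fun t => polar (r t) (θ t)) (J.field (polar (r t) (θ t))) s t := by
  have h1 := hr.mul hθ.cos
  have h2 := hr.mul hθ.sin
  have hcs := Real.sin_sq_add_cos_sq (θ t)
  refine (h1.prodMk h2).congr_deriv ?_
  simp only [field, polar, radial, angular, a₁, a₂, b₁, b₂, f₂, g₂, f₃, g₃]
  generalize Real.cos (θ t) = c at *
  generalize Real.sin (θ t) = σ at *
  generalize r t = ρ
  have e : σ ^ 2 = 1 - c ^ 2 := by linarith
  ext
  · simp only
    linear_combination (ρ ^ 2 * (J.f20 * c ^ 2 + J.f11 * c * σ + J.f02 * σ ^ 2) +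
      ρ ^ 3 * (J.f30 * c ^ 3 + J.f21 * c ^ 2 * σ + J.f12 * c * σ ^ 2 + J.f03 * σ ^ 3)) * hcs
  · simp only
    linear_combination (ρ ^ 2 * (J.g20 * c ^ 2 + J.g11 * c * σ + J.g02 * σ ^ 2) +
      ρ ^ 3 * (J.g30 * c ^ 3 + J.g21 * c ^ 2 * σ + J.g12 * c * σ ^ 2 + J.g03 * σ ^ 3)) * hcs

/-! ### Averages over the circle -/

/-- The integral of `cos ^ i * sin ^ j` over a full turn. -/
def trigInt (i j : ℕ) : ℝ := ∫ θ in (0:ℝ)..2 * Real.pi, Real.cos θ ^ i * Real.sin θ ^ j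

/-- Integration by parts, from `d (cos ^ (i + 1) * sin ^ (j + 1))`. -/
theorem trigInt_rec (i j : ℕ) :
    (i + 1 : ℝ) * trigInt i (j + 2) = (j + 1 : ℝ) * trigInt (i + 2) j := by
  have hd : ∀ θ : ℝ, HasDerivAt (fun θ => Real.cos θ ^ (i + 1) * Real.sin θ ^ (j + 1))
      ((j + 1 : ℝ) * (Real.cos θ ^ (i + 2) * Real.sin θ ^ j) -
        (i + 1 : ℝ) * (Real.cos θ ^ i * Real.sin θ ^ (j + 2))) θ := by
    intro θ
    have hc : HasDerivAt (fun θ => Real.cos θ ^ (i + 1)) _ θ := (Real.hasDerivAt_cos θ).pow (i + 1)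
    have hs : HasDerivAt (fun θ => Real.sin θ ^ (j + 1)) _ θ := (Real.hasDerivAt_sin θ).pow (j + 1)
    refine (hc.mul hs).congr_deriv ?_
    simp only [Nat.add_sub_cancel]
    push_cast
    ring
  have hi : ∀ k l : ℕ, IntervalIntegrable (fun θ => Real.cos θ ^ k * Real.sin θ ^ l)
      MeasureTheory.volume 0 (2 * Real.pi) := fun k l =>
    Continuous.intervalIntegrable (by fun_prop) _ _
  have := intervalIntegral.integral_eq_sub_of_hasDerivAt (a := 0) (b := 2 * Real.pi)
    (fun θ _ => hd θ) (((hi _ _).const_mul _).sub ((hi _ _).const_mul _))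
  rw [intervalIntegral.integral_sub ((hi _ _).const_mul _) ((hi _ _).const_mul _),
    intervalIntegral.integral_const_mul, intervalIntegral.integral_const_mul] at this
  simp at this
  simp only [trigInt]
  linarith

theorem trigInt_add (i j : ℕ) : trigInt i j = trigInt (i + 2) j + trigInt i (j + 2) := by
  have hi : ∀ k l : ℕ, IntervalIntegrable (fun θ => Real.cos θ ^ k * Real.sin θ ^ l)
      MeasureTheory.volume 0 (2 * Real.pi) := fun k l =>
    Continuous.intervalIntegrable (by fun_prop) _ _
  rw [trigInt, trigInt, trigInt, ← intervalIntegral.integral_add (hi _ _) (hi _ _)]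
  refine intervalIntegral.integral_congr fun θ _ => ?_
  have := Real.sin_sq_add_cos_sq θ
  linear_combination -(Real.cos θ ^ i * Real.sin θ ^ j) * this

theorem trigInt_zero : trigInt 0 0 = 2 * Real.pi := by simp [trigInt]

/-- The integral of a binary form of degree four over the circle. -/
theorem integral_quartic (A B C D E : ℝ) :
    ∫ θ in (0:ℝ)..2 * Real.pi, (A * (Real.cos θ ^ 4 * Real.sin θ ^ 0) +
      B * (Real.cos θ ^ 3 * Real.sin θ ^ 1) + C * (Real.cos θ ^ 2 * Real.sin θ ^ 2) +
      D * (Real.cos θ ^ 1 * Real.sin θ ^ 3) + E * (Real.cos θ ^ 0 * Real.sin θ ^ 4)) =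
    2 * Real.pi * ((3 * A + C + 3 * E) / 8) := by
  have hi : ∀ k l : ℕ, IntervalIntegrable (fun θ => Real.cos θ ^ k * Real.sin θ ^ l)
      MeasureTheory.volume 0 (2 * Real.pi) := fun k l =>
    Continuous.intervalIntegrable (by fun_prop) _ _
  have hI : ∀ (c : ℝ) (k l : ℕ), IntervalIntegrable
      (fun θ => c * (Real.cos θ ^ k * Real.sin θ ^ l)) MeasureTheory.volume 0 (2 * Real.pi) :=
    fun c k l => (hi k l).const_mul c
  rw [intervalIntegral.integral_add ((((hI _ _ _).add (hI _ _ _)).add (hI _ _ _)).add (hI _ _ _))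
      (hI _ _ _),
    intervalIntegral.integral_add (((hI _ _ _).add (hI _ _ _)).add (hI _ _ _)) (hI _ _ _),
    intervalIntegral.integral_add ((hI _ _ _).add (hI _ _ _)) (hI _ _ _),
    intervalIntegral.integral_add (hI _ _ _) (hI _ _ _)]
  simp only [intervalIntegral.integral_const_mul]
  have e : ∀ k l : ℕ, (∫ θ in (0:ℝ)..2 * Real.pi, Real.cos θ ^ k * Real.sin θ ^ l) = trigInt k l :=
    fun k l => rfl
  simp only [e]
  have r1 := trigInt_rec 0 0
  have r2 := trigInt_rec 0 2
  have r3 := trigInt_rec 2 0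
  have r4 := trigInt_rec 1 1
  have r5 := trigInt_add 0 0
  have r6 := trigInt_add 2 0
  have r7 := trigInt_add 0 2
  have r8 := trigInt_add 1 1
  have r9 := trigInt_rec 0 1
  have z := trigInt_zero
  have o : trigInt 1 1 = 0 := by
    have := integral_sin_mul_cos₁ (a := 0) (b := 2 * Real.pi)
    simp only [trigInt, pow_one, mul_comm (Real.cos _), this]
    simp
  norm_num at r1 r2 r3 r4 r5 r6 r7 r8 r9
  have v22 : trigInt 2 2 = Real.pi / 4 := by linarith
  have v40 : trigInt 4 0 = 3 * Real.pi / 4 := by linarith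
  have v04 : trigInt 0 4 = 3 * Real.pi / 4 := by linarith
  have v31 : trigInt 3 1 = 0 := by linarith
  have v13 : trigInt 1 3 = 0 := by linarith
  rw [v22, v40, v04, v31, v13]
  ring

/-- The integral of a binary form of degree six over the circle. -/
theorem integral_sextic (A B C D E F G : ℝ) :
    ∫ θ in (0:ℝ)..2 * Real.pi, (A * (Real.cos θ ^ 6 * Real.sin θ ^ 0) +
      B * (Real.cos θ ^ 5 * Real.sin θ ^ 1) + C * (Real.cos θ ^ 4 * Real.sin θ ^ 2) +
      D * (Real.cos θ ^ 3 * Real.sin θ ^ 3) + E * (Real.cos θ ^ 2 * Real.sin θ ^ 4) +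
      F * (Real.cos θ ^ 1 * Real.sin θ ^ 5) + G * (Real.cos θ ^ 0 * Real.sin θ ^ 6)) =
    2 * Real.pi * ((5 * A + C + E + 5 * G) / 16) := by
  have hi : ∀ k l : ℕ, IntervalIntegrable (fun θ => Real.cos θ ^ k * Real.sin θ ^ l)
      MeasureTheory.volume 0 (2 * Real.pi) := fun k l =>
    Continuous.intervalIntegrable (by fun_prop) _ _
  have hI : ∀ (c : ℝ) (k l : ℕ), IntervalIntegrable
      (fun θ => c * (Real.cos θ ^ k * Real.sin θ ^ l)) MeasureTheory.volume 0 (2 * Real.pi) :=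
    fun c k l => (hi k l).const_mul c
  rw [intervalIntegral.integral_add ((((((hI _ _ _).add (hI _ _ _)).add (hI _ _ _)).add
      (hI _ _ _)).add (hI _ _ _)).add (hI _ _ _)) (hI _ _ _),
    intervalIntegral.integral_add (((((hI _ _ _).add (hI _ _ _)).add (hI _ _ _)).add
      (hI _ _ _)).add (hI _ _ _)) (hI _ _ _),
    intervalIntegral.integral_add ((((hI _ _ _).add (hI _ _ _)).add (hI _ _ _)).add (hI _ _ _))
      (hI _ _ _),
    intervalIntegral.integral_add (((hI _ _ _).add (hI _ _ _)).add (hI _ _ _)) (hI _ _ _),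
    intervalIntegral.integral_add ((hI _ _ _).add (hI _ _ _)) (hI _ _ _),
    intervalIntegral.integral_add (hI _ _ _) (hI _ _ _)]
  simp only [intervalIntegral.integral_const_mul]
  have e : ∀ k l : ℕ, (∫ θ in (0:ℝ)..2 * Real.pi, Real.cos θ ^ k * Real.sin θ ^ l) = trigInt k l :=
    fun k l => rfl
  simp only [e]
  have q1 := integral_quartic 1 0 0 0 0
  have q2 := integral_quartic 0 1 0 0 0
  have q3 := integral_quartic 0 0 1 0 0
  have q4 := integral_quartic 0 0 0 1 0
  have q5 := integral_quartic 0 0 0 0 1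
  simp only [zero_mul, one_mul, add_zero, zero_add, e] at q1 q2 q3 q4 q5
  have r1 := trigInt_rec 0 4
  have r2 := trigInt_rec 4 0
  have r3 := trigInt_rec 2 2
  have r4 := trigInt_rec 1 3
  have r5 := trigInt_rec 3 1
  have s1 := trigInt_add 4 0
  have s2 := trigInt_add 0 4
  have s3 := trigInt_add 2 2
  have s4 := trigInt_add 3 1
  have s5 := trigInt_add 1 3
  norm_num at r1 r2 r3 r4 r5 s1 s2 s3 s4 s5
  have v42 : trigInt 4 2 = Real.pi / 8 := by linarith
  have v24 : trigInt 2 4 = Real.pi / 8 := by linarith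
  have v60 : trigInt 6 0 = 5 * Real.pi / 8 := by linarith
  have v06 : trigInt 0 6 = 5 * Real.pi / 8 := by linarith
  have v51 : trigInt 5 1 = 0 := by linarith
  have v15 : trigInt 1 5 = 0 := by linarith
  have v33 : trigInt 3 3 = 0 := by linarith
  rw [v42, v24, v60, v06, v51, v15, v33]
  ring

/-- `lyap` is the mean of `a₂ - a₁ b₁ / ω`. -/
theorem integral_lyap :
    ∫ θ in (0:ℝ)..2 * Real.pi, (J.a₂ θ - J.a₁ θ * J.b₁ θ / J.ω) = 2 * Real.pi * J.lyap := by
  have h4 := integral_quartic J.f30 (J.f21 + J.g30) (J.f12 + J.g21) (J.f03 + J.g12) J.g03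
  have h6 := integral_sextic (J.f20 * J.g20)
    (J.f20 * (J.g11 - J.f20) + (J.f11 + J.g20) * J.g20)
    (J.f20 * (J.g02 - J.f11) + (J.f11 + J.g20) * (J.g11 - J.f20) + (J.f02 + J.g11) * J.g20)
    (-J.f20 * J.f02 + (J.f11 + J.g20) * (J.g02 - J.f11) + (J.f02 + J.g11) * (J.g11 - J.f20) +
      J.g02 * J.g20)
    (-(J.f11 + J.g20) * J.f02 + (J.f02 + J.g11) * (J.g02 - J.f11) + J.g02 * (J.g11 - J.f20))
    (-(J.f02 + J.g11) * J.f02 + J.g02 * (J.g02 - J.f11)) (-J.g02 * J.f02)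
  have e : ∀ θ, J.a₂ θ - J.a₁ θ * J.b₁ θ / J.ω =
      (J.f30 * (Real.cos θ ^ 4 * Real.sin θ ^ 0) +
      (J.f21 + J.g30) * (Real.cos θ ^ 3 * Real.sin θ ^ 1) +
      (J.f12 + J.g21) * (Real.cos θ ^ 2 * Real.sin θ ^ 2) +
      (J.f03 + J.g12) * (Real.cos θ ^ 1 * Real.sin θ ^ 3) +
      J.g03 * (Real.cos θ ^ 0 * Real.sin θ ^ 4)) - J.ω⁻¹ *
      ((J.f20 * J.g20) * (Real.cos θ ^ 6 * Real.sin θ ^ 0) +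
      (J.f20 * (J.g11 - J.f20) + (J.f11 + J.g20) * J.g20) *
        (Real.cos θ ^ 5 * Real.sin θ ^ 1) +
      (J.f20 * (J.g02 - J.f11) + (J.f11 + J.g20) * (J.g11 - J.f20) + (J.f02 + J.g11) * J.g20) *
        (Real.cos θ ^ 4 * Real.sin θ ^ 2) +
      (-J.f20 * J.f02 + (J.f11 + J.g20) * (J.g02 - J.f11) + (J.f02 + J.g11) * (J.g11 - J.f20) +
        J.g02 * J.g20) * (Real.cos θ ^ 3 * Real.sin θ ^ 3) +
      (-(J.f11 + J.g20) * J.f02 + (J.f02 + J.g11) * (J.g02 - J.f11) + J.g02 * (J.g11 - J.f20)) *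
        (Real.cos θ ^ 2 * Real.sin θ ^ 4) +
      (-(J.f02 + J.g11) * J.f02 + J.g02 * (J.g02 - J.f11)) * (Real.cos θ ^ 1 * Real.sin θ ^ 5) +
      (-J.g02 * J.f02) * (Real.cos θ ^ 0 * Real.sin θ ^ 6)) := by
    intro θ
    simp only [a₁, a₂, b₁, f₂, g₂, f₃, g₃]
    ring
  simp only [e]
  rw [intervalIntegral.integral_sub (Continuous.intervalIntegrable (by fun_prop) _ _)
    (Continuous.intervalIntegrable (by fun_prop) _ _), intervalIntegral.integral_const_mul, h4, h6,
    lyap]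
  field_simp
  ring

theorem continuous_a₁ : Continuous J.a₁ := by unfold a₁ f₂ g₂; fun_prop
theorem continuous_a₂ : Continuous J.a₂ := by unfold a₂ f₃ g₃; fun_prop
theorem continuous_b₁ : Continuous J.b₁ := by unfold b₁ f₂ g₂; fun_prop
theorem continuous_b₂ : Continuous J.b₂ := by unfold b₂ f₃ g₃; fun_prop

theorem periodic_a₁ (θ : ℝ) : J.a₁ (θ + 2 * Real.pi) = J.a₁ θ := by simp [a₁]
theorem periodic_a₂ (θ : ℝ) : J.a₂ (θ + 2 * Real.pi) = J.a₂ θ := by simp [a₂]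
theorem periodic_b₁ (θ : ℝ) : J.b₁ (θ + 2 * Real.pi) = J.b₁ θ := by simp [b₁]
theorem periodic_b₂ (θ : ℝ) : J.b₂ (θ + 2 * Real.pi) = J.b₂ θ := by simp [b₂]

theorem integral_a₁ : ∫ θ in (0:ℝ)..2 * Real.pi, J.a₁ θ = 0 := by
  have hodd : ∀ θ, J.a₁ (θ + Real.pi) = -J.a₁ θ := by
    intro θ; simp only [a₁, f₂, g₂, Real.cos_add_pi, Real.sin_add_pi]; ring
  have hi := fun a b => J.continuous_a₁.intervalIntegrable (μ := MeasureTheory.volume) a b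
  rw [← intervalIntegral.integral_add_adjacent_intervals (hi 0 Real.pi) (hi _ _)]
  have h2 : ∫ θ in Real.pi..2 * Real.pi, J.a₁ θ = ∫ θ in (0:ℝ)..Real.pi, J.a₁ (θ + Real.pi) := by
    rw [intervalIntegral.integral_comp_add_right]; congr 1 <;> ring
  rw [h2]
  simp [hodd]

/-- A continuous periodic function of mean zero has a periodic primitive. -/
theorem exists_periodic_primitive {g : ℝ → ℝ} (hg : Continuous g)
    (hper : ∀ θ, g (θ + 2 * Real.pi) = g θ) (h0 : ∫ θ in (0:ℝ)..2 * Real.pi, g θ = 0) {M : ℝ}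
    (hM : ∀ θ, |g θ| ≤ M) :
    ∃ H : ℝ → ℝ, (∀ θ, HasDerivAt H (g θ) θ) ∧ (∀ θ, H (θ + 2 * Real.pi) = H θ) ∧
      ∀ θ, |H θ| ≤ 2 * Real.pi * M := by
  have hP : Function.Periodic g (2 * Real.pi) := hper
  set H : ℝ → ℝ := fun θ => ∫ s in (0:ℝ)..θ, g s with hH
  have hHper : Function.Periodic H (2 * Real.pi) := by
    intro θ
    have hi := fun a b => hg.intervalIntegrable (μ := MeasureTheory.volume) a b
    simp only [hH]
    rw [← intervalIntegral.integral_add_adjacent_intervals (hi 0 θ) (hi _ _),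
      hP.intervalIntegral_add_eq θ 0, zero_add, h0, add_zero]
  refine ⟨H, fun θ => (hg.integral_hasStrictDerivAt 0 θ).hasDerivAt, hHper, fun θ => ?_⟩
  obtain ⟨y, hy, hyθ⟩ := hHper.exists_mem_Ico₀ Real.two_pi_pos θ
  rw [hyθ]
  have := intervalIntegral.norm_integral_le_of_norm_le_const (a := 0) (b := y) (f := g) (C := M)
    fun x _ => hM x
  have hM0 : 0 ≤ M := (abs_nonneg _).trans (hM 0)
  rw [Real.norm_eq_abs] at this
  refine this.trans ?_
  rw [sub_zero, abs_of_nonneg hy.1, mul_comm]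
  exact mul_le_mul_of_nonneg_right hy.2.le hM0

/-- The coefficients are bounded by `C` and the rotation speed is at least `w`. -/
structure Bounded (C w : ℝ) : Prop where
  ω_ge : w ≤ J.ω
  ω_le : J.ω ≤ C
  f20 : |J.f20| ≤ C
  f11 : |J.f11| ≤ C
  f02 : |J.f02| ≤ C
  g20 : |J.g20| ≤ C
  g11 : |J.g11| ≤ C
  g02 : |J.g02| ≤ C
  f30 : |J.f30| ≤ C
  f21 : |J.f21| ≤ C
  f12 : |J.f12| ≤ C
  f03 : |J.f03| ≤ C
  g30 : |J.g30| ≤ C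
  g21 : |J.g21| ≤ C
  g12 : |J.g12| ≤ C
  g03 : |J.g03| ≤ C

/-- The data that removes the oscillating parts of the radial equation up to second order: the
change of variable `log r + r H₁ + r² H₂`, with `q₁ = H₁'` and `q₂ = H₂'`. -/
structure Averaging (M : ℝ) (H₁ H₂ q₁ q₂ : ℝ → ℝ) : Prop where
  deriv₁ : ∀ θ, HasDerivAt H₁ (q₁ θ) θ
  deriv₂ : ∀ θ, HasDerivAt H₂ (q₂ θ) θ
  periodic₁ : ∀ θ, H₁ (θ + 2 * Real.pi) = H₁ θ
  periodic₂ : ∀ θ, H₂ (θ + 2 * Real.pi) = H₂ θ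
  eq₁ : ∀ θ, J.ω * q₁ θ = -J.a₁ θ
  eq₂ : ∀ θ, J.ω * q₂ θ = J.lyap - J.a₂ θ + J.a₁ θ * J.b₁ θ / J.ω - J.a₁ θ * H₁ θ
  le_H₁ : ∀ θ, |H₁ θ| ≤ M
  le_H₂ : ∀ θ, |H₂ θ| ≤ M
  le_q₁ : ∀ θ, |q₁ θ| ≤ M
  le_q₂ : ∀ θ, |q₂ θ| ≤ M
  le_a₁ : ∀ θ, |J.a₁ θ| ≤ M
  le_a₂ : ∀ θ, |J.a₂ θ| ≤ M
  le_b₁ : ∀ θ, |J.b₁ θ| ≤ M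
  le_b₂ : ∀ θ, |J.b₂ θ| ≤ M
  ω_le : J.ω ≤ M
  lyap_le : |J.lyap| ≤ M

theorem abs_mul_le {a b A B : ℝ} (ha : |a| ≤ A) (hb : |b| ≤ B) : |a * b| ≤ A * B := by
  rw [abs_mul]
  exact mul_le_mul ha hb (abs_nonneg _) ((abs_nonneg _).trans ha)

/-- The averaging data exist because `J.a₁` and the right-hand side of `eq₂` have mean zero, for the
latter by the formula for the Lyapunov coefficient; the bound `M` depends on the bounds of the
coefficients of `J` only. -/
theorem exists_averaging (C : ℝ) {w : ℝ} (hw : 0 < w) :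
    ∃ M ≥ 1, ∀ J : CubicJet, J.Bounded C w → ∃ H₁ H₂ q₁ q₂, J.Averaging M H₁ H₂ q₁ q₂ := by
  rcases lt_or_ge C 0 with hC | hC
  · exact ⟨1, le_rfl, fun J hJ => absurd (hJ.ω_ge.trans hJ.ω_le) (by linarith)⟩
  have hpi := Real.two_pi_pos
  -- successive bounds for the coefficients, `H₁'`, `H₁`, `H₂'` and `H₂`
  set M₀ : ℝ := 8 * C with hM₀
  set M₁ : ℝ := 2 * Real.pi * (M₀ / w) with hM₁
  set L : ℝ := C + 8 * C * C / w with hL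
  set M₂ : ℝ := (L + M₀ + M₀ * M₀ / w + M₀ * M₁) / w with hM₂
  set M₃ : ℝ := 2 * Real.pi * M₂ with hM₃
  have hM₀0 : 0 ≤ M₀ := by positivity
  have hM₁0 : 0 ≤ M₁ := by positivity
  have hL0 : 0 ≤ L := by positivity
  have hM₂0 : 0 ≤ M₂ := by positivity
  have hM₃0 : 0 ≤ M₃ := by positivity
  have hq0 : 0 ≤ M₀ / w := by positivity
  refine ⟨1 + C + M₀ + M₀ / w + M₁ + L + M₂ + M₃, by linarith, fun J hJ => ?_⟩
  have hω : 0 < J.ω := hw.trans_le hJ.ω_ge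
  have tri : ∀ {x y X Y : ℝ}, |x| ≤ X → |y| ≤ Y → |x + y| ≤ X + Y := fun hx hy =>
    (abs_add_le _ _).trans (add_le_add hx hy)
  have trs : ∀ {x y X Y : ℝ}, |x| ≤ X → |y| ≤ Y → |x - y| ≤ X + Y := fun hx hy =>
    (abs_sub _ _).trans (add_le_add hx hy)
  have hdiv : ∀ {x X : ℝ}, |x| ≤ X → |x / J.ω| ≤ X / w := by
    intro x X hx
    rw [abs_div, abs_of_pos hω]
    exact div_le_div₀ ((abs_nonneg _).trans hx) hx hw hJ.ω_ge
  have hc : ∀ θ k, |Real.cos θ ^ k| ≤ 1 := fun θ k => by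
    rw [abs_pow]; exact pow_le_one₀ (abs_nonneg _) (Real.abs_cos_le_one θ)
  have hs : ∀ θ k, |Real.sin θ ^ k| ≤ 1 := fun θ k => by
    rw [abs_pow]; exact pow_le_one₀ (abs_nonneg _) (Real.abs_sin_le_one θ)
  have hmon : ∀ {x : ℝ} (θ : ℝ) (k l : ℕ), |x| ≤ C → |x * (Real.cos θ ^ k * Real.sin θ ^ l)| ≤ C := by
    intro x θ k l hx
    have := abs_mul_le hx (abs_mul_le (hc θ k) (hs θ l))
    simpa using this
  have ha₁ : ∀ θ, |J.a₁ θ| ≤ M₀ := by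
    intro θ
    have e : J.a₁ θ = J.f20 * (Real.cos θ ^ 3 * Real.sin θ ^ 0) + J.f11 * (Real.cos θ ^ 2 * Real.sin θ ^ 1) +
      J.f02 * (Real.cos θ ^ 1 * Real.sin θ ^ 2) + J.g20 * (Real.cos θ ^ 2 * Real.sin θ ^ 1) +
      J.g11 * (Real.cos θ ^ 1 * Real.sin θ ^ 2) + J.g02 * (Real.cos θ ^ 0 * Real.sin θ ^ 3) := by
      simp only [a₁, f₂, g₂]; ring
    rw [e]
    refine (tri (tri (tri (tri (tri (hmon θ 3 0 hJ.f20) (hmon θ 2 1 hJ.f11)) (hmon θ 1 2 hJ.f02))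
      (hmon θ 2 1 hJ.g20)) (hmon θ 1 2 hJ.g11)) (hmon θ 0 3 hJ.g02)).trans (by linarith)
  have hb₁ : ∀ θ, |J.b₁ θ| ≤ M₀ := by
    intro θ
    have e : J.b₁ θ = J.g20 * (Real.cos θ ^ 3 * Real.sin θ ^ 0) + J.g11 * (Real.cos θ ^ 2 * Real.sin θ ^ 1) +
      J.g02 * (Real.cos θ ^ 1 * Real.sin θ ^ 2) - J.f20 * (Real.cos θ ^ 2 * Real.sin θ ^ 1) -
      J.f11 * (Real.cos θ ^ 1 * Real.sin θ ^ 2) - J.f02 * (Real.cos θ ^ 0 * Real.sin θ ^ 3) := by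
      simp only [b₁, f₂, g₂]; ring
    rw [e]
    refine (trs (trs (trs (tri (tri (hmon θ 3 0 hJ.g20) (hmon θ 2 1 hJ.g11)) (hmon θ 1 2 hJ.g02))
      (hmon θ 2 1 hJ.f20)) (hmon θ 1 2 hJ.f11)) (hmon θ 0 3 hJ.f02)).trans (by linarith)
  have ha₂ : ∀ θ, |J.a₂ θ| ≤ M₀ := by
    intro θ
    have e : J.a₂ θ = J.f30 * (Real.cos θ ^ 4 * Real.sin θ ^ 0) + J.f21 * (Real.cos θ ^ 3 * Real.sin θ ^ 1) +
      J.f12 * (Real.cos θ ^ 2 * Real.sin θ ^ 2) + J.f03 * (Real.cos θ ^ 1 * Real.sin θ ^ 3) +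
      J.g30 * (Real.cos θ ^ 3 * Real.sin θ ^ 1) + J.g21 * (Real.cos θ ^ 2 * Real.sin θ ^ 2) +
      J.g12 * (Real.cos θ ^ 1 * Real.sin θ ^ 3) + J.g03 * (Real.cos θ ^ 0 * Real.sin θ ^ 4) := by
      simp only [a₂, f₃, g₃]; ring
    rw [e]
    refine (tri (tri (tri (tri (tri (tri (tri (hmon θ 4 0 hJ.f30) (hmon θ 3 1 hJ.f21))
      (hmon θ 2 2 hJ.f12)) (hmon θ 1 3 hJ.f03)) (hmon θ 3 1 hJ.g30)) (hmon θ 2 2 hJ.g21))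
      (hmon θ 1 3 hJ.g12)) (hmon θ 0 4 hJ.g03)).trans (by linarith)
  have hb₂ : ∀ θ, |J.b₂ θ| ≤ M₀ := by
    intro θ
    have e : J.b₂ θ = J.g30 * (Real.cos θ ^ 4 * Real.sin θ ^ 0) + J.g21 * (Real.cos θ ^ 3 * Real.sin θ ^ 1) +
      J.g12 * (Real.cos θ ^ 2 * Real.sin θ ^ 2) + J.g03 * (Real.cos θ ^ 1 * Real.sin θ ^ 3) -
      J.f30 * (Real.cos θ ^ 3 * Real.sin θ ^ 1) - J.f21 * (Real.cos θ ^ 2 * Real.sin θ ^ 2) -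
      J.f12 * (Real.cos θ ^ 1 * Real.sin θ ^ 3) - J.f03 * (Real.cos θ ^ 0 * Real.sin θ ^ 4) := by
      simp only [b₂, f₃, g₃]; ring
    rw [e]
    refine (trs (trs (trs (trs (tri (tri (tri (hmon θ 4 0 hJ.g30) (hmon θ 3 1 hJ.g21))
      (hmon θ 2 2 hJ.g12)) (hmon θ 1 3 hJ.g03)) (hmon θ 3 1 hJ.f30)) (hmon θ 2 2 hJ.f21))
      (hmon θ 1 3 hJ.f12)) (hmon θ 0 4 hJ.f03)).trans (by linarith)
  have hlyap : |J.lyap| ≤ L := by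
    have h1 : |(3 * J.f30 + J.f12 + J.g21 + 3 * J.g03) / 8| ≤ C := by
      have a1 := abs_le.1 hJ.f30
      have a2 := abs_le.1 hJ.f12
      have a3 := abs_le.1 hJ.g21
      have a4 := abs_le.1 hJ.g03
      rw [abs_le]; constructor <;> linarith [a1.1, a1.2, a2.1, a2.2, a3.1, a3.2, a4.1, a4.2]
    have h2 : |J.f11 * (J.f20 + J.f02) - J.g11 * (J.g20 + J.g02) - 2 * J.f20 * J.g20 +
        2 * J.f02 * J.g02| ≤ 8 * C * C := by
      have := tri (trs (trs (abs_mul_le hJ.f11 (tri hJ.f20 hJ.f02))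
        (abs_mul_le hJ.g11 (tri hJ.g20 hJ.g02)))
        (abs_mul_le (abs_mul_le (abs_two.le) hJ.f20) hJ.g20))
        (abs_mul_le (abs_mul_le (abs_two.le) hJ.f02) hJ.g02)
      exact this.trans (by nlinarith)
    have h3 := hdiv h2
    refine (tri h1 (y := _ / (8 * J.ω)) (Y := 8 * C * C / w) ?_).trans le_rfl
    refine le_trans ?_ h3
    rw [abs_div, abs_div]
    refine div_le_div_of_nonneg_left (abs_nonneg _) (abs_pos.2 hω.ne') ?_
    rw [abs_of_pos hω, abs_of_pos (by positivity)]; linarith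
  have hq₁ : ∀ θ, |-J.a₁ θ / J.ω| ≤ M₀ / w := fun θ => hdiv (by rw [abs_neg]; exact ha₁ θ)
  obtain ⟨H₁, hd₁, hp₁, hb₁'⟩ := exists_periodic_primitive (g := fun θ => -J.a₁ θ / J.ω)
    (J.continuous_a₁.neg.div_const _) (fun θ => by rw [J.periodic_a₁])
    (by rw [intervalIntegral.integral_div, intervalIntegral.integral_neg, J.integral_a₁]; simp) hq₁
  have hH₁c : Continuous H₁ := continuous_iff_continuousAt.2 fun θ => (hd₁ θ).continuousAt
  set q₂ : ℝ → ℝ := fun θ =>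
    (J.lyap - J.a₂ θ + J.a₁ θ * J.b₁ θ / J.ω - J.a₁ θ * H₁ θ) / J.ω with hq₂
  have hq₂b : ∀ θ, |q₂ θ| ≤ M₂ := fun θ =>
    hdiv (trs (tri (trs hlyap (ha₂ θ)) (hdiv (abs_mul_le (ha₁ θ) (hb₁ θ))))
      (abs_mul_le (ha₁ θ) (hb₁' θ)))
  have hq₂c : Continuous q₂ :=
    (((continuous_const.sub J.continuous_a₂).add
      ((J.continuous_a₁.mul J.continuous_b₁).div_const _)).sub
      (J.continuous_a₁.mul hH₁c)).div_const _
  -- `a₁ H₁ = -ω H₁ H₁'` has mean zero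
  have hmean : ∫ θ in (0:ℝ)..2 * Real.pi, J.a₁ θ * H₁ θ = 0 := by
    have hd : ∀ θ, HasDerivAt (fun θ => -(J.ω / 2) * H₁ θ ^ 2) (J.a₁ θ * H₁ θ) θ := by
      intro θ
      have h1 : HasDerivAt (fun θ => H₁ θ ^ 2) _ θ := (hd₁ θ).pow 2
      refine (h1.const_mul (-(J.ω / 2))).congr_deriv ?_
      have := hω.ne'
      field_simp
      ring
    rw [intervalIntegral.integral_eq_sub_of_hasDerivAt (fun θ _ => hd θ)
      ((J.continuous_a₁.mul hH₁c).intervalIntegrable _ _)]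
    have := hp₁ 0
    rw [zero_add] at this
    rw [this]; ring
  have hint : ∫ θ in (0:ℝ)..2 * Real.pi, q₂ θ = 0 := by
    have e : ∀ θ, q₂ θ = (J.lyap - (J.a₂ θ - J.a₁ θ * J.b₁ θ / J.ω) - J.a₁ θ * H₁ θ) / J.ω :=
      fun θ => by simp only [hq₂]; ring
    simp only [e]
    have c1 : Continuous fun θ => J.a₂ θ - J.a₁ θ * J.b₁ θ / J.ω :=
      J.continuous_a₂.sub ((J.continuous_a₁.mul J.continuous_b₁).div_const _)
    have c2 : Continuous fun θ => J.lyap - (J.a₂ θ - J.a₁ θ * J.b₁ θ / J.ω) :=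
      continuous_const.sub c1
    have c3 : Continuous fun θ => J.a₁ θ * H₁ θ := J.continuous_a₁.mul hH₁c
    rw [intervalIntegral.integral_div, intervalIntegral.integral_sub
      (c2.intervalIntegrable _ _) (c3.intervalIntegrable _ _), intervalIntegral.integral_sub
      (continuous_const.intervalIntegrable _ _) (c1.intervalIntegrable _ _), J.integral_lyap, hmean]
    simp
  obtain ⟨H₂, hd₂, hp₂, hb₂'⟩ := exists_periodic_primitive hq₂c (fun θ => by
    simp only [hq₂, J.periodic_a₁, J.periodic_a₂, J.periodic_b₁, hp₁]) hint hq₂b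
  exact ⟨H₁, H₂, _, q₂,
    { deriv₁ := hd₁
      deriv₂ := hd₂
      periodic₁ := hp₁
      periodic₂ := hp₂
      eq₁ := fun θ => by field_simp
      eq₂ := fun θ => by simp only [hq₂]; field_simp
      le_H₁ := fun θ => (hb₁' θ).trans (by linarith)
      le_H₂ := fun θ => (hb₂' θ).trans (by linarith)
      le_q₁ := fun θ => (hq₁ θ).trans (by linarith)
      le_q₂ := fun θ => (hq₂b θ).trans (by linarith)
      le_a₁ := fun θ => (ha₁ θ).trans (by linarith)
      le_a₂ := fun θ => (ha₂ θ).trans (by linarith)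
      le_b₁ := fun θ => (hb₁ θ).trans (by linarith)
      le_b₂ := fun θ => (hb₂ θ).trans (by linarith)
      ω_le := hJ.ω_le.trans (by linarith)
      lyap_le := hlyap.trans (by linarith) }⟩

end CubicJet

/-! ### The averaged radial equation -/

namespace CubicJet

variable {J : CubicJet} {M : ℝ} {H₁ H₂ q₁ q₂ : ℝ → ℝ}

/-- The change of variable `log r + r H₁ + r² H₂` written in `u = log r`. -/
def averaged (H₁ H₂ : ℝ → ℝ) (θ u : ℝ) : ℝ :=
  u + Real.exp u * H₁ θ + Real.exp u ^ 2 * H₂ θ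

/-- The time derivative of `averaged` along the field. -/
def averagedRate (J : CubicJet) (H₁ H₂ q₁ q₂ : ℝ → ℝ) (θ r : ℝ) : ℝ :=
  J.radial θ r * (1 + r * H₁ θ + 2 * r ^ 2 * H₂ θ) +
    J.angular θ r * (r * q₁ θ + r ^ 2 * q₂ θ)

/-- Coefficient of `r³` in `averagedRate`. -/
def c₃ (J : CubicJet) (H₁ H₂ q₁ q₂ : ℝ → ℝ) (θ : ℝ) : ℝ :=
  2 * J.a₁ θ * H₂ θ + J.a₂ θ * H₁ θ + J.b₁ θ * q₂ θ + J.b₂ θ * q₁ θ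

/-- Coefficient of `r⁴` in `averagedRate`. -/
def c₄ (J : CubicJet) (H₂ q₂ : ℝ → ℝ) (θ : ℝ) : ℝ := 2 * J.a₂ θ * H₂ θ + J.b₂ θ * q₂ θ

/-- After averaging, the oscillating terms of order `r` and `r²` are gone, up to multiples of
`μ`. -/
theorem averagedRate_eq (h : J.Averaging M H₁ H₂ q₁ q₂) (hω : 0 < J.ω) (θ r : ℝ) :
    averagedRate J H₁ H₂ q₁ q₂ θ r = J.μ * (1 + r * H₁ θ + 2 * r ^ 2 * H₂ θ) + J.lyap * r ^ 2 +
      c₃ J H₁ H₂ q₁ q₂ θ * r ^ 3 + c₄ J H₂ q₂ θ * r ^ 4 := by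
  have e1 := h.eq₁ θ
  have e2 := h.eq₂ θ
  have e3 : q₁ θ = -(J.a₁ θ / J.ω) := by field_simp; linarith
  have e4 : J.b₁ θ * q₁ θ = -(J.a₁ θ * J.b₁ θ / J.ω) := by rw [e3]; ring
  simp only [averagedRate, radial, angular, c₃, c₄]
  linear_combination r * e1 + r ^ 2 * e2 + r ^ 2 * e4

theorem abs_c₃_le (h : J.Averaging M H₁ H₂ q₁ q₂) (θ : ℝ) :
    |c₃ J H₁ H₂ q₁ q₂ θ| ≤ 5 * M ^ 2 := by
  have h1 := abs_mul_le (h.le_a₁ θ) (h.le_H₂ θ)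
  have h2 := abs_mul_le (h.le_a₂ θ) (h.le_H₁ θ)
  have h3 := abs_mul_le (h.le_b₁ θ) (h.le_q₂ θ)
  have h4 := abs_mul_le (h.le_b₂ θ) (h.le_q₁ θ)
  rw [abs_le] at *
  simp only [c₃]
  constructor <;> nlinarith [h1.1, h1.2, h2.1, h2.2, h3.1, h3.2, h4.1, h4.2]

theorem abs_c₄_le (h : J.Averaging M H₁ H₂ q₁ q₂) (θ : ℝ) :
    |c₄ J H₂ q₂ θ| ≤ 3 * M ^ 2 := by
  have h2 := abs_mul_le (h.le_a₂ θ) (h.le_H₂ θ)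
  have h4 := abs_mul_le (h.le_b₂ θ) (h.le_q₂ θ)
  rw [abs_le] at *
  simp only [c₄]
  constructor <;> nlinarith [h2.1, h2.2, h4.1, h4.2]

/-- If the focus is weakly stable and the Lyapunov coefficient negative, `averaged` decreases along
the field near the origin. -/
theorem averagedRate_neg (h : J.Averaging M H₁ H₂ q₁ q₂) (hM : 1 ≤ M) (hω : 0 < J.ω) {l : ℝ}
    (hJl : J.lyap ≤ -l) (hμ : J.μ ≤ 0) {θ r : ℝ} (hr : 0 < r) (hr1 : 4 * M * r ≤ 1)
    (hr2 : 8 * M ^ 2 * r < l) : averagedRate J H₁ H₂ q₁ q₂ θ r < 0 := by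
  rw [averagedRate_eq h hω]
  have b1 := abs_le.1 (h.le_H₁ θ)
  have b2 := abs_le.1 (h.le_H₂ θ)
  have b3 := abs_le.1 (abs_c₃_le h θ)
  have b4 := abs_le.1 (abs_c₄_le h θ)
  have hr1' : r ≤ 1 := by nlinarith
  have hpos : 0 ≤ 1 + r * H₁ θ + 2 * r ^ 2 * H₂ θ := by
    have : -(M * r) ≤ r * H₁ θ := by nlinarith [b1.1]
    have : -(M * r ^ 2) ≤ r ^ 2 * H₂ θ := by nlinarith [b2.1, sq_nonneg r]
    have : M * r ^ 2 ≤ M * r := by nlinarith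
    nlinarith
  have h1 := mul_nonpos_of_nonpos_of_nonneg hμ hpos
  have h2 : c₃ J H₁ H₂ q₁ q₂ θ * r ^ 3 ≤ 5 * M ^ 2 * r ^ 3 :=
    mul_le_mul_of_nonneg_right b3.2 (by positivity)
  have h3 : c₄ J H₂ q₂ θ * r ^ 4 ≤ 3 * M ^ 2 * r ^ 4 :=
    mul_le_mul_of_nonneg_right b4.2 (by positivity)
  have h4 : 3 * M ^ 2 * r ^ 4 ≤ 3 * M ^ 2 * r ^ 3 :=
    mul_le_mul_of_nonneg_left (pow_le_pow_of_le_one hr.le hr1' (by norm_num)) (by positivity)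
  have h5 : J.lyap * r ^ 2 ≤ -l * r ^ 2 := mul_le_mul_of_nonneg_right hJl (by positivity)
  have h6 : 8 * M ^ 2 * r * r ^ 2 < l * r ^ 2 := mul_lt_mul_of_pos_right hr2 (by positivity)
  nlinarith

theorem radial_bounds (h : J.Averaging M H₁ H₂ q₁ q₂) {θ r : ℝ} (hr : 0 < r) (hr1 : r ≤ 1) :
    |J.angular θ r - J.ω| ≤ 2 * M * r := by
  have b1 := abs_le.1 (h.le_b₁ θ)
  have b2 := abs_le.1 (h.le_b₂ θ)
  have h2 : r ^ 2 ≤ r := by nlinarith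
  have hM : 0 ≤ M := by linarith
  have e1 : |r * J.b₁ θ| ≤ r * M := by
    rw [abs_mul, abs_of_pos hr]; exact mul_le_mul_of_nonneg_left (h.le_b₁ θ) hr.le
  have e2 : |r ^ 2 * J.b₂ θ| ≤ r * M := by
    rw [abs_mul, abs_of_nonneg (sq_nonneg r)]
    exact mul_le_mul h2 (h.le_b₂ θ) (abs_nonneg _) hr.le
  have : J.angular θ r - J.ω = r * J.b₁ θ + r ^ 2 * J.b₂ θ := by simp only [angular]; ring
  rw [this]
  exact (abs_add_le _ _).trans (by linarith)

theorem field_polar (J : CubicJet) (r θ : ℝ) :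
    J.field (polar r θ) =
      (r * (J.radial θ r * Real.cos θ - J.angular θ r * Real.sin θ),
        r * (J.radial θ r * Real.sin θ + J.angular θ r * Real.cos θ)) := by
  have hcs := Real.sin_sq_add_cos_sq θ
  simp only [field, polar, radial, angular, a₁, a₂, b₁, b₂, f₂, g₂, f₃, g₃]
  generalize Real.cos θ = c at *
  generalize Real.sin θ = σ at *
  ext
  · simp only
    linear_combination -(r ^ 2 * (J.f20 * c ^ 2 + J.f11 * c * σ + J.f02 * σ ^ 2) +
      r ^ 3 * (J.f30 * c ^ 3 + J.f21 * c ^ 2 * σ + J.f12 * c * σ ^ 2 + J.f03 * σ ^ 3)) * hcs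
  · simp only
    linear_combination -(r ^ 2 * (J.g20 * c ^ 2 + J.g11 * c * σ + J.g02 * σ ^ 2) +
      r ^ 3 * (J.g30 * c ^ 3 + J.g21 * c ^ 2 * σ + J.g12 * c * σ ^ 2 + J.g03 * σ ^ 3)) * hcs

/-! ### Absence of small compact invariant sets -/

/-- The plane `ℝ × ℝ` as the complex plane. -/
def toC (y : ℝ × ℝ) : ℂ := y.1 + y.2 * Complex.I

theorem continuous_toC : Continuous toC := by unfold toC; fun_prop

theorem toC_eq_zero {y : ℝ × ℝ} : toC y = 0 ↔ y = 0 := by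
  simp [toC, Complex.ext_iff, Prod.ext_iff]

theorem sq_norm_toC (y : ℝ × ℝ) : ‖toC y‖ ^ 2 = y.1 ^ 2 + y.2 ^ 2 := by
  rw [← Complex.normSq_eq_norm_sq, Complex.normSq_apply]; simp [toC]; ring

theorem toC_injective : Function.Injective toC := fun x y h => by
  simp [toC, Complex.ext_iff] at h; exact Prod.ext h.1 h.2

theorem toC_polar (r θ : ℝ) : toC (polar r θ) = r * Complex.exp (θ * Complex.I) := by
  rw [Complex.exp_mul_I, toC, polar]; push_cast; ring

theorem polar_toC (y : ℝ × ℝ) : polar ‖toC y‖ (toC y).arg = y := by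
  apply toC_injective
  rw [toC_polar, Complex.norm_mul_exp_arg_mul_I]

/-- A continuous `2π`-periodic function of the argument is continuous off the origin. -/
theorem continuousAt_comp_arg {H : ℝ → ℝ} (hH : Continuous H)
    (hper : ∀ θ, H (θ + 2 * Real.pi) = H θ) {z : ℂ} (hz : z ≠ 0) :
    ContinuousAt (fun z : ℂ => H z.arg) z := by
  have hP : Function.Periodic H (2 * Real.pi) := hper
  have hl : Continuous (hP.lift : Real.Angle → ℝ) := by
    exact continuous_coinduced_dom.2 hH
  have := hl.continuousAt.comp (Complex.continuousAt_arg_coe_angle hz)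
  exact this

theorem periodic_congr {H : ℝ → ℝ} (hper : ∀ θ, H (θ + 2 * Real.pi) = H θ) {θ φ : ℝ}
    (h : (θ : Real.Angle) = φ) : H θ = H φ := by
  obtain ⟨n, hn⟩ := Real.Angle.angle_eq_iff_two_pi_dvd_sub.1 h
  have := (show Function.Periodic H (2 * Real.pi) from hper).int_mul n φ
  rw [← this]; congr 1; linarith

/-- With a negative Lyapunov coefficient and a weakly stable focus, a small compact invariant set is
contained in the equilibrium: at a point of the set where `exp averaged` is largest its
derivative along the field would have to vanish. -/
theorem compact_invariant_subset (C : ℝ) {w l : ℝ} (hw : 0 < w) (hl : 0 < l) :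
    ∃ r₀ > 0, ∀ J : CubicJet, J.Bounded C w → J.lyap ≤ -l → J.μ ≤ 0 → ∀ K : Set (ℝ × ℝ),
      IsCompact K → (∀ y ∈ K, ‖toC y‖ < r₀) →
      (∀ y ∈ K, ∃ x : ℝ → ℝ × ℝ, x 0 = y ∧ HasDerivAt x (J.field y) 0 ∧ ∀ t, x t ∈ K) →
      K ⊆ {0} := by
  obtain ⟨M, hM, hav⟩ := exists_averaging C hw
  refine ⟨min (1 / (4 * M)) (l / (8 * M ^ 2)), by positivity, ?_⟩
  intro J hJ hJl hμ K hK hKr hinv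
  obtain ⟨H₁, H₂, q₁, q₂, h⟩ := hav J hJ
  have hω : 0 < J.ω := hw.trans_le hJ.ω_ge
  have hH₁ : Continuous H₁ := continuous_iff_continuousAt.2 fun θ => (h.deriv₁ θ).continuousAt
  have hH₂ : Continuous H₂ := continuous_iff_continuousAt.2 fun θ => (h.deriv₂ θ).continuousAt
  set W : ℂ → ℝ := fun z => ‖z‖ * Real.exp (‖z‖ * H₁ z.arg + ‖z‖ ^ 2 * H₂ z.arg) with hW
  have hWc : Continuous W := by
    rw [continuous_iff_continuousAt]
    intro z
    rcases eq_or_ne z 0 with rfl | hz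
    · have h1 : ∀ z : ℂ, |‖z‖ * H₁ z.arg + ‖z‖ ^ 2 * H₂ z.arg| ≤ ‖z‖ * M + ‖z‖ ^ 2 * M := by
        intro z
        refine (abs_add_le _ _).trans (add_le_add ?_ ?_)
        · rw [abs_mul, abs_norm]; exact mul_le_mul_of_nonneg_left (h.le_H₁ _) (norm_nonneg _)
        · rw [abs_mul, abs_of_nonneg (sq_nonneg _)]
          exact mul_le_mul_of_nonneg_left (h.le_H₂ _) (sq_nonneg _)
      have h2 : Tendsto (fun z : ℂ => ‖z‖ * Real.exp (‖z‖ * M + ‖z‖ ^ 2 * M)) (𝓝 0) (𝓝 0) := by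
        have : Continuous fun z : ℂ => ‖z‖ * Real.exp (‖z‖ * M + ‖z‖ ^ 2 * M) := by fun_prop
        simpa using this.tendsto 0
      have h0 : W 0 = 0 := by simp [hW]
      rw [ContinuousAt, h0]
      refine squeeze_zero (fun z => by positivity) (fun z => ?_) h2
      exact mul_le_mul_of_nonneg_left (Real.exp_le_exp.2 ((le_abs_self _).trans (h1 z)))
        (norm_nonneg _)
    · have e1 := continuousAt_comp_arg hH₁ h.periodic₁ hz
      have e2 := continuousAt_comp_arg hH₂ h.periodic₂ hz
      have e0 : ContinuousAt (fun z : ℂ => ‖z‖) z := continuous_norm.continuousAt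
      exact e0.mul ((e0.mul e1).add ((e0.pow 2).mul e2)).rexp
  intro y₀ hy₀
  by_contra hne
  have hne : y₀ ≠ 0 := hne
  obtain ⟨y, hy, hmax⟩ := hK.exists_isMaxOn ⟨y₀, hy₀⟩ (hWc.comp continuous_toC).continuousOn
  have hWpos : ∀ y : ℝ × ℝ, y ≠ 0 → 0 < W (toC y) := fun y hy =>
    mul_pos (norm_pos_iff.2 (mt toC_eq_zero.1 hy)) (Real.exp_pos _)
  have hyne : y ≠ 0 := by
    rintro rfl
    have h1 : W (toC y₀) ≤ W (toC 0) := hmax hy₀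
    have h2 : W (toC 0) = 0 := by simp [hW, toC]
    linarith [hWpos y₀ hne]
  set z := toC y with hz
  have hz0 : z ≠ 0 := mt toC_eq_zero.1 hyne
  obtain ⟨x, hx0, hxd, hxK⟩ := hinv y hy
  set r := ‖z‖ with hr
  set θ := z.arg with hθ
  have hrpos : 0 < r := norm_pos_iff.2 hz0
  -- the logarithm of the trajectory, along a continuous branch near `t = 0`
  set ℓ : ℝ → ℂ := fun t => Complex.log (toC (x t) / z) with hℓ
  have hfield : toC (J.field y) = z * (J.radial θ r + J.angular θ r * Complex.I) := by
    have e1 : y = polar r θ := (polar_toC y).symm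
    have e2 : z = r * Complex.exp (θ * Complex.I) := by
      rw [hz]; conv_lhs => rw [e1]
      exact toC_polar r θ
    rw [e2]
    conv_lhs => rw [e1]
    rw [field_polar, Complex.exp_mul_I, toC]
    push_cast
    linear_combination -(r * J.angular θ r * Complex.sin θ : ℂ) * Complex.I_sq
  have hxC : HasDerivAt (fun t => toC (x t)) (toC (J.field y)) 0 := by
    have h1 : HasDerivAt (fun t => (x t).1) (J.field y).1 0 := (ContinuousLinearMap.fst ℝ ℝ ℝ).hasFDerivAt.comp_hasDerivAt 0 hxd
    have h2 : HasDerivAt (fun t => (x t).2) (J.field y).2 0 := (ContinuousLinearMap.snd ℝ ℝ ℝ).hasFDerivAt.comp_hasDerivAt 0 hxd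
    exact h1.ofReal_comp.add (h2.ofReal_comp.mul_const _)
  have hℓd : HasDerivAt ℓ (J.radial θ r + J.angular θ r * Complex.I) 0 := by
    have h1 := hxC.div_const z
    have h2 := h1.clog_real (by rw [hx0, ← hz, div_self hz0]; exact Complex.one_mem_slitPlane)
    refine h2.congr_deriv ?_
    rw [hx0, hfield, ← hz]
    field_simp
  set u : ℝ → ℝ := fun t => Real.log r + (ℓ t).re with hu
  set ϑ : ℝ → ℝ := fun t => θ + (ℓ t).im with hϑ
  have hud : HasDerivAt u (J.radial θ r) 0 := by
    have : HasDerivAt (fun t => (ℓ t).re) (J.radial θ r) 0 := by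
      have := Complex.reCLM.hasFDerivAt.comp_hasDerivAt 0 hℓd
      exact this.congr_deriv (by simp)
    exact this.const_add _
  have hϑd : HasDerivAt ϑ (J.angular θ r) 0 := by
    have : HasDerivAt (fun t => (ℓ t).im) (J.angular θ r) 0 := by
      have := Complex.imCLM.hasFDerivAt.comp_hasDerivAt 0 hℓd
      exact this.congr_deriv (by simp)
    exact this.const_add _
  have hℓ0 : ℓ 0 = 0 := by simp only [hℓ]; rw [hx0, ← hz, div_self hz0, Complex.log_one]
  have hu0 : u 0 = Real.log r := by simp [hu, hℓ0]
  have hϑ0 : ϑ 0 = θ := by simp [hϑ, hℓ0]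
  have hexp0 : Real.exp (u 0) = r := by rw [hu0, Real.exp_log hrpos]
  have hΦ : HasDerivAt (fun t => averaged H₁ H₂ (ϑ t) (u t)) (averagedRate J H₁ H₂ q₁ q₂ θ r) 0 := by
    have d1 : HasDerivAt (fun t => H₁ (ϑ t)) (q₁ θ * J.angular θ r) 0 :=
      HasDerivAt.comp (h₂ := H₁) 0 (by rw [hϑ0]; exact h.deriv₁ θ) hϑd
    have d2 : HasDerivAt (fun t => H₂ (ϑ t)) (q₂ θ * J.angular θ r) 0 :=
      HasDerivAt.comp (h₂ := H₂) 0 (by rw [hϑ0]; exact h.deriv₂ θ) hϑd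
    have d3 : HasDerivAt (fun t => Real.exp (u t)) (r * J.radial θ r) 0 := by
      have := hud.exp; rwa [hexp0] at this
    have d4 : HasDerivAt (fun t => Real.exp (u t) ^ 2) (2 * r * (r * J.radial θ r)) 0 := by
      have := d3.pow 2
      rw [hexp0] at this
      refine HasDerivAt.congr_deriv this ?_
      norm_num
    refine ((hud.add (d3.mul d1)).add (d4.mul d2)).congr_deriv ?_
    rw [hexp0, hϑ0, averagedRate]
    ring
  have hloc : ∀ᶠ t in 𝓝 (0:ℝ), W (toC (x t)) = Real.exp (averaged H₁ H₂ (ϑ t) (u t)) := by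
    have hne' : ∀ᶠ t in 𝓝 (0:ℝ), toC (x t) ≠ 0 :=
      hxC.continuousAt.eventually_ne (by rw [hx0]; exact hz0)
    filter_upwards [hne'] with t ht
    have hq : toC (x t) / z ≠ 0 := div_ne_zero ht hz0
    have e1 : Real.exp (u t) = ‖toC (x t)‖ := by
      rw [hu]; simp only
      rw [Real.exp_add, Real.exp_log hrpos, hℓ]
      simp only [Complex.log_re]
      rw [Real.exp_log (norm_pos_iff.2 hq), norm_div, ← hr]
      field_simp
    have e2 : ((toC (x t)).arg : Real.Angle) = (ϑ t : Real.Angle) := by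
      have : toC (x t) = z * (toC (x t) / z) := by field_simp
      rw [hϑ]; simp only [hℓ, Complex.log_im]
      conv_lhs => rw [this, Complex.arg_mul_coe_angle hz0 hq]
      rw [← Real.Angle.coe_add]
    rw [averaged, add_assoc, Real.exp_add, e1, periodic_congr h.periodic₁ e2.symm,
      periodic_congr h.periodic₂ e2.symm]
  have hmax' : IsLocalMax (fun t => averaged H₁ H₂ (ϑ t) (u t)) 0 := by
    have hloc0 := hloc.self_of_nhds
    filter_upwards [hloc] with t ht
    have : W (toC (x t)) ≤ W (toC (x 0)) := by rw [hx0]; exact hmax (hxK t)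
    rw [ht, hloc0] at this
    exact Real.exp_le_exp.1 this
  have hzero := hmax'.hasDerivAt_eq_zero hΦ
  have hrr := hKr y hy
  have hr1 := hrr.trans_le (min_le_left _ _)
  have hr2 := hrr.trans_le (min_le_right _ _)
  rw [lt_div_iff₀ (by positivity)] at hr1 hr2
  have := averagedRate_neg h hM hω hJl hμ (θ := θ) hrpos (by rw [hr, hz]; linarith)
    (by rw [hr, hz]; linarith)
  linarith

end CubicJet

/-! ### Attracting cycles -/

/-- `C` is a nonconstant periodic orbit of the planar field `g`, parametrized by a solution `c` of
minimal period `τ`, and `C` is asymptotically stable. -/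
structure AttractingCycle (g : ℝ × ℝ → ℝ × ℝ) (C : Set (ℝ × ℝ)) : Prop where
  orbit : ∃ (c : ℝ → ℝ × ℝ) (τ : ℝ), 0 < τ ∧ (∀ t, HasDerivAt c (g (c t)) t) ∧
    (∀ s t, c s = c t ↔ ∃ n : ℤ, s - t = n * τ) ∧ (∀ t, g (c t) ≠ 0) ∧ range c = C
  stable : ∀ V ∈ 𝓝ˢ C, ∃ W ∈ 𝓝ˢ C, ∀ y ∈ W, ∃ x : ℝ → ℝ × ℝ, x 0 = y ∧
    (∀ t, 0 ≤ t → HasDerivAt x (g (x t)) t) ∧ ∀ t, 0 ≤ t → x t ∈ V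
  attractive : ∃ W ∈ 𝓝ˢ C, ∀ y ∈ W, ∃ x : ℝ → ℝ × ℝ, x 0 = y ∧
    (∀ t, 0 ≤ t → HasDerivAt x (g (x t)) t) ∧ Tendsto x atTop (𝓝ˢ C)

namespace CubicJet

variable {J : CubicJet} {M : ℝ} {H₁ H₂ q₁ q₂ : ℝ → ℝ}

/-- The radial equation `d (log r) / dθ = G θ (log r)` with the angle as independent variable. -/
def orbitRate (J : CubicJet) (θ u : ℝ) : ℝ := J.radial θ (Real.exp u) / J.angular θ (Real.exp u)

theorem hasDerivAt_polar_angle {u ϑ : ℝ → ℝ} {t : ℝ}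
    (hu : HasDerivAt u (J.orbitRate (ϑ t) (u (ϑ t))) (ϑ t))
    (hϑ : HasDerivAt ϑ (J.angular (ϑ t) (Real.exp (u (ϑ t)))) t)
    (hne : J.angular (ϑ t) (Real.exp (u (ϑ t))) ≠ 0) :
    HasDerivAt (fun t => polar (Real.exp (u (ϑ t))) (ϑ t))
      (J.field (polar (Real.exp (u (ϑ t))) (ϑ t))) t := by
  have h1 : HasDerivAt (fun t => Real.exp (u (ϑ t)))
      (Real.exp (u (ϑ t)) * J.radial (ϑ t) (Real.exp (u (ϑ t)))) t := by
    refine (hu.comp t hϑ).exp.congr_deriv ?_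
    rw [orbitRate]
    simp only [Function.comp]
    field_simp
  have := J.hasDerivWithinAt_polar (s := univ) (r := fun t => Real.exp (u (ϑ t)))
    h1.hasDerivWithinAt hϑ.hasDerivWithinAt
  exact this.hasDerivAt univ_mem

theorem norm_toC_polar {r θ : ℝ} (hr : 0 ≤ r) : ‖toC (polar r θ)‖ = r := by
  rw [toC_polar, norm_mul, Complex.norm_exp_ofReal_mul_I, mul_one, Complex.norm_real,
    Real.norm_of_nonneg hr]

theorem polar_congr {r θ φ : ℝ} (h : (θ : Real.Angle) = φ) : polar r θ = polar r φ := by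
  rw [polar, polar, ← Real.Angle.cos_coe, ← Real.Angle.sin_coe, h, Real.Angle.cos_coe,
    Real.Angle.sin_coe]

theorem arg_toC_polar {r : ℝ} (hr : 0 < r) (θ : ℝ) : ((toC (polar r θ)).arg : Real.Angle) = θ := by
  have := Complex.arg_mul_cos_add_sin_mul_I_coe_angle hr (θ : Real.Angle)
  rw [Real.Angle.cos_coe, Real.Angle.sin_coe, Complex.ofReal_cos, Complex.ofReal_sin,
    ← Complex.exp_mul_I, ← toC_polar] at this
  exact this

theorem angle_eq_of_polar_eq {r r' θ φ : ℝ} (hr : 0 < r) (hr' : 0 < r')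
    (h : polar r θ = polar r' φ) : (θ : Real.Angle) = φ := by
  rw [← arg_toC_polar hr θ, h, arg_toC_polar hr']

/-- A neighbourhood of a closed curve `r = exp (w θ)` contains a band around it. -/
theorem exists_band {w : ℝ → ℝ} (hw : Continuous w) (hper : ∀ θ, w (θ + 2 * Real.pi) = w θ)
    {V : Set (ℝ × ℝ)} (hV : V ∈ 𝓝ˢ (range fun θ => polar (Real.exp (w θ)) θ)) :
    ∃ ε > 0, ∀ u θ, |u - w θ| < ε → polar (Real.exp u) θ ∈ V := by
  obtain ⟨V', hV'o, hV's, hV'V⟩ := mem_nhdsSet_iff_exists.1 hV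
  set m : ℝ × ℝ → ℝ × ℝ := fun p => polar (Real.exp (w p.2 + p.1)) p.2 with hm
  have hmc : Continuous m := by
    have : Continuous fun p : ℝ × ℝ => polar (Real.exp (w p.2 + p.1)) p.2 := by
      unfold polar; fun_prop
    exact this
  have hopen : IsOpen (m ⁻¹' V') := hV'o.preimage hmc
  obtain ⟨A, B, hA, -, hA0, hB0, hAB⟩ := generalized_tube_lemma
    (isCompact_singleton (x := (0:ℝ))) (isCompact_Icc (a := (0:ℝ)) (b := 2 * Real.pi)) hopen
    (by
      rintro ⟨d, θ⟩ ⟨hd, -⟩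
      rw [mem_singleton_iff] at hd
      simp only at hd
      subst hd
      exact hV's ⟨θ, by simp [hm]⟩)
  obtain ⟨ε, hε, hball⟩ := Metric.isOpen_iff.1 hA 0 (hA0 rfl)
  refine ⟨ε, hε, fun u θ hu => hV'V ?_⟩
  obtain ⟨φ, hφ, hφθ⟩ := (show Function.Periodic (fun θ : ℝ => (w θ, (θ : Real.Angle))) (2 * Real.pi)
    from fun θ => by simp [hper]).exists_mem_Ico₀ Real.two_pi_pos θ
  simp only [Prod.mk.injEq] at hφθ
  have hmem : ((u - w θ, φ) : ℝ × ℝ) ∈ A ×ˢ B :=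
    ⟨hball (by simpa [Real.dist_eq] using hu), hB0 (Ico_subset_Icc_self hφ)⟩
  have := hAB hmem
  simp only [hm, mem_preimage] at this
  rw [← hφθ.1, show w θ + (u - w θ) = u by ring] at this
  rwa [polar_congr hφθ.2]

/-- Bands around a closed curve `r = exp (w θ)` are neighbourhoods of it. -/
theorem band_mem_nhdsSet {w : ℝ → ℝ} (hw : Continuous w) (hper : ∀ θ, w (θ + 2 * Real.pi) = w θ)
    {ε : ℝ} (hε : 0 < ε) :
    {y | y ≠ 0 ∧ |Real.log ‖toC y‖ - w (toC y).arg| < ε} ∈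
      𝓝ˢ (range fun θ => polar (Real.exp (w θ)) θ) := by
  rw [mem_nhdsSet_iff_forall]
  rintro _ ⟨θ, rfl⟩
  have hpos := Real.exp_pos (w θ)
  set y := polar (Real.exp (w θ)) θ with hy
  have hn : ‖toC y‖ = Real.exp (w θ) := norm_toC_polar hpos.le
  have hz : toC y ≠ 0 := by rw [← norm_pos_iff, hn]; exact hpos
  have harg : w (toC y).arg = w θ := by
    exact periodic_congr hper (arg_toC_polar hpos θ)
  have hc : ContinuousAt (fun y => |Real.log ‖toC y‖ - w (toC y).arg|) y := by
    have h1 : ContinuousAt (fun y => Real.log ‖toC y‖) y :=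
      (continuous_toC.norm.continuousAt).log (by rw [hn]; exact hpos.ne')
    have h2 : ContinuousAt (fun y => w (toC y).arg) y :=
      ContinuousAt.comp (f := toC) (continuousAt_comp_arg hw hper hz) continuous_toC.continuousAt
    exact (h1.sub h2).abs
  have h0 : |Real.log ‖toC y‖ - w (toC y).arg| < ε := by
    rw [hn, harg, Real.log_exp, sub_self, abs_zero]; exact hε
  exact ((continuousAt_id.eventually_ne (mt toC_eq_zero.2 hz)).and
    (hc.eventually_lt_const h0))

/-- A contracting strip for the orbit equation yields an attracting cycle of the planar field. -/
theorem exists_cycle_of_strip {Φ K : ℝ → ℝ → ℝ} {U₁ U₂ A₀ A₁ B₀ B₁ κ m m' : ℝ}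
    (h : ContractingStrip J.orbitRate Φ K U₁ U₂ A₀ A₁ B₀ B₁ κ) (hm : 0 < m)
    (hmin : ∀ θ, ∀ u ∈ Icc U₁ U₂, m ≤ J.angular θ (Real.exp u))
    (hmax : ∀ θ, ∀ u ∈ Icc U₁ U₂, J.angular θ (Real.exp u) ≤ m') :
    ∃ C, AttractingCycle J.field C ∧ ∀ y ∈ C, ‖toC y‖ ≤ Real.exp U₂ := by
  obtain ⟨w, hper, hwd, hwI, ε₀, hε₀, hattr⟩ := h.exists_periodic_attractor
  have hang : Continuous fun p : ℝ × ℝ => J.angular p.1 (Real.exp p.2) := by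
    unfold angular
    have := J.continuous_b₁
    have := J.continuous_b₂
    fun_prop
  have hwc : Continuous w := continuous_iff_continuousAt.2 fun θ => (hwd θ).continuousAt
  have hangper : ∀ θ r, J.angular (θ + 2 * Real.pi) r = J.angular θ r := fun θ r => by
    simp only [angular, periodic_b₁, periodic_b₂]
  -- trajectories starting in a band around the closed orbit
  have hsol : ∀ y : ℝ × ℝ, y ≠ 0 → |Real.log ‖toC y‖ - w (toC y).arg| ≤ ε₀ →
      ∃ u ϑ : ℝ → ℝ, polar (Real.exp (u (ϑ 0))) (ϑ 0) = y ∧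
        (∀ t, 0 ≤ t → HasDerivAt (fun t => polar (Real.exp (u (ϑ t))) (ϑ t))
          (J.field (polar (Real.exp (u (ϑ t))) (ϑ t))) t) ∧
        Tendsto ϑ atTop atTop ∧ ∀ t, 0 ≤ t → 0 ≤ ϑ t - (toC y).arg ∧ |u (ϑ t) - w (ϑ t)| ≤
          4 * |Real.log ‖toC y‖ - w (toC y).arg| *
            Real.exp (-(κ / 2) * (ϑ t - (toC y).arg)) := by
    intro y hy hd
    obtain ⟨u, hu0, huI, huc, hud, hue⟩ := hattr _ _ hd
    set θ₀ := (toC y).arg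
    have hB : Continuous fun θ => J.angular (max θ θ₀) (Real.exp (u (max θ θ₀))) :=
      hang.comp ((continuous_id.max continuous_const).prodMk
        (huc.comp (continuous_id.max continuous_const)))
    obtain ⟨ϑ, hϑ0, hϑd, -, hϑt, -⟩ := exists_angle_solution hB hm
      (fun θ => hmin _ _ (huI _ (le_max_right _ _))) (fun θ => hmax _ _ (huI _ (le_max_right _ _))) θ₀
    have hmono : Monotone ϑ := monotone_of_deriv_nonneg (fun t => (hϑd t).differentiableAt)
      fun t => by rw [(hϑd t).deriv]; exact hm.le.trans (hmin _ _ (huI _ (le_max_right _ _)))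
    have hge : ∀ t, 0 ≤ t → θ₀ ≤ ϑ t := fun t ht => hϑ0 ▸ hmono ht
    refine ⟨u, ϑ, ?_, fun t ht => ?_, hϑt, fun t ht => ⟨sub_nonneg.2 (hge t ht), hue _ (hge t ht)⟩⟩
    · rw [hϑ0, hu0, Real.exp_log (norm_pos_iff.2 (mt toC_eq_zero.1 hy)), polar_toC]
    · have := hϑd t
      rw [max_eq_left (hge t ht)] at this
      exact hasDerivAt_polar_angle (hud _ (hge t ht)) this
        (hm.trans_le (hmin _ _ (huI _ (hge t ht)))).ne'
  have hexp1 : ∀ x : ℝ, 0 ≤ x → Real.exp (-(κ / 2) * x) ≤ 1 := fun x hx => by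
    rw [Real.exp_le_one_iff]; nlinarith [h.κ_pos]
  refine ⟨range fun θ => polar (Real.exp (w θ)) θ, ⟨?_, ?_, ?_⟩, ?_⟩
  · have hB : Continuous fun θ => J.angular θ (Real.exp (w θ)) :=
      hang.comp (continuous_id.prodMk hwc)
    have hBpos : ∀ θ, 0 < J.angular θ (Real.exp (w θ)) := fun θ => hm.trans_le (hmin _ _ (hwI θ))
    obtain ⟨ϑ, hϑ0, hϑd, hϑb, -, hϑT⟩ := exists_angle_solution hB hm
      (fun θ => hmin _ _ (hwI θ)) (fun θ => hmax _ _ (hwI θ)) 0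
    obtain ⟨τ, hτ, hτp⟩ := angle_solution_periodic hB hBpos Real.two_pi_pos
      (fun θ => by rw [hangper, hper]) hϑb hϑT
    have hcd : ∀ t, HasDerivAt (fun t => polar (Real.exp (w (ϑ t))) (ϑ t))
        (J.field (polar (Real.exp (w (ϑ t))) (ϑ t))) t := fun t =>
      hasDerivAt_polar_angle (hwd _) (hϑd t) (hBpos _).ne'
    refine ⟨fun t => polar (Real.exp (w (ϑ t))) (ϑ t), τ, hτ, hcd, fun s t => ?_, fun t h0 => ?_, ?_⟩
    · rw [← hτp s t]
      constructor
      · intro he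
        obtain ⟨n, hn⟩ := Real.Angle.angle_eq_iff_two_pi_dvd_sub.1
          (angle_eq_of_polar_eq (Real.exp_pos _) (Real.exp_pos _) he)
        exact ⟨n, by rw [hn]; ring⟩
      · rintro ⟨n, hn⟩
        have hang : (ϑ s : Real.Angle) = ϑ t :=
          Real.Angle.angle_eq_iff_two_pi_dvd_sub.2 ⟨n, by rw [hn]; ring⟩
        simp only
        rw [periodic_congr hper hang, polar_congr hang]
    · -- the angular speed does not vanish
      rw [field_polar] at h0
      have h1 := congrArg Prod.fst h0
      have h2 := congrArg Prod.snd h0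
      simp only [Prod.fst_zero, Prod.snd_zero, mul_eq_zero, (Real.exp_pos _).ne', false_or] at h1 h2
      have hcs := Real.sin_sq_add_cos_sq (ϑ t)
      have : J.angular (ϑ t) (Real.exp (w (ϑ t))) = 0 := by
        linear_combination Real.cos (ϑ t) * h2 - Real.sin (ϑ t) * h1 -
          J.angular (ϑ t) (Real.exp (w (ϑ t))) * hcs
      exact (hBpos _).ne' this
    · exact hϑb.2.range_comp fun θ => polar (Real.exp (w θ)) θ
  · intro V hV
    obtain ⟨ε, hε, hεV⟩ := exists_band hwc hper hV
    refine ⟨_, band_mem_nhdsSet hwc hper (lt_min hε₀ (show 0 < ε / 8 by positivity)),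
      fun y hy => ?_⟩
    obtain ⟨u, ϑ, h0, hd, -, hclose⟩ := hsol y hy.1 (hy.2.le.trans (min_le_left _ _))
    refine ⟨_, h0, hd, fun t ht => hεV _ _ ?_⟩
    obtain ⟨hc1, hc2⟩ := hclose t ht
    refine hc2.trans_lt ?_
    have h3 := hy.2.trans_le (min_le_right _ _)
    have h4 := hexp1 _ hc1
    have h5 : (0:ℝ) ≤ 4 * |Real.log ‖toC y‖ - w (toC y).arg| := by positivity
    nlinarith [mul_le_mul_of_nonneg_left h4 h5]
  · refine ⟨_, band_mem_nhdsSet hwc hper hε₀, fun y hy => ?_⟩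
    obtain ⟨u, ϑ, h0, hd, hϑ, hclose⟩ := hsol y hy.1 hy.2.le
    refine ⟨_, h0, hd, fun V hV => ?_⟩
    obtain ⟨ε, hε, hεV⟩ := exists_band hwc hper hV
    have hlim : Tendsto (fun t => 4 * |Real.log ‖toC y‖ - w (toC y).arg| *
        Real.exp (-(κ / 2) * (ϑ t - (toC y).arg))) atTop (𝓝 0) := by
      have h1 : Tendsto (fun t => -(κ / 2) * (ϑ t - (toC y).arg)) atTop atBot :=
        (tendsto_atTop_add_const_right _ _ hϑ).const_mul_atTop_of_neg (by linarith [h.κ_pos])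
      have := (Real.tendsto_exp_atBot.comp h1).const_mul (4 * |Real.log ‖toC y‖ - w (toC y).arg|)
      simpa using this
    rw [mem_map]
    filter_upwards [hlim.eventually_lt_const hε, eventually_ge_atTop 0] with t ht ht0
    exact hεV _ _ ((hclose t ht0).2.trans_lt ht)
  · rintro _ ⟨θ, rfl⟩
    rw [norm_toC_polar (Real.exp_pos _).le]
    exact Real.exp_le_exp.2 (hwI θ).2

end CubicJet

namespace CubicJet

variable {J : CubicJet} {M : ℝ} {H₁ H₂ q₁ q₂ : ℝ → ℝ}

/-- The derivative of `averaged` along solutions of the orbit equation. -/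
theorem hasDerivAt_averaged (h : J.Averaging M H₁ H₂ q₁ q₂) {u : ℝ → ℝ} {θ : ℝ}
    (hu : HasDerivAt u (J.orbitRate θ (u θ)) θ) (hne : J.angular θ (Real.exp (u θ)) ≠ 0) :
    HasDerivAt (fun s => averaged H₁ H₂ s (u s))
      (averagedRate J H₁ H₂ q₁ q₂ θ (Real.exp (u θ)) / J.angular θ (Real.exp (u θ))) θ := by
  have d4 : HasDerivAt (fun s => Real.exp (u s) ^ 2) _ θ := hu.exp.pow 2
  refine ((hu.add (hu.exp.mul (h.deriv₁ θ))).add (d4.mul (h.deriv₂ θ))).congr_deriv ?_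
  rw [averagedRate, orbitRate]
  field_simp
  norm_num
  ring

theorem hasDerivAt_averagedRate (h : J.Averaging M H₁ H₂ q₁ q₂) (hω : 0 < J.ω) (θ u : ℝ) :
    HasDerivAt (fun u => averagedRate J H₁ H₂ q₁ q₂ θ (Real.exp u))
      (J.μ * (Real.exp u * H₁ θ + 4 * Real.exp u ^ 2 * H₂ θ) + 2 * J.lyap * Real.exp u ^ 2 +
        3 * c₃ J H₁ H₂ q₁ q₂ θ * Real.exp u ^ 3 + 4 * c₄ J H₂ q₂ θ * Real.exp u ^ 4) u := by
  simp only [averagedRate_eq h hω]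
  have d1 := Real.hasDerivAt_exp u
  have d2 : HasDerivAt (fun u => Real.exp u ^ 2) _ u := d1.pow 2
  have d3 : HasDerivAt (fun u => Real.exp u ^ 3) _ u := d1.pow 3
  have d4 : HasDerivAt (fun u => Real.exp u ^ 4) _ u := d1.pow 4
  refine ((((((d1.mul_const (H₁ θ)).const_add 1).add ((d2.const_mul 2).mul_const (H₂ θ))).const_mul
    J.μ).add (d2.const_mul J.lyap)).add (d3.const_mul (c₃ J H₁ H₂ q₁ q₂ θ))).add
    (d4.const_mul (c₄ J H₂ q₂ θ)) |>.congr_deriv ?_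
  norm_num
  ring

theorem hasDerivAt_angular (J : CubicJet) (θ u : ℝ) :
    HasDerivAt (fun u => J.angular θ (Real.exp u))
      (Real.exp u * J.b₁ θ + 2 * Real.exp u ^ 2 * J.b₂ θ) u := by
  have d1 := Real.hasDerivAt_exp u
  have d2 : HasDerivAt (fun u => Real.exp u ^ 2) _ u := d1.pow 2
  refine (((d1.mul_const (J.b₁ θ)).const_add J.ω).add (d2.mul_const (J.b₂ θ))).congr_deriv ?_
  push_cast
  ring

theorem hasDerivAt_radial (J : CubicJet) (θ u : ℝ) :
    HasDerivAt (fun u => J.radial θ (Real.exp u))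
      (Real.exp u * J.a₁ θ + 2 * Real.exp u ^ 2 * J.a₂ θ) u := by
  have d1 := Real.hasDerivAt_exp u
  have d2 : HasDerivAt (fun u => Real.exp u ^ 2) _ u := d1.pow 2
  refine (((d1.mul_const (J.a₁ θ)).const_add J.μ).add (d2.mul_const (J.a₂ θ))).congr_deriv ?_
  push_cast
  ring

/-- A perturbation `r x + c r² y` of size at most `(1 + c) M r`. -/
theorem abs_perturbation_le {x y r c : ℝ} (hx : |x| ≤ M) (hy : |y| ≤ M) (hr : 0 < r) (hr1 : r ≤ 1)
    (hc : 0 ≤ c) : |r * x + c * r ^ 2 * y| ≤ (1 + c) * M * r := by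
  have hM : 0 ≤ M := (abs_nonneg _).trans hx
  have e1 : |r * x| ≤ r * M := by
    rw [abs_mul, abs_of_pos hr]; exact mul_le_mul_of_nonneg_left hx hr.le
  have e2 : |c * r ^ 2 * y| ≤ c * r * M := by
    rw [abs_mul, abs_of_nonneg (by positivity)]
    exact mul_le_mul (mul_le_mul_of_nonneg_left (by nlinarith) hc) hy (abs_nonneg _) (by positivity)
  exact (abs_add_le _ _).trans (by linarith)

/-- The rate `K` of the averaged variable is strongly decreasing on the annulus where
`μ ≤ 64 |lyap| r²`: this bounds the numerator of `dK / du`. -/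
theorem averagedRate_slope_le (h : J.Averaging M H₁ H₂ q₁ q₂) (hM : 1 ≤ M) {w l : ℝ} (hw : 0 < w)
    (hJl : J.lyap ≤ -l) (hω : 0 < J.ω) (hμ : 0 < J.μ) {θ r : ℝ} (hr : 0 < r)
    (hμr : J.μ ≤ 64 * (-J.lyap) * r ^ 2) (hb : w / 2 ≤ J.angular θ r) (hr1 : 3 * M * r ≤ 1 / 8)
    (hr2 : (350 * M ^ 2 + 830 * M ^ 3 / w) * r ≤ l) :
    (J.μ * (r * H₁ θ + 4 * r ^ 2 * H₂ θ) + 2 * J.lyap * r ^ 2 + 3 * c₃ J H₁ H₂ q₁ q₂ θ * r ^ 3 +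
        4 * c₄ J H₂ q₂ θ * r ^ 4) * J.angular θ r -
      averagedRate J H₁ H₂ q₁ q₂ θ r * (r * J.b₁ θ + 2 * r ^ 2 * J.b₂ θ) ≤
      J.lyap * r ^ 2 * J.angular θ r := by
  have hr1' : r ≤ 1 := by nlinarith
  set Λ := -J.lyap with hΛ
  have hΛl : l ≤ Λ := by linarith
  have hΛM : Λ ≤ M := by
    have := (abs_le.1 h.lyap_le).1; linarith
  have hBpos : 0 < J.angular θ r := by linarith
  have p1 := abs_perturbation_le (h.le_H₁ θ) (h.le_H₂ θ) hr hr1' (c := 4) (by norm_num)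
  have p2 := abs_perturbation_le (h.le_H₁ θ) (h.le_H₂ θ) hr hr1' (c := 2) (by norm_num)
  have p3 := abs_perturbation_le (h.le_b₁ θ) (h.le_b₂ θ) hr hr1' (c := 2) (by norm_num)
  have c3 := abs_c₃_le h θ
  have c4 := abs_c₄_le h θ
  have hr34 : r ^ 4 ≤ r ^ 3 := pow_le_pow_of_le_one hr.le hr1' (by norm_num)
  have hμM : J.μ ≤ 64 * M * r ^ 2 := hμr.trans (by nlinarith [sq_nonneg r])
  have e1 : J.μ * (r * H₁ θ + 4 * r ^ 2 * H₂ θ) ≤ 320 * M ^ 2 * r ^ 3 := by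
    have := mul_le_mul_of_nonneg_left (abs_le.1 p1).2 hμ.le
    have h2 := mul_le_mul_of_nonneg_right hμM (show 0 ≤ 5 * M * r by positivity)
    nlinarith
  have e2 : 3 * c₃ J H₁ H₂ q₁ q₂ θ * r ^ 3 ≤ 15 * M ^ 2 * r ^ 3 := by
    have := mul_le_mul_of_nonneg_right (abs_le.1 c3).2 (show 0 ≤ r ^ 3 by positivity)
    linarith
  have e3 : 4 * c₄ J H₂ q₂ θ * r ^ 4 ≤ 12 * M ^ 2 * r ^ 3 := by
    have := mul_le_mul_of_nonneg_right (abs_le.1 c4).2 (show 0 ≤ r ^ 4 by positivity)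
    have h2 := mul_le_mul_of_nonneg_left hr34 (show 0 ≤ 12 * M ^ 2 by positivity)
    linarith
  have e4 : |averagedRate J H₁ H₂ q₁ q₂ θ r| ≤ 137 * M ^ 2 * r ^ 2 := by
    rw [averagedRate_eq h hω]
    have t1 : |J.μ * (1 + r * H₁ θ + 2 * r ^ 2 * H₂ θ)| ≤ 64 * M * r ^ 2 * 2 := by
      refine abs_mul_le (by rwa [abs_of_pos hμ]) ?_
      have := abs_le.1 p2
      rw [abs_le]; constructor <;> linarith [this.1, this.2]
    have t2 : |J.lyap * r ^ 2| ≤ M * r ^ 2 := by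
      rw [abs_mul, abs_of_nonneg (sq_nonneg r)]
      exact mul_le_mul_of_nonneg_right h.lyap_le (sq_nonneg r)
    have t3 : |c₃ J H₁ H₂ q₁ q₂ θ * r ^ 3| ≤ 5 * M ^ 2 * r ^ 2 := by
      refine abs_mul_le c3 ?_
      rw [abs_of_pos (by positivity)]
      exact pow_le_pow_of_le_one hr.le hr1' (by norm_num)
    have t4 : |c₄ J H₂ q₂ θ * r ^ 4| ≤ 3 * M ^ 2 * r ^ 2 := by
      refine abs_mul_le c4 ?_
      rw [abs_of_pos (by positivity)]
      exact pow_le_pow_of_le_one hr.le hr1' (by norm_num)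
    have hMM : M * r ^ 2 ≤ M ^ 2 * r ^ 2 := mul_le_mul_of_nonneg_right (by nlinarith) (sq_nonneg r)
    refine (abs_add_le _ _).trans ((add_le_add ((abs_add_le _ _).trans (add_le_add
      ((abs_add_le _ _).trans (add_le_add t1 t2)) t3)) t4).trans ?_)
    linarith
  have e5 : -(averagedRate J H₁ H₂ q₁ q₂ θ r * (r * J.b₁ θ + 2 * r ^ 2 * J.b₂ θ)) ≤
      830 * M ^ 3 / w * r ^ 3 * J.angular θ r := by
    have t1 := (neg_le_abs _).trans (abs_mul_le e4 p3)
    have t2 : 137 * M ^ 2 * r ^ 2 * ((1 + 2) * M * r) ≤ 830 * M ^ 3 / w * r ^ 3 * (w / 2) := by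
      have : 830 * M ^ 3 / w * r ^ 3 * (w / 2) = 415 * M ^ 3 * r ^ 3 := by field_simp; norm_num
      rw [this]
      have : 0 ≤ M ^ 3 * r ^ 3 := by positivity
      linarith
    have t3 : 830 * M ^ 3 / w * r ^ 3 * (w / 2) ≤ 830 * M ^ 3 / w * r ^ 3 * J.angular θ r :=
      mul_le_mul_of_nonneg_left hb (by positivity)
    linarith
  have e6 : (J.μ * (r * H₁ θ + 4 * r ^ 2 * H₂ θ) + 2 * J.lyap * r ^ 2 +
      3 * c₃ J H₁ H₂ q₁ q₂ θ * r ^ 3 + 4 * c₄ J H₂ q₂ θ * r ^ 4) * J.angular θ r ≤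
      (2 * J.lyap * r ^ 2 + 350 * M ^ 2 * r ^ 3) * J.angular θ r := by
    refine mul_le_mul_of_nonneg_right ?_ hBpos.le
    have : 0 ≤ M ^ 2 * r ^ 3 := by positivity
    linarith
  have e7 : (350 * M ^ 2 + 830 * M ^ 3 / w) * r * (r ^ 2 * J.angular θ r) ≤
      Λ * (r ^ 2 * J.angular θ r) := mul_le_mul_of_nonneg_right (hr2.trans hΛl) (by positivity)
  rw [hΛ] at e7
  nlinarith

theorem norm_div_deriv_le {x x' y y' a a' b' m : ℝ} (hm : 0 < m) (hx : |x| ≤ a) (hx' : |x'| ≤ a')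
    (hy : m ≤ y) (hY : y ≤ a) (hy' : |y'| ≤ b') :
    ‖(x' * y - x * y') / y ^ 2‖ ≤ (a' * a + a * b') / m ^ 2 := by
  have hy0 : 0 < y := hm.trans_le hy
  rw [Real.norm_eq_abs, abs_div, abs_of_pos (show 0 < y ^ 2 by positivity)]
  have h1 := abs_mul_le hx' (show |y| ≤ a by rwa [abs_of_pos hy0])
  have h2 := abs_mul_le hx hy'
  have h3 : |x' * y - x * y'| ≤ a' * a + a * b' := (abs_sub _ _).trans (add_le_add h1 h2)
  exact div_le_div₀ ((abs_nonneg _).trans h3) h3 (by positivity)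
    (pow_le_pow_left₀ hm.le hy 2)

set_option maxHeartbeats 1600000 in
/-- With a negative Lyapunov coefficient, an attracting cycle surrounds every slightly unstable
focus; the size of the cycle tends to zero with `μ`. -/
theorem exists_attractingCycle (C : ℝ) {w l : ℝ} (hw : 0 < w) (hl : 0 < l) {ε : ℝ} (hε : 0 < ε) :
    ∃ μ₀ > 0, ∀ J : CubicJet, J.Bounded C w → J.lyap ≤ -l → 0 < J.μ → J.μ < μ₀ →
      ∃ S, AttractingCycle J.field S ∧ ∀ y ∈ S, ‖toC y‖ < ε := by
  obtain ⟨M, hM, hav⟩ := exists_averaging C hw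
  have hM0 : 0 < M := by linarith
  -- all radii considered are below `ρ`, where every error term is dominated
  obtain ⟨ρ, hρ, hρε, hρ1, hρ2, hρ3, hρ4⟩ : ∃ ρ > 0, ρ < ε ∧ 4 * M * ρ ≤ 1 / 8 ∧
      2 * M * ρ ≤ w / 2 ∧ 32 * M ^ 2 * ρ ≤ l ∧ (350 * M ^ 2 + 830 * M ^ 3 / w) * ρ ≤ l := by
    set A := 1 / ε + 32 * M + 4 * M / w + 32 * M ^ 2 / l + (350 * M ^ 2 + 830 * M ^ 3 / w) / l
      with hA
    have a1 : 0 < 1 / ε := by positivity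
    have a2 : 0 < 32 * M := by positivity
    have a3 : 0 < 4 * M / w := by positivity
    have a4 : 0 < 32 * M ^ 2 / l := by positivity
    have a5 : 0 < (350 * M ^ 2 + 830 * M ^ 3 / w) / l := by positivity
    have hApos : 0 < A := by positivity
    refine ⟨1 / A, by positivity, ?_, ?_, ?_, ?_, ?_⟩
    · rw [div_lt_iff₀ hApos]
      have : 1 = ε * (1 / ε) := by field_simp
      nlinarith
    · rw [mul_one_div, div_le_iff₀ hApos]; linarith
    · rw [mul_one_div, div_le_iff₀ hApos]
      have : 2 * M = w / 2 * (4 * M / w) := by field_simp; norm_num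
      rw [this]; exact mul_le_mul_of_nonneg_left (by linarith) (by positivity)
    · rw [mul_one_div, div_le_iff₀ hApos]
      have : 32 * M ^ 2 = l * (32 * M ^ 2 / l) := by field_simp
      rw [this]; exact mul_le_mul_of_nonneg_left (by linarith) hl.le
    · rw [mul_one_div, div_le_iff₀ hApos]
      have : (350 * M ^ 2 + 830 * M ^ 3 / w) = l * ((350 * M ^ 2 + 830 * M ^ 3 / w) / l) := by
        field_simp
      rw [this]; exact mul_le_mul_of_nonneg_left (by linarith) hl.le
  refine ⟨l * (ρ / 8) ^ 2, by positivity, fun J hJ hJl hμ hμ₀ => ?_⟩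
  obtain ⟨H₁, H₂, q₁, q₂, h⟩ := hav J hJ
  have hω : 0 < J.ω := hw.trans_le hJ.ω_ge
  set Λ := -J.lyap with hΛ
  have hΛl : l ≤ Λ := by linarith
  have hΛ0 : 0 < Λ := hl.trans_le hΛl
  -- the radius at which the averaged rate vanishes to leading order
  set R := Real.sqrt (J.μ / Λ) with hR
  have hRpos : 0 < R := Real.sqrt_pos.2 (by positivity)
  have hR2 : R ^ 2 = J.μ / Λ := Real.sq_sqrt (by positivity)
  have hμR : J.μ = Λ * R ^ 2 := by rw [hR2]; field_simp
  have hRρ : 8 * R < ρ := by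
    have : R ^ 2 < (ρ / 8) ^ 2 := by
      have : l * R ^ 2 < l * (ρ / 8) ^ 2 := by nlinarith [sq_nonneg R]
      exact lt_of_mul_lt_mul_left this hl.le
    have := lt_of_pow_lt_pow_left₀ 2 (by positivity) this
    linarith
  set U := Real.log R with hU
  have hexp : ∀ u, Real.exp u = R * Real.exp (u - U) := by
    intro u; rw [Real.exp_sub, hU, Real.exp_log hRpos]; field_simp
  have hexp2 : Real.exp 2 ≤ 8 := by
    have h1 := Real.exp_one_lt_d9
    have : Real.exp 2 = Real.exp 1 ^ 2 := by rw [← Real.exp_nat_mul]; norm_num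
    rw [this]; nlinarith [Real.exp_pos 1]
  have hexpn2 : 1 / 8 ≤ Real.exp (-2) := by
    rw [Real.exp_neg, ← one_div]; exact one_div_le_one_div_of_le (Real.exp_pos _) hexp2
  -- bounds for the radius on the strip
  have hrU : ∀ u ∈ Icc (U - 2) (U + 2), Real.exp u ≤ 8 * R ∧ R ≤ 8 * Real.exp u := by
    intro u hu
    rw [hexp u]
    have h1 : Real.exp (u - U) ≤ Real.exp 2 := Real.exp_le_exp.2 (by linarith [hu.2])
    have h2 : Real.exp (-2) ≤ Real.exp (u - U) := Real.exp_le_exp.2 (by linarith [hu.1])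
    constructor <;> nlinarith
  have hsmall : ∀ u ∈ Icc (U - 2) (U + 2), Real.exp u < ρ := fun u hu => (hrU u hu).1.trans_lt hRρ
  have hMρ : ∀ u ∈ Icc (U - 2) (U + 2), M * Real.exp u ≤ M * ρ := fun u hu =>
    mul_le_mul_of_nonneg_left (hsmall u hu).le hM0.le
  have hone : ∀ u ∈ Icc (U - 2) (U + 2), Real.exp u ≤ 1 := fun u hu => by
    have := hMρ u hu; nlinarith [Real.exp_pos u]
  have hang : ∀ θ, ∀ u ∈ Icc (U - 2) (U + 2), J.ω / 2 ≤ J.angular θ (Real.exp u) ∧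
      J.angular θ (Real.exp u) ≤ 2 * J.ω := by
    intro θ u hu
    have h1 := abs_le.1 (radial_bounds h (θ := θ) (Real.exp_pos u) (hone u hu))
    have h2 := hMρ u hu
    have h3 := hJ.ω_ge
    constructor <;> nlinarith [h1.1, h1.2]
  have hangpos : ∀ θ, ∀ u ∈ Icc (U - 2) (U + 2), 0 < J.angular θ (Real.exp u) := fun θ u hu =>
    (half_pos hω).trans_le (hang θ u hu).1
  have hpert : ∀ θ, ∀ u ∈ Icc (U - 2) (U + 2), ∀ c : ℝ, 0 ≤ c → c ≤ 2 →
      |Real.exp u * H₁ θ + c * Real.exp u ^ 2 * H₂ θ| ≤ 1 / 8 := by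
    intro θ u hu c hc hc2
    refine (abs_perturbation_le (h.le_H₁ θ) (h.le_H₂ θ) (Real.exp_pos u) (hone u hu) hc).trans ?_
    have h1 := hMρ u hu
    have : 0 ≤ M * Real.exp u := by positivity
    nlinarith
  have hΦu : ∀ θ, ∀ u ∈ Icc (U - 2) (U + 2), |averaged H₁ H₂ θ u - u| ≤ 1 / 8 := by
    intro θ u hu
    have := hpert θ u hu 1 (by norm_num) (by norm_num)
    rw [averaged, show u + Real.exp u * H₁ θ + Real.exp u ^ 2 * H₂ θ - u =
      Real.exp u * H₁ θ + 1 * Real.exp u ^ 2 * H₂ θ by ring]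
    exact this
  have hU2 : U - 2 ≤ U + 2 := by linarith
  have hΦd : ∀ θ u, HasDerivAt (averaged H₁ H₂ θ)
      (1 + (Real.exp u * H₁ θ + 2 * Real.exp u ^ 2 * H₂ θ)) u := by
    intro θ u
    have d1 := Real.hasDerivAt_exp u
    have d2 : HasDerivAt (fun u => Real.exp u ^ 2) _ u := d1.pow 2
    refine (((hasDerivAt_id u).add (d1.mul_const (H₁ θ))).add (d2.mul_const (H₂ θ))).congr_deriv ?_
    norm_num
    ring
  -- sign of the averaged rate inside and outside the critical circle
  have herr : ∀ θ, ∀ u ∈ Icc (U - 2) (U + 2), |c₃ J H₁ H₂ q₁ q₂ θ * Real.exp u ^ 3 +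
      c₄ J H₂ q₂ θ * Real.exp u ^ 4| ≤ l / 4 * Real.exp u ^ 2 := by
    intro θ u hu
    have hr := Real.exp_pos u
    have t1 : |c₃ J H₁ H₂ q₁ q₂ θ * Real.exp u ^ 3| ≤ 5 * M ^ 2 * (Real.exp u * Real.exp u ^ 2) := by
      refine abs_mul_le (abs_c₃_le h θ) ?_
      rw [abs_of_pos (by positivity)]; exact le_of_eq (by ring)
    have t2 : |c₄ J H₂ q₂ θ * Real.exp u ^ 4| ≤ 3 * M ^ 2 * (Real.exp u * Real.exp u ^ 2) := by
      refine abs_mul_le (abs_c₄_le h θ) ?_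
      rw [abs_of_pos (by positivity)]
      have := pow_le_pow_of_le_one hr.le (hone u hu) (show 3 ≤ 4 by norm_num)
      exact this.trans_eq (by ring)
    refine (abs_add_le _ _).trans ((add_le_add t1 t2).trans ?_)
    have h1 : 32 * M ^ 2 * Real.exp u ≤ l :=
      (mul_le_mul_of_nonneg_left (hsmall u hu).le (by positivity)).trans hρ3
    nlinarith [mul_le_mul_of_nonneg_right h1 (sq_nonneg (Real.exp u))]
  have hrate : ∀ θ u, averagedRate J H₁ H₂ q₁ q₂ θ (Real.exp u) =
      Λ * (R ^ 2 * (1 + (Real.exp u * H₁ θ + 2 * Real.exp u ^ 2 * H₂ θ)) - Real.exp u ^ 2) +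
        (c₃ J H₁ H₂ q₁ q₂ θ * Real.exp u ^ 3 + c₄ J H₂ q₂ θ * Real.exp u ^ 4) := by
    intro θ u
    rw [averagedRate_eq h hω, hμR, show J.lyap = -Λ by simp [hΛ]]; ring
  have hexp74 : 2 ≤ Real.exp (7 / 4) := by
    have := Real.add_one_le_exp (7 / 4 : ℝ); linarith
  have hexpn74 : Real.exp (-(7 / 4)) ≤ 1 / 2 := by
    rw [Real.exp_neg, ← one_div]; exact one_div_le_one_div_of_le (by norm_num) hexp74
  have hsq : ∀ u, Real.exp u ^ 2 = R ^ 2 * Real.exp (2 * (u - U)) := by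
    intro u; rw [hexp u, mul_pow, ← Real.exp_nat_mul]; norm_num
  have hR20 : 0 < R ^ 2 := by positivity
  have hpos : ∀ θ, ∀ u ∈ Icc (U - 2) (U + 2), averaged H₁ H₂ θ u ≤ U - 1 →
      0 < averagedRate J H₁ H₂ q₁ q₂ θ (Real.exp u) := by
    intro θ u hu hle
    have h1 := abs_le.1 (hΦu θ u hu)
    have h2 : Real.exp (2 * (u - U)) ≤ 1 / 2 :=
      (Real.exp_le_exp.2 (by linarith [h1.1])).trans hexpn74
    have h3 : Real.exp u ^ 2 ≤ R ^ 2 / 2 := by rw [hsq]; nlinarith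
    have h4 := abs_le.1 (hpert θ u hu 2 (by norm_num) le_rfl)
    have h5 := abs_le.1 (herr θ u hu)
    have h6 : R ^ 2 * (7 / 8) ≤ R ^ 2 * (1 + (Real.exp u * H₁ θ + 2 * Real.exp u ^ 2 * H₂ θ)) :=
      mul_le_mul_of_nonneg_left (by linarith [h4.1]) hR20.le
    have h7 : Λ * (R ^ 2 * (3 / 8)) ≤
      Λ * (R ^ 2 * (1 + (Real.exp u * H₁ θ + 2 * Real.exp u ^ 2 * H₂ θ)) - Real.exp u ^ 2) :=
      mul_le_mul_of_nonneg_left (by linarith) hΛ0.le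
    rw [hrate]
    have h8 : l / 4 * Real.exp u ^ 2 ≤ Λ / 4 * (R ^ 2 / 2) :=
      mul_le_mul (by linarith) h3 (by positivity) (by positivity)
    have h9 : 0 < Λ * R ^ 2 := by positivity
    have h10 := h5.1
    clear * - h7 h8 h9 h10
    linarith
  have hneg : ∀ θ, ∀ u ∈ Icc (U - 2) (U + 2), U + 1 ≤ averaged H₁ H₂ θ u →
      averagedRate J H₁ H₂ q₁ q₂ θ (Real.exp u) < 0 := by
    intro θ u hu hle
    have h1 := abs_le.1 (hΦu θ u hu)
    have h2 : 2 ≤ Real.exp (2 * (u - U)) :=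
      hexp74.trans (Real.exp_le_exp.2 (by linarith [h1.2]))
    have h3 : 2 * R ^ 2 ≤ Real.exp u ^ 2 := by rw [hsq]; nlinarith
    have h4 := abs_le.1 (hpert θ u hu 2 (by norm_num) le_rfl)
    have h5 := abs_le.1 (herr θ u hu)
    have h6 : R ^ 2 * (1 + (Real.exp u * H₁ θ + 2 * Real.exp u ^ 2 * H₂ θ)) ≤ R ^ 2 * (9 / 8) :=
      mul_le_mul_of_nonneg_left (by linarith [h4.2]) hR20.le
    have h7 : Λ * (R ^ 2 * (1 + (Real.exp u * H₁ θ + 2 * Real.exp u ^ 2 * H₂ θ)) - Real.exp u ^ 2) ≤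
        Λ * (-(7 / 16) * Real.exp u ^ 2) := mul_le_mul_of_nonneg_left (by linarith) hΛ0.le
    rw [hrate]
    have h8 : l / 4 * Real.exp u ^ 2 ≤ Λ / 4 * Real.exp u ^ 2 :=
      mul_le_mul_of_nonneg_right (by linarith) (by positivity)
    have h9 : 0 < Λ * Real.exp u ^ 2 := by positivity
    have h10 := h5.2
    clear * - h7 h8 h9 h10
    linarith
  set κ := Λ * (R / 8) ^ 2 / (2 * J.ω) with hκ
  have hκ0 : 0 < κ := by positivity
  have hKd : ∀ θ, ∀ u ∈ Icc (U - 2) (U + 2), ∃ d ≤ -κ, HasDerivAt (fun u =>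
      averagedRate J H₁ H₂ q₁ q₂ θ (Real.exp u) / J.angular θ (Real.exp u)) d u := by
    intro θ u hu
    have hr := Real.exp_pos u
    have hB := hangpos θ u hu
    refine ⟨_, ?_, (hasDerivAt_averagedRate h hω θ u).div (hasDerivAt_angular J θ u) hB.ne'⟩
    have hR8 : R ^ 2 ≤ 64 * Real.exp u ^ 2 := by
      have := (hrU u hu).2
      nlinarith
    have hs := averagedRate_slope_le h hM hw hJl hω hμ (θ := θ) hr
      (by rw [hμR]; nlinarith) (by have := hJ.ω_ge; linarith [(hang θ u hu).1])
      (by have := hMρ u hu; nlinarith)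
      ((mul_le_mul_of_nonneg_left (hsmall u hu).le (by positivity)).trans hρ4)
    rw [div_le_iff₀ (by positivity)]
    refine hs.trans ?_
    have h1 : κ * J.angular θ (Real.exp u) ≤ Λ * (R / 8) ^ 2 := by
      have : κ * (2 * J.ω) = Λ * (R / 8) ^ 2 := by rw [hκ]; field_simp
      rw [← this]; exact mul_le_mul_of_nonneg_left (hang θ u hu).2 hκ0.le
    have h2 : Λ * (R / 8) ^ 2 ≤ Λ * Real.exp u ^ 2 :=
      mul_le_mul_of_nonneg_left (by linarith) hΛ0.le
    have h3 := mul_le_mul_of_nonneg_right (h1.trans h2) hB.le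
    have h4 : J.lyap = -Λ := by simp [hΛ]
    rw [h4]; nlinarith
  have hstrip : ContractingStrip J.orbitRate (averaged H₁ H₂)
      (fun θ u => averagedRate J H₁ H₂ q₁ q₂ θ (Real.exp u) / J.angular θ (Real.exp u))
      (U - 2) (U + 2) (U - 3 / 2) (U - 1) (U + 1) (U + 3 / 2) κ := by
    have hmemU : U - 2 ∈ Icc (U - 2) (U + 2) := ⟨le_rfl, hU2⟩
    have hmemU' : U + 2 ∈ Icc (U - 2) (U + 2) := ⟨hU2, le_rfl⟩
    have hradb : ∀ θ, ∀ u ∈ Icc (U - 2) (U + 2), |J.radial θ (Real.exp u)| ≤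
        J.μ + 2 * M + 2 * J.ω := by
      intro θ u hu
      have := abs_perturbation_le (h.le_a₁ θ) (h.le_a₂ θ) (Real.exp_pos u) (hone u hu) (c := 1)
        zero_le_one
      rw [radial, add_assoc]
      refine (abs_add_le _ _).trans ?_
      rw [abs_of_pos hμ]
      rw [one_mul] at this
      have h2 : (1 + 1) * M * Real.exp u ≤ 2 * M := by nlinarith [hone u hu]
      linarith
    have hder3 : ∀ {x y : ℝ}, |x| ≤ M → |y| ≤ M → ∀ u ∈ Icc (U - 2) (U + 2),
        |Real.exp u * x + 2 * Real.exp u ^ 2 * y| ≤ 3 * M := by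
      intro x y hx hy u hu
      have := abs_perturbation_le hx hy (Real.exp_pos u) (hone u hu) (c := 2) zero_le_two
      have h2 : (1 + 2) * M * Real.exp u ≤ 3 * M := by nlinarith [hone u hu]
      linarith
    refine
      { G_periodic := fun θ u => by
          simp only [orbitRate, radial, angular, periodic_a₁, periodic_a₂, periodic_b₁, periodic_b₂]
        Φ_periodic := fun θ u => by simp only [averaged, h.periodic₁, h.periodic₂]
        U_lt := by linarith
        G_lipschitz := ?_
        G_continuous := fun u hu => ?_
        G_bounded := ?_
        Φ_deriv := fun u θ hd hu => hasDerivAt_averaged h hd (hangpos θ _ hu).ne'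
        Φ_lower := fun θ u hu v hv huv => ?_
        Φ_upper := fun θ u hu v hv huv => ?_
        κ_pos := hκ0
        K_decreasing := fun θ u hu v hv huv => ?_
        K_pos := fun θ u hu hle => div_pos (hpos θ u hu hle) (hangpos θ u hu)
        K_neg := fun θ u hu hle => div_neg_of_neg_of_pos (hneg θ u hu hle) (hangpos θ u hu)
        Φ_left := fun θ => by linarith [(abs_le.1 (hΦu θ _ hmemU)).2]
        Φ_right := fun θ => by linarith [(abs_le.1 (hΦu θ _ hmemU')).1]
        A_lt := by linarith
        A_lt_B := by linarith
        B_lt := by linarith }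
    · set a := J.μ + 2 * M + 2 * J.ω with ha
      set L := (3 * M * a + a * (3 * M)) / (J.ω / 2) ^ 2 with hL
      have hL0 : 0 ≤ L := by positivity
      refine ⟨⟨L, hL0⟩, fun θ => ?_⟩
      refine (convex_Icc (U - 2) (U + 2)).lipschitzOnWith_of_nnnorm_hasDerivWithin_le
        (fun u hu => ((hasDerivAt_radial J θ u).div (hasDerivAt_angular J θ u)
          (hangpos θ u hu).ne').hasDerivWithinAt) fun u hu => ?_
      exact norm_div_deriv_le (half_pos hω) (hradb θ u hu)
        (hder3 (h.le_a₁ θ) (h.le_a₂ θ) u hu) (hang θ u hu).1 ((hang θ u hu).2.trans (by linarith))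
        (hder3 (h.le_b₁ θ) (h.le_b₂ θ) u hu)
    · have := J.continuous_a₁
      have := J.continuous_a₂
      have := J.continuous_b₁
      have := J.continuous_b₂
      have c1 : Continuous fun θ => J.radial θ (Real.exp u) := by unfold radial; fun_prop
      have c2 : Continuous fun θ => J.angular θ (Real.exp u) := by unfold angular; fun_prop
      exact c1.div c2 fun θ => (hangpos θ u hu).ne'
    · set a := J.μ + 2 * M + 2 * J.ω with ha
      have ha0 : 0 ≤ a := by positivity
      refine ⟨⟨a / (J.ω / 2), by positivity⟩, fun θ u hu => ?_⟩
      rw [orbitRate, Real.norm_eq_abs, abs_div, abs_of_pos (hangpos θ u hu)]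
      exact div_le_div₀ ha0 (hradb θ u hu) (half_pos hω) (hang θ u hu).1
    · have := (convex_Icc (U - 2) (U + 2)).mul_sub_le_image_sub_of_le_deriv (f := averaged H₁ H₂ θ)
        (C := 1 / 2) (fun u _ => (hΦd θ u).continuousAt.continuousWithinAt)
        (fun u _ => (hΦd θ u).differentiableAt.differentiableWithinAt)
        (fun u hu => by
          rw [(hΦd θ u).deriv]
          linarith [(abs_le.1 (hpert θ u (interior_subset hu) 2 (by norm_num) le_rfl)).1])
        u hu v hv huv
      linarith
    · have := (convex_Icc (U - 2) (U + 2)).image_sub_le_mul_sub_of_deriv_le (f := averaged H₁ H₂ θ)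
        (C := 2) (fun u _ => (hΦd θ u).continuousAt.continuousWithinAt)
        (fun u _ => (hΦd θ u).differentiableAt.differentiableWithinAt)
        (fun u hu => by
          rw [(hΦd θ u).deriv]
          linarith [(abs_le.1 (hpert θ u (interior_subset hu) 2 (by norm_num) le_rfl)).2])
        u hu v hv huv
      linarith
    · refine (convex_Icc (U - 2) (U + 2)).image_sub_le_mul_sub_of_deriv_le
        (f := fun u => averagedRate J H₁ H₂ q₁ q₂ θ (Real.exp u) / J.angular θ (Real.exp u))
        (C := -κ) (fun u hu => ?_) (fun u hu => ?_) (fun u hu => ?_) u hu v hv huv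
      · obtain ⟨d, -, hd⟩ := hKd θ u hu
        exact hd.continuousAt.continuousWithinAt
      · obtain ⟨d, -, hd⟩ := hKd θ u (interior_subset hu)
        exact hd.differentiableAt.differentiableWithinAt
      · obtain ⟨d, hdle, hd⟩ := hKd θ u (interior_subset hu)
        rw [hd.deriv]; exact hdle
  obtain ⟨S, hS, hSU⟩ := exists_cycle_of_strip hstrip (half_pos hω) (fun θ u hu => (hang θ u hu).1)
    (fun θ u hu => (hang θ u hu).2)
  exact ⟨S, hS, fun y hy => (hSU y hy).trans_lt
    ((hsmall _ ⟨hU2, le_rfl⟩).trans hρε)⟩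

end CubicJet

/-! ### Transport of attracting cycles -/

/-- `C` is a nonconstant periodic orbit of `g`. -/
def IsCycle (g : ℝ × ℝ → ℝ × ℝ) (C : Set (ℝ × ℝ)) : Prop :=
  ∃ (c : ℝ → ℝ × ℝ) (τ : ℝ), 0 < τ ∧ (∀ t, HasDerivAt c (g (c t)) t) ∧
    (∀ s t, c s = c t ↔ ∃ n : ℤ, s - t = n * τ) ∧ (∀ t, g (c t) ≠ 0) ∧ range c = C

/-- A cycle of the reversed field, run backwards, is a cycle. -/
theorem IsCycle.reverse {g : ℝ × ℝ → ℝ × ℝ} {C : Set (ℝ × ℝ)} (h : IsCycle (-g) C) :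
    IsCycle g C := by
  obtain ⟨c, τ, hτ, hd, hper, hne, hr⟩ := h
  refine ⟨fun t => c (-t), τ, hτ, fun t => ?_, fun s t => ?_, fun t h0 => hne (-t) ?_, ?_⟩
  · refine ((hd (-t)).scomp t (hasDerivAt_neg t)).congr_deriv ?_
    simp
  · rw [hper]
    constructor
    · rintro ⟨n, hn⟩; exact ⟨-n, by push_cast; linarith⟩
    · rintro ⟨n, hn⟩; exact ⟨-n, by push_cast; linarith⟩
  · simp [h0]
  · rw [← hr]; exact (Equiv.neg ℝ).surjective.range_comp c

theorem IsCycle.isCompact {g : ℝ × ℝ → ℝ × ℝ} {C : Set (ℝ × ℝ)} (h : IsCycle g C) :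
    IsCompact C := by
  obtain ⟨c, τ, hτ, hd, hper, -, rfl⟩ := h
  have hc : Continuous c := continuous_iff_continuousAt.2 fun t => (hd t).continuousAt
  have hp : Function.Periodic c τ := fun t => (hper _ _).2 ⟨1, by simp⟩
  rw [← hp.image_Icc hτ 0]
  exact isCompact_Icc.image hc

theorem Homeomorph.mem_nhdsSet_image {X Y : Type*} [TopologicalSpace X] [TopologicalSpace Y]
    (e : X ≃ₜ Y) {s : Set X} {V : Set Y} : V ∈ 𝓝ˢ (e '' s) ↔ e ⁻¹' V ∈ 𝓝ˢ s := by
  rw [mem_nhdsSet_iff_forall, mem_nhdsSet_iff_forall, forall_mem_image]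
  refine forall₂_congr fun x _ => ?_
  rw [← e.map_nhds_eq, mem_map]

/-- Affine conjugations preserve attracting cycles. -/
theorem AttractingCycle.map {g g' : ℝ × ℝ → ℝ × ℝ} {C : Set (ℝ × ℝ)} (h : AttractingCycle g C)
    (e : (ℝ × ℝ) ≃L[ℝ] (ℝ × ℝ)) (p : ℝ × ℝ) (hg : ∀ y, g' (p + e y) = e (g y)) :
    AttractingCycle g' ((fun y => p + e y) '' C) := by
  set φ : (ℝ × ℝ) ≃ₜ (ℝ × ℝ) := e.toHomeomorph.trans (Homeomorph.addLeft p) with hφ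
  have hφa : ∀ y, φ y = p + e y := fun y => rfl
  have hφd : ∀ {x : ℝ → ℝ × ℝ} {t : ℝ}, HasDerivAt x (g (x t)) t →
      HasDerivAt (fun t => φ (x t)) (g' (φ (x t))) t := by
    intro x t hx
    rw [hφa, hg]
    exact ((e : (ℝ × ℝ) →L[ℝ] (ℝ × ℝ)).hasFDerivAt.comp_hasDerivAt t hx).const_add p
  refine ⟨?_, fun V hV => ?_, ?_⟩
  · obtain ⟨c, τ, hτ, hd, hper, hne, rfl⟩ := h.orbit
    refine ⟨fun t => φ (c t), τ, hτ, fun t => hφd (hd t), fun s t => ?_, fun t => ?_, ?_⟩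
    · rw [φ.injective.eq_iff, hper]
    · show g' (φ (c t)) ≠ 0
      rw [hφa, hg, map_ne_zero_iff _ e.injective]
      exact hne t
    · exact range_comp φ c
  · obtain ⟨W, hW, hWV⟩ := h.stable _ (φ.mem_nhdsSet_image.1 hV)
    refine ⟨φ '' W, φ.mem_nhdsSet_image.2 (by rwa [φ.injective.preimage_image]), ?_⟩
    rintro _ ⟨y, hy, rfl⟩
    obtain ⟨x, h0, hd, hx⟩ := hWV y hy
    exact ⟨fun t => φ (x t), by simp only [h0], fun t ht => hφd (hd t ht), hx⟩
  · obtain ⟨W, hW, hWa⟩ := h.attractive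
    refine ⟨φ '' W, φ.mem_nhdsSet_image.2 (by rwa [φ.injective.preimage_image]), ?_⟩
    rintro _ ⟨y, hy, rfl⟩
    obtain ⟨x, h0, hd, hx⟩ := hWa y hy
    exact ⟨fun t => φ (x t), by simp only [h0], fun t ht => hφd (hd t ht),
      fun V hV => hx (φ.mem_nhdsSet_image.1 hV)⟩

/-- Solutions of an autonomous equation with continuously differentiable field are determined by
their initial value. -/
theorem eqOn_Icc_of_contDiff {E : Type*} [NormedAddCommGroup E] [NormedSpace ℝ E]
    [FiniteDimensional ℝ E] {v : E → E} (hv : ContDiff ℝ 1 v) {x y : ℝ → E} {T : ℝ}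
    (hx : ContinuousOn x (Icc 0 T))
    (hx' : ∀ t ∈ Ico 0 T, HasDerivWithinAt x (v (x t)) (Ici t) t)
    (hy : ContinuousOn y (Icc 0 T))
    (hy' : ∀ t ∈ Ico 0 T, HasDerivWithinAt y (v (y t)) (Ici t) t) (h0 : x 0 = y 0) :
    EqOn x y (Icc 0 T) := by
  have := FiniteDimensional.proper ℝ E
  obtain ⟨R, hR⟩ := ((isCompact_Icc.image_of_continuousOn hx).union
    (isCompact_Icc.image_of_continuousOn hy)).isBounded.subset_closedBall 0
  obtain ⟨L, hL⟩ := (hv.contDiffOn (s := Metric.closedBall 0 R)).exists_lipschitzOnWith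
    one_ne_zero (convex_closedBall _ _) (isCompact_closedBall _ _)
  exact ODE_solution_unique_of_mem_Icc_right (v := fun _ => v)
    (s := fun _ => Metric.closedBall 0 R) (fun t _ => hL) hx hx'
    (fun t ht => hR (Or.inl ⟨t, Ico_subset_Icc_self ht, rfl⟩)) hy hy'
    (fun t ht => hR (Or.inr ⟨t, Ico_subset_Icc_self ht, rfl⟩)) h0

/-! ### Tori over sets of amplitudes -/

/-- The states whose amplitudes are positive with squares in `C`. -/
def torusLift (C : Set (ℝ × ℝ)) : Set PhaseSpace :=
  {q | 0 < q.1 ∧ 0 < q.2.1 ∧ (q.1 ^ 2, q.2.1 ^ 2) ∈ C}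

theorem isCompact_univ_angle : IsCompact (univ : Set Real.Angle) := by
  have : (univ : Set Real.Angle) = Real.Angle.coe '' Icc 0 (0 + 2 * Real.pi) := by
    refine (eq_univ_of_forall fun θ => ?_).symm
    obtain ⟨x, rfl⟩ : ∃ x : ℝ, (x : Real.Angle) = θ := ⟨θ.toReal, θ.coe_toReal⟩
    obtain ⟨y, hy, hxy⟩ := (show Function.Periodic (fun x : ℝ => (x : Real.Angle)) (2 * Real.pi)
      from fun x => by simp).exists_mem_Ico Real.two_pi_pos x 0
    exact ⟨y, Ico_subset_Icc_self hy, hxy.symm⟩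
  rw [this]
  exact isCompact_Icc.image Real.Angle.continuous_coe

/-- By compactness of the angles, the lifts of the neighbourhoods of `C` are arbitrarily small
neighbourhoods of the lift of `C`. -/
theorem exists_nhdsSet_torusLift_subset {C : Set (ℝ × ℝ)} (hC : IsCompact C)
    (hpos : C ⊆ TruncatedNormalForm.posQuadrant) {V : Set PhaseSpace} (hV : V ∈ 𝓝ˢ (torusLift C)) :
    ∃ V' ∈ 𝓝ˢ C, V' ⊆ TruncatedNormalForm.posQuadrant ∧ torusLift V' ⊆ V := by
  obtain ⟨O, hO, hCO, hOV⟩ := mem_nhdsSet_iff_exists.1 hV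
  set m : (ℝ × ℝ) × (Real.Angle × Real.Angle) → PhaseSpace :=
    fun p => (√p.1.1, √p.1.2, p.2.1, p.2.2) with hm
  have hmc : Continuous m := by
    refine (continuous_fst.fst.sqrt).prodMk ((continuous_fst.snd.sqrt).prodMk
      (continuous_snd.fst.prodMk continuous_snd.snd))
  obtain ⟨A, B, hA, -, hCA, hB, hAB⟩ := generalized_tube_lemma hC
    (isCompact_univ_angle.prod isCompact_univ_angle) (hO.preimage hmc) (by
      rintro ⟨ρ, φ⟩ ⟨hρ, -⟩
      have := hpos hρ
      refine hCO ⟨Real.sqrt_pos.2 this.1, Real.sqrt_pos.2 this.2, ?_⟩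
      simp only [hm, Real.sq_sqrt this.1.le, Real.sq_sqrt this.2.le]
      exact hρ)
  have hQ : IsOpen TruncatedNormalForm.posQuadrant :=
    (isOpen_lt continuous_const continuous_fst).inter (isOpen_lt continuous_const continuous_snd)
  refine ⟨A ∩ TruncatedNormalForm.posQuadrant,
    (hA.inter hQ).mem_nhdsSet.2 (subset_inter hCA hpos), inter_subset_right, ?_⟩
  rintro ⟨r₁, r₂, φ₁, φ₂⟩ ⟨h1, h2, h3⟩
  simp only at h1 h2 h3
  have : (((r₁ ^ 2, r₂ ^ 2), (φ₁, φ₂)) : (ℝ × ℝ) × (Real.Angle × Real.Angle)) ∈ A ×ˢ B :=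
    ⟨h3.1, hB ⟨trivial, trivial⟩⟩
  have := hAB this
  simp only [mem_preimage, hm, Real.sqrt_sq h1.le, Real.sqrt_sq h2.le] at this
  exact hOV this

theorem torusLift_mem_nhdsSet {C W : Set (ℝ × ℝ)} (hW : W ∈ 𝓝ˢ C) :
    torusLift W ∈ 𝓝ˢ (torusLift C) := by
  obtain ⟨O, hO, hCO, hOW⟩ := mem_nhdsSet_iff_exists.1 hW
  refine mem_nhdsSet_iff_exists.2 ⟨torusLift O, ?_, fun q hq => ⟨hq.1, hq.2.1, hCO hq.2.2⟩,
    fun q hq => ⟨hq.1, hq.2.1, hOW hq.2.2⟩⟩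
  have c1 : Continuous fun q : PhaseSpace => q.1 := continuous_fst
  have c2 : Continuous fun q : PhaseSpace => q.2.1 := continuous_snd.fst
  exact (isOpen_lt continuous_const c1).inter ((isOpen_lt continuous_const c2).inter
    (hO.preimage ((c1.pow 2).prodMk (c2.pow 2))))

theorem torusOver_eq_torusLift {ρ : ℝ × ℝ} (hρ : ρ ∈ TruncatedNormalForm.posQuadrant) :
    TruncatedNormalForm.torusOver ρ = torusLift {ρ} := by
  have h1 := Real.sqrt_pos.2 hρ.1
  have h2 := Real.sqrt_pos.2 hρ.2
  ext q
  constructor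
  · rintro ⟨e1, e2⟩
    refine ⟨e1 ▸ h1, e2 ▸ h2, ?_⟩
    rw [mem_singleton_iff, e1, e2, Real.sq_sqrt hρ.1.le, Real.sq_sqrt hρ.2.le]
  · rintro ⟨p1, p2, e⟩
    rw [mem_singleton_iff] at e
    exact ⟨by rw [← e]; exact (Real.sqrt_sq p1.le).symm, by rw [← e]; exact (Real.sqrt_sq p2.le).symm⟩

namespace TruncatedNormalForm

variable (N : TruncatedNormalForm) (δ : ℝ × ℝ)

/-- The trajectory of the truncated normal form with amplitudes `√ρ` and initial phases `φ`. -/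
def liftCurve (φ : ℝ × ℝ) (ρ : ℝ → ℝ × ℝ) (t : ℝ) : ℝ × ℝ × ℝ × ℝ :=
  (√(ρ t).1, √(ρ t).2, φ.1 + N.β 0 δ * t, φ.2 + N.β 1 δ * t)

theorem hasDerivAt_liftCurve {ρ : ℝ → ℝ × ℝ} {t : ℝ} (φ : ℝ × ℝ)
    (hρ : HasDerivAt ρ (N.ampField δ (ρ t)) t) (hpos : ρ t ∈ posQuadrant) :
    HasDerivAt (N.liftCurve δ φ ρ) (N.field δ (N.liftCurve δ φ ρ t)) t := by
  have h1 : HasDerivAt (fun t => (ρ t).1) (N.ampField δ (ρ t)).1 t :=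
    (ContinuousLinearMap.fst ℝ ℝ ℝ).hasFDerivAt.comp_hasDerivAt t hρ
  have h2 : HasDerivAt (fun t => (ρ t).2) (N.ampField δ (ρ t)).2 t :=
    (ContinuousLinearMap.snd ℝ ℝ ℝ).hasFDerivAt.comp_hasDerivAt t hρ
  have l1 : HasDerivAt (fun t => φ.1 + N.β 0 δ * t) (N.β 0 δ) t := by
    simpa using ((hasDerivAt_id t).const_mul (N.β 0 δ)).const_add φ.1
  have l2 : HasDerivAt (fun t => φ.2 + N.β 1 δ * t) (N.β 1 δ) t := by
    simpa using ((hasDerivAt_id t).const_mul (N.β 1 δ)).const_add φ.2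
  refine ((h1.sqrt hpos.1.ne').prodMk ((h2.sqrt hpos.2.ne').prodMk (l1.prodMk l2))).congr_deriv ?_
  have s1 := Real.sq_sqrt hpos.1.le
  have s2 := Real.sq_sqrt hpos.2.le
  have p1 := Real.sqrt_pos.2 hpos.1
  have p2 := Real.sqrt_pos.2 hpos.2
  simp only [liftCurve, field, ampField, s1, s2]
  refine Prod.ext ?_ (Prod.ext ?_ rfl)
  · simp only
    field_simp
    rw [s1]
    ring
  · simp only
    field_simp
    rw [s2]
    ring

theorem toPhase_liftCurve_mem {ρ : ℝ → ℝ × ℝ} {t : ℝ} (φ : ℝ × ℝ) (hpos : ρ t ∈ posQuadrant)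
    {C : Set (ℝ × ℝ)} : toPhase (N.liftCurve δ φ ρ t) ∈ torusLift C ↔ ρ t ∈ C := by
  have e : ((√(ρ t).1) ^ 2, (√(ρ t).2) ^ 2) = ρ t := by
    rw [Real.sq_sqrt hpos.1.le, Real.sq_sqrt hpos.2.le]
  constructor
  · rintro ⟨-, -, h⟩; simp only [toPhase, liftCurve] at h; rwa [e] at h
  · intro h
    refine ⟨Real.sqrt_pos.2 hpos.1, Real.sqrt_pos.2 hpos.2, ?_⟩
    simp only [toPhase, liftCurve]; rwa [e]

theorem liftCurve_zero {ρ : ℝ → ℝ × ℝ} {x₀ : ℝ × ℝ × ℝ × ℝ} (h1 : 0 < x₀.1) (h2 : 0 < x₀.2.1)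
    (h0 : ρ 0 = (x₀.1 ^ 2, x₀.2.1 ^ 2)) : N.liftCurve δ x₀.2.2 ρ 0 = x₀ := by
  simp [liftCurve, h0, Real.sqrt_sq h1.le, Real.sqrt_sq h2.le]

/-- The torus over an attracting cycle of the amplitude system is asymptotically stable. -/
theorem isAsymptoticallyStable_torusLift {C : Set (ℝ × ℝ)}
    (h : AttractingCycle (N.ampField δ) C) (hpos : C ⊆ posQuadrant) :
    N.IsAsymptoticallyStable δ (torusLift C) := by
  have hC : IsCompact C := IsCycle.isCompact h.orbit
  have hV₀ : posQuadrant ∈ 𝓝ˢ C :=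
    ((isOpen_lt continuous_const continuous_fst).inter
      (isOpen_lt continuous_const continuous_snd)).mem_nhdsSet.2 hpos
  refine ⟨fun V hV => ?_, ?_⟩
  · obtain ⟨V', hV', hV'pos, hV'V⟩ := exists_nhdsSet_torusLift_subset hC hpos hV
    obtain ⟨W, hW, hWs⟩ := h.stable V' hV'
    refine ⟨torusLift W, torusLift_mem_nhdsSet hW, fun x₀ hx₀ => ?_⟩
    obtain ⟨ρ, h0, hd, hin⟩ := hWs _ hx₀.2.2
    refine ⟨N.liftCurve δ x₀.2.2 ρ, fun t ht => ?_, N.liftCurve_zero δ hx₀.1 hx₀.2.1 h0,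
      fun t ht => hV'V ((N.toPhase_liftCurve_mem δ _ (hV'pos (hin t ht))).2 (hin t ht))⟩
    exact (N.hasDerivAt_liftCurve δ _ (hd t ht) (hV'pos (hin t ht))).hasDerivWithinAt
  · obtain ⟨W₁, hW₁, hW₁s⟩ := h.stable _ hV₀
    obtain ⟨W₂, hW₂, hW₂a⟩ := h.attractive
    have hWW : W₁ ∩ W₂ ∈ 𝓝ˢ C := inter_mem hW₁ hW₂
    refine ⟨torusLift (W₁ ∩ W₂), torusLift_mem_nhdsSet hWW, fun x₀ hx₀ => ?_⟩
    obtain ⟨ρ, h0, hd, hin⟩ := hW₁s _ hx₀.2.2.1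
    obtain ⟨ρ', h0', hd', hlim⟩ := hW₂a _ hx₀.2.2.2
    -- both solutions agree for nonnegative times, by local Lipschitz continuity of the field
    have hsmooth : ContDiff ℝ 1 (N.ampField δ) := by
      unfold ampField bracket₁ bracket₂; fun_prop
    have heq : ∀ T, 0 ≤ T → EqOn ρ ρ' (Icc 0 T) := fun T _ =>
      eqOn_Icc_of_contDiff hsmooth (fun t ht => (hd t ht.1).continuousAt.continuousWithinAt)
        (fun t ht => (hd t ht.1).hasDerivWithinAt)
        (fun t ht => (hd' t ht.1).continuousAt.continuousWithinAt)
        (fun t ht => (hd' t ht.1).hasDerivWithinAt) (by rw [h0, h0'])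
    refine ⟨N.liftCurve δ x₀.2.2 ρ, fun t ht => ?_, N.liftCurve_zero δ hx₀.1 hx₀.2.1 h0,
      fun V hV => ?_⟩
    · exact (N.hasDerivAt_liftCurve δ _ (hd t ht) (hin t ht)).hasDerivWithinAt
    · obtain ⟨V', hV', hV'pos, hV'V⟩ := exists_nhdsSet_torusLift_subset hC hpos hV
      rw [mem_map]
      filter_upwards [hlim hV', eventually_ge_atTop 0] with t ht ht0
      rw [mem_preimage, ← heq t ht0 ⟨ht0, le_rfl⟩] at ht
      exact hV'V ((N.toPhase_liftCurve_mem δ _ (hV'pos ht)).2 ht)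

/-- The torus over a cycle that attracts in backward time is not Lyapunov stable: a point off the
torus is reached from arbitrarily close to the torus. -/
theorem not_isLyapunovStable_torusLift {C : Set (ℝ × ℝ)}
    (h : AttractingCycle (-(N.ampField δ)) C) (hpos : C ⊆ posQuadrant) :
    ¬ N.IsLyapunovStable δ (torusLift C) := by
  intro hstab
  have hC : IsCompact C := IsCycle.isCompact h.orbit
  have hCne : C.Nonempty := by
    obtain ⟨c, -, -, -, -, -, rfl⟩ := h.orbit
    exact range_nonempty c
  have hQ : IsOpen posQuadrant :=
    (isOpen_lt continuous_const continuous_fst).inter (isOpen_lt continuous_const continuous_snd)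
  have hV₀ : posQuadrant ∈ 𝓝ˢ C := hQ.mem_nhdsSet.2 hpos
  obtain ⟨W₁, hW₁, hW₁s⟩ := h.stable _ hV₀
  obtain ⟨W₂, hW₂, hW₂a⟩ := h.attractive
  have hWW : W₁ ∩ W₂ ∈ 𝓝ˢ C := inter_mem hW₁ hW₂
  -- a compact set of the plane is not open, so the basin is larger than the cycle
  obtain ⟨y, hy, hyC⟩ : ∃ y ∈ W₁ ∩ W₂, y ∉ C := by
    by_contra! hsub
    have hopen : IsOpen C := by
      rw [isOpen_iff_mem_nhds]
      intro c hc
      exact mem_of_superset (nhds_le_nhdsSet hc hWW) hsub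
    have huniv : C = univ := IsClopen.eq_univ ⟨hC.isClosed, hopen⟩ hCne
    exact noncompact_univ (ℝ × ℝ) (huniv ▸ hC)
  obtain ⟨ρ, h0, hd, hin⟩ := hW₁s _ hy.1
  obtain ⟨ρ', h0', hd', hlim⟩ := hW₂a _ hy.2
  have hsmooth : ContDiff ℝ 1 (-(N.ampField δ)) := by
    have : ContDiff ℝ 1 (N.ampField δ) := by unfold ampField bracket₁ bracket₂; fun_prop
    exact this.neg
  have heq : ∀ T, 0 ≤ T → EqOn ρ ρ' (Icc 0 T) := fun T _ =>
    eqOn_Icc_of_contDiff hsmooth (fun t ht => (hd t ht.1).continuousAt.continuousWithinAt)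
      (fun t ht => (hd t ht.1).hasDerivWithinAt)
      (fun t ht => (hd' t ht.1).continuousAt.continuousWithinAt)
      (fun t ht => (hd' t ht.1).hasDerivWithinAt) (by rw [h0, h0'])
  have hV : torusLift {y}ᶜ ∈ 𝓝ˢ (torusLift C) :=
    torusLift_mem_nhdsSet (isOpen_compl_singleton.mem_nhdsSet.2 fun c hc hcy => hyC (hcy ▸ hc))
  obtain ⟨W, hW, hWs⟩ := hstab _ hV
  obtain ⟨W', hW', -, hW'W⟩ := exists_nhdsSet_torusLift_subset hC hpos hW
  have hev : ∀ᶠ t in atTop, ρ' t ∈ W' := hlim hW'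
  obtain ⟨T, hTmem, hT0⟩ := (hev.and (eventually_ge_atTop 0)).exists
  rw [← heq T hT0 ⟨hT0, le_rfl⟩] at hTmem
  -- the reversed trajectory from near the torus to the point over `y`
  set χ : ℝ → ℝ × ℝ := fun t => ρ (T - t) with hχ
  have hχd : ∀ t, t ≤ T → HasDerivAt χ (N.ampField δ (χ t)) t := by
    intro t ht
    have h1 := hd (T - t) (by linarith)
    have h2 : HasDerivAt (fun t => T - t) (-1) t := (hasDerivAt_id t).const_sub T
    refine (h1.scomp t h2).congr_deriv ?_
    simp [hχ]
  have hχpos : ∀ t, t ≤ T → χ t ∈ posQuadrant := fun t ht => hin _ (by linarith)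
  set z : ℝ → ℝ × ℝ × ℝ × ℝ := N.liftCurve δ 0 χ with hz
  have hzd : ∀ t, t ≤ T → HasDerivAt z (N.field δ (z t)) t := fun t ht =>
    N.hasDerivAt_liftCurve δ _ (hχd t ht) (hχpos t ht)
  have hz0 : toPhase (z 0) ∈ W := by
    refine hW'W ((N.toPhase_liftCurve_mem δ _ (hχpos 0 hT0)).2 ?_)
    simpa [hχ] using hTmem
  obtain ⟨x, hxs, hx0, hxV⟩ := hWs (z 0) hz0
  have hxz : EqOn x z (Icc 0 T) := by
    have hfs : ContDiff ℝ 1 (N.field δ) := by unfold field bracket₁ bracket₂; fun_prop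
    exact eqOn_Icc_of_contDiff hfs
      (fun t ht => ((hxs t ht.1).continuousWithinAt).mono Icc_subset_Ici_self)
      (fun t ht => (hxs t ht.1).mono (Ici_subset_Ici.2 ht.1))
      (fun t ht => (hzd t ht.2).continuousAt.continuousWithinAt)
      (fun t ht => (hzd t ht.2.le).hasDerivWithinAt) hx0
  have hfin := hxV T hT0
  rw [hxz ⟨hT0, le_rfl⟩] at hfin
  have := (N.toPhase_liftCurve_mem δ _ (hχpos T le_rfl)).1 hfin
  simp [hχ, h0] at this

end TruncatedNormalForm

/-! ### Embedded tori -/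

theorem coe_toCircle_coe (t : ℝ) :
    ((t : Real.Angle).toCircle : ℂ) = Complex.exp (t * Complex.I) := by
  rw [Real.Angle.toCircle_coe, Circle.coe_exp]

theorem exp_mul_I_eq_iff {s t : ℝ} :
    Complex.exp (s * Complex.I) = Complex.exp (t * Complex.I) ↔
      (s : Real.Angle) = (t : Real.Angle) := by
  rw [← coe_toCircle_coe, ← coe_toCircle_coe, Circle.coe_inj]
  constructor
  · intro h
    rw [← Real.Angle.arg_toCircle s, h, Real.Angle.arg_toCircle]
  · intro h; rw [h]

theorem hasDerivAt_exp_line (a b : ℝ) :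
    HasDerivAt (fun t : ℝ => Complex.exp ((a + t * b : ℝ) * Complex.I))
      (b * Complex.I * Complex.exp (a * Complex.I)) 0 := by
  have h1 : HasDerivAt (fun t : ℝ => a + t * b) b 0 := by
    simpa using ((hasDerivAt_id (0 : ℝ)).mul_const b).const_add a
  have h2 := (h1.ofReal_comp.mul_const Complex.I).cexp
  refine h2.congr_deriv ?_
  simp [mul_comm]

theorem eq_zero_of_mul_I_mul_exp {a b : ℝ}
    (h : b * Complex.I * Complex.exp (a * Complex.I) = 0) : b = 0 := by
  rcases mul_eq_zero.1 h with h | h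
  · rcases mul_eq_zero.1 h with h | h
    · exact_mod_cast h
    · exact absurd h Complex.I_ne_zero
  · exact absurd h (Complex.exp_ne_zero _)

theorem DifferentiableAt.hasDerivAt_line {k : ℕ} {F : Type*} [NormedAddCommGroup F]
    [NormedSpace ℝ F] {Ψ : (Fin k → ℝ) → F} {x : Fin k → ℝ} (h : DifferentiableAt ℝ Ψ x)
    (v : Fin k → ℝ) : HasDerivAt (fun t : ℝ => Ψ (x + t • v)) (fderiv ℝ Ψ x v) 0 := by
  have h1 : HasDerivAt (fun t : ℝ => x + t • v) v 0 := by
    simpa using ((hasDerivAt_id (0 : ℝ)).smul_const v).const_add x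
  have h2 : HasFDerivAt Ψ (fderiv ℝ Ψ x) (x + (0 : ℝ) • v) := by
    simpa using h.hasFDerivAt
  exact h2.comp_hasDerivAt (0 : ℝ) h1

/-- The components of the derivative of a curve in `ℝ × ℝ × ℂ × ℂ`. -/
theorem HasDerivAt.components {f : ℝ → ℝ × ℝ × ℂ × ℂ} {f' : ℝ × ℝ × ℂ × ℂ} {t : ℝ}
    (h : HasDerivAt f f' t) :
    HasDerivAt (fun t => (f t).1) f'.1 t ∧ HasDerivAt (fun t => (f t).2.1) f'.2.1 t ∧
      HasDerivAt (fun t => (f t).2.2.1) f'.2.2.1 t ∧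
      HasDerivAt (fun t => (f t).2.2.2) f'.2.2.2 t := by
  have a1 := (ContinuousLinearMap.fst ℝ ℝ (ℝ × ℂ × ℂ)).hasFDerivAt.comp_hasDerivAt t h
  have a2 := (ContinuousLinearMap.snd ℝ ℝ (ℝ × ℂ × ℂ)).hasFDerivAt.comp_hasDerivAt t h
  have b1 := (ContinuousLinearMap.fst ℝ ℝ (ℂ × ℂ)).hasFDerivAt.comp_hasDerivAt t a2
  have b2 := (ContinuousLinearMap.snd ℝ ℝ (ℂ × ℂ)).hasFDerivAt.comp_hasDerivAt t a2
  have c1 := (ContinuousLinearMap.fst ℝ ℂ ℂ).hasFDerivAt.comp_hasDerivAt t b2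
  have c2 := (ContinuousLinearMap.snd ℝ ℂ ℂ).hasFDerivAt.comp_hasDerivAt t b2
  exact ⟨a1, b1, c1, c2⟩

theorem Real.Angle.exists_coe (θ : Real.Angle) : ∃ x : ℝ, (x : Real.Angle) = θ :=
  ⟨θ.toReal, θ.coe_toReal⟩

/-- The torus over a closed orbit of a continuous field in the open quadrant is a `C¹` torus of
dimension three. -/
theorem isEmbeddedTorus_torusLift {g : ℝ × ℝ → ℝ × ℝ} (hg : Continuous g) {C : Set (ℝ × ℝ)}
    (h : IsCycle g C) (hpos : C ⊆ TruncatedNormalForm.posQuadrant) :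
    IsEmbeddedTorus 3 (torusLift C) := by
  obtain ⟨c, τ, hτ, hd, hper, hne, rfl⟩ := h
  have hcpos : ∀ t, c t ∈ TruncatedNormalForm.posQuadrant := fun t => hpos ⟨t, rfl⟩
  have hcc : Continuous c := continuous_iff_continuousAt.2 fun t => (hd t).continuousAt
  have hc1 : ContDiff ℝ 1 c := by
    rw [contDiff_one_iff_deriv]
    refine ⟨fun t => (hd t).differentiableAt, ?_⟩
    have : deriv c = fun t => g (c t) := funext fun t => (hd t).deriv
    rw [this]; exact hg.comp hcc
  obtain ⟨κ, hκ⟩ : ∃ κ : ℝ, κ = τ / (2 * Real.pi) := ⟨_, rfl⟩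
  have hπ := Real.pi_pos
  have hκ0 : 0 < κ := by rw [hκ]; positivity
  have hκτ : κ * (2 * Real.pi) = τ := by rw [hκ]; field_simp
  set Ψ : (Fin 3 → ℝ) → ℝ × ℝ × ℂ × ℂ := fun x =>
    (√(c (κ * x 0)).1, √(c (κ * x 0)).2, Complex.exp ((x 1 : ℝ) * Complex.I),
      Complex.exp ((x 2 : ℝ) * Complex.I)) with hΨ
  have hcκ : ContDiff ℝ 1 fun x : Fin 3 → ℝ => c (κ * x 0) := hc1.comp (by fun_prop)
  have hexp : ∀ i : Fin 3, ContDiff ℝ 1 fun x : Fin 3 → ℝ => Complex.exp ((x i : ℝ) * Complex.I) :=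
    fun i => ((Complex.ofRealCLM.contDiff.comp (contDiff_apply ℝ ℝ i)).mul contDiff_const).cexp
  have hΨ1 : ContDiff ℝ 1 Ψ := by
    refine ContDiff.prodMk ?_ (ContDiff.prodMk ?_ ((hexp 1).prodMk (hexp 2)))
    · exact hcκ.fst.sqrt fun x => (hcpos _).1.ne'
    · exact hcκ.snd.sqrt fun x => (hcpos _).2.ne'
  refine ⟨Ψ, hΨ1, fun x y => ?_, fun x => ?_, ?_⟩
  · rw [Fin.forall_fin_succ, Fin.forall_fin_two]
    simp only [hΨ, Prod.mk.injEq, exp_mul_I_eq_iff, Real.sqrt_inj (hcpos _).1.le (hcpos _).1.le,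
      Real.sqrt_inj (hcpos _).2.le (hcpos _).2.le, ← and_assoc, ← Prod.ext_iff, hper]
    refine and_congr_left' (and_congr_left' ?_)
    rw [Real.Angle.angle_eq_iff_two_pi_dvd_sub]
    refine exists_congr fun n => ?_
    rw [← hκτ]
    constructor
    · intro e
      exact mul_left_cancel₀ hκ0.ne' (by linarith)
    · intro e
      linear_combination κ * e
  · rw [← ContinuousLinearMap.coe_coe, ← LinearMap.ker_eq_bot, LinearMap.ker_eq_bot']
    intro v hv
    have hl := (hΨ1.differentiable one_ne_zero x).hasDerivAt_line v
    rw [show fderiv ℝ Ψ x v = 0 from hv] at hl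
    obtain ⟨k1, k2, k3, k4⟩ := hl.components
    have hline : HasDerivAt (fun t : ℝ => c (κ * (x 0 + t * v 0)))
        ((κ * v 0) • g (c (κ * x 0))) 0 := by
      have h1 : HasDerivAt (fun t : ℝ => κ * (x 0 + t * v 0)) (κ * v 0) 0 := by
        simpa using (((hasDerivAt_id (0 : ℝ)).mul_const (v 0)).const_add (x 0)).const_mul κ
      have h2 : HasDerivAt c (g (c (κ * x 0))) (κ * (x 0 + 0 * v 0)) := by
        simpa using hd (κ * x 0)
      exact h2.scomp (0 : ℝ) h1
    have l1 : HasDerivAt (fun t : ℝ => (c (κ * (x 0 + t * v 0))).1)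
        ((κ * v 0) * (g (c (κ * x 0))).1) 0 :=
      (ContinuousLinearMap.fst ℝ ℝ ℝ).hasFDerivAt.comp_hasDerivAt 0 hline
    have l2 : HasDerivAt (fun t : ℝ => (c (κ * (x 0 + t * v 0))).2)
        ((κ * v 0) * (g (c (κ * x 0))).2) 0 :=
      (ContinuousLinearMap.snd ℝ ℝ ℝ).hasFDerivAt.comp_hasDerivAt 0 hline
    have e1 : (fun t : ℝ => (Ψ (x + t • v)).1 ^ 2) = fun t => (c (κ * (x 0 + t * v 0))).1 := by
      funext t
      simp only [hΨ, Pi.add_apply, Pi.smul_apply, smul_eq_mul]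
      exact Real.sq_sqrt (hcpos _).1.le
    have e2 : (fun t : ℝ => (Ψ (x + t • v)).2.1 ^ 2) = fun t => (c (κ * (x 0 + t * v 0))).2 := by
      funext t
      simp only [hΨ, Pi.add_apply, Pi.smul_apply, smul_eq_mul]
      exact Real.sq_sqrt (hcpos _).2.le
    have q1 : HasDerivAt (fun t : ℝ => (Ψ (x + t • v)).1 ^ 2) _ 0 := k1.pow 2
    have q2 : HasDerivAt (fun t : ℝ => (Ψ (x + t • v)).2.1 ^ 2) _ 0 := k2.pow 2
    rw [e1] at q1
    rw [e2] at q2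
    have z1 := l1.unique q1
    have z2 := l2.unique q2
    simp only [Prod.fst_zero, Prod.snd_zero, mul_zero] at z1 z2
    have hv0 : v 0 = 0 := by
      by_contra hv0
      have hκv : κ * v 0 ≠ 0 := mul_ne_zero hκ0.ne' hv0
      exact hne (κ * x 0) (Prod.ext ((mul_eq_zero.1 z1).resolve_left hκv)
        ((mul_eq_zero.1 z2).resolve_left hκv))
    have hv1 : v 1 = 0 := eq_zero_of_mul_I_mul_exp
      ((hasDerivAt_exp_line (x 1) (v 1)).unique k3)
    have hv2 : v 2 = 0 := eq_zero_of_mul_I_mul_exp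
      ((hasDerivAt_exp_line (x 2) (v 2)).unique k4)
    funext i
    fin_cases i
    exacts [hv0, hv1, hv2]
  · ext w
    constructor
    · rintro ⟨x, rfl⟩
      refine ⟨(√(c (κ * x 0)).1, √(c (κ * x 0)).2, (x 1 : Real.Angle), (x 2 : Real.Angle)),
        ⟨Real.sqrt_pos.2 (hcpos _).1, Real.sqrt_pos.2 (hcpos _).2, κ * x 0, ?_⟩, ?_⟩
      · exact Prod.ext (Real.sq_sqrt (hcpos _).1.le).symm (Real.sq_sqrt (hcpos _).2.le).symm
      · simp only [phaseEmb, coe_toCircle_coe, hΨ]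
    · rintro ⟨⟨r₁, r₂, φ₁, φ₂⟩, ⟨h1, h2, t, ht⟩, rfl⟩
      obtain ⟨a, rfl⟩ := φ₁.exists_coe
      obtain ⟨b, rfl⟩ := φ₂.exists_coe
      refine ⟨![t / κ, a, b], ?_⟩
      simp only at h1 h2 ht
      have : κ * (t / κ) = t := by field_simp
      simp [hΨ, phaseEmb, this, ht, Real.sqrt_sq h1.le, Real.sqrt_sq h2.le]

/-- The states over a point of the open quadrant form an embedded torus of dimension two. -/
theorem isEmbeddedTorus_torusOver (ρ : ℝ × ℝ) :
    IsEmbeddedTorus 2 (TruncatedNormalForm.torusOver ρ) := by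
  set Ψ : (Fin 2 → ℝ) → ℝ × ℝ × ℂ × ℂ := fun x =>
    (√ρ.1, √ρ.2, Complex.exp ((x 0 : ℝ) * Complex.I), Complex.exp ((x 1 : ℝ) * Complex.I)) with hΨ
  have hexp : ∀ i : Fin 2, ContDiff ℝ 1 fun x : Fin 2 → ℝ => Complex.exp ((x i : ℝ) * Complex.I) :=
    fun i => ((Complex.ofRealCLM.contDiff.comp (contDiff_apply ℝ ℝ i)).mul contDiff_const).cexp
  have hΨ1 : ContDiff ℝ 1 Ψ :=
    contDiff_const.prodMk (contDiff_const.prodMk ((hexp 0).prodMk (hexp 1)))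
  refine ⟨Ψ, hΨ1, fun x y => ?_, fun x => ?_, ?_⟩
  · rw [Fin.forall_fin_two]
    simp [hΨ, exp_mul_I_eq_iff]
  · rw [← ContinuousLinearMap.coe_coe, ← LinearMap.ker_eq_bot, LinearMap.ker_eq_bot']
    intro v hv
    have hl := (hΨ1.differentiable one_ne_zero x).hasDerivAt_line v
    rw [show fderiv ℝ Ψ x v = 0 from hv] at hl
    obtain ⟨-, -, k3, k4⟩ := hl.components
    have hv1 : v 0 = 0 := eq_zero_of_mul_I_mul_exp
      ((hasDerivAt_exp_line (x 0) (v 0)).unique k3)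
    have hv2 : v 1 = 0 := eq_zero_of_mul_I_mul_exp
      ((hasDerivAt_exp_line (x 1) (v 1)).unique k4)
    funext i
    fin_cases i
    exacts [hv1, hv2]
  · ext w
    constructor
    · rintro ⟨x, rfl⟩
      refine ⟨(√ρ.1, √ρ.2, (x 0 : Real.Angle), (x 1 : Real.Angle)), ⟨rfl, rfl⟩, ?_⟩
      simp only [phaseEmb, coe_toCircle_coe, hΨ]
    · rintro ⟨⟨r₁, r₂, φ₁, φ₂⟩, ⟨h1, h2⟩, rfl⟩
      obtain ⟨a, rfl⟩ := φ₁.exists_coe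
      obtain ⟨b, rfl⟩ := φ₂.exists_coe
      refine ⟨![a, b], ?_⟩
      simp only at h1 h2
      simp [hΨ, phaseEmb, h1, h2]

theorem mul_add_mul_eq_zero_of_norm_eq_one {f : ℝ → ℂ} {f' : ℂ} {t : ℝ} (h : HasDerivAt f f' t)
    (h1 : ∀ s, ‖f s‖ = 1) : (f t).re * f'.re + (f t).im * f'.im = 0 := by
  have hre : HasDerivAt (fun s => (f s).re) f'.re t :=
    Complex.reCLM.hasFDerivAt.comp_hasDerivAt t h
  have him : HasDerivAt (fun s => (f s).im) f'.im t :=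
    Complex.imCLM.hasFDerivAt.comp_hasDerivAt t h
  have h2 : HasDerivAt (fun s => (f s).re ^ 2 + (f s).im ^ 2) _ t := (hre.pow 2).add (him.pow 2)
  have h3 : (fun s => (f s).re ^ 2 + (f s).im ^ 2) = fun _ => 1 := by
    funext s
    have := Complex.sq_norm (f s)
    rw [h1, Complex.normSq_apply] at this
    linarith
  rw [h3] at h2
  have := (hasDerivAt_const t (1 : ℝ)).unique h2
  norm_num at this
  linarith

/-- The torus of states over a single point is too small to contain a torus of dimension three:
tangent vectors of the latter would have both amplitude components zero and both phase components
in a line. -/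
theorem not_isEmbeddedTorus_of_subset_torusOver {ρ : ℝ × ℝ} {S : Set PhaseSpace}
    (hS : S ⊆ TruncatedNormalForm.torusOver ρ) : ¬ IsEmbeddedTorus 3 S := by
  rintro ⟨Ψ, hΨ1, -, hinj, hrange⟩
  have hmem : ∀ x, ∃ q ∈ S, phaseEmb q = Ψ x := fun x => by
    have : Ψ x ∈ range Ψ := ⟨x, rfl⟩
    rwa [hrange] at this
  have n1 : ∀ x, (Ψ x).1 = √ρ.1 := fun x => by
    obtain ⟨q, hq, e⟩ := hmem x; rw [← e]; exact (hS hq).1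
  have n2 : ∀ x, (Ψ x).2.1 = √ρ.2 := fun x => by
    obtain ⟨q, hq, e⟩ := hmem x; rw [← e]; exact (hS hq).2
  have n3 : ∀ x, ‖(Ψ x).2.2.1‖ = 1 := fun x => by
    obtain ⟨q, hq, e⟩ := hmem x; rw [← e]; exact Circle.norm_coe _
  have n4 : ∀ x, ‖(Ψ x).2.2.2‖ = 1 := fun x => by
    obtain ⟨q, hq, e⟩ := hmem x; rw [← e]; exact Circle.norm_coe _
  set L := fderiv ℝ Ψ 0 with hL
  set z₀ := (Ψ 0).2.2.1 with hz₀
  set w₀ := (Ψ 0).2.2.2 with hw₀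
  -- the angular components of tangent vectors
  let M : (Fin 3 → ℝ) →ₗ[ℝ] ℝ × ℝ :=
    { toFun := fun v => (z₀.re * (L v).2.2.1.im - z₀.im * (L v).2.2.1.re,
        w₀.re * (L v).2.2.2.im - w₀.im * (L v).2.2.2.re)
      map_add' := fun u v => by
        refine Prod.ext ?_ ?_ <;> simp <;> ring
      map_smul' := fun a v => by
        refine Prod.ext ?_ ?_ <;> simp <;> ring }
  have hker : LinearMap.ker M ≠ ⊥ := LinearMap.ker_ne_bot_of_finrank_lt (by simp)
  obtain ⟨v, hv, hv0⟩ := Submodule.exists_mem_ne_zero_of_ne_bot hker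
  have hM : M v = 0 := hv
  have hl := (hΨ1.differentiable one_ne_zero 0).hasDerivAt_line v
  obtain ⟨k1, k2, k3, k4⟩ := hl.components
  have e1 : (L v).1 = 0 := by
    have : (fun t : ℝ => (Ψ (0 + t • v)).1) = fun _ => √ρ.1 := funext fun t => n1 _
    rw [this] at k1
    exact k1.unique (hasDerivAt_const _ _)
  have e2 : (L v).2.1 = 0 := by
    have : (fun t : ℝ => (Ψ (0 + t • v)).2.1) = fun _ => √ρ.2 := funext fun t => n2 _
    rw [this] at k2
    exact k2.unique (hasDerivAt_const _ _)
  have p3 := mul_add_mul_eq_zero_of_norm_eq_one k3 fun t => n3 _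
  have p4 := mul_add_mul_eq_zero_of_norm_eq_one k4 fun t => n4 _
  simp only [zero_smul, add_zero] at p3 p4
  have m1 : z₀.re * (L v).2.2.1.im - z₀.im * (L v).2.2.1.re = 0 := congrArg Prod.fst hM
  have m2 : w₀.re * (L v).2.2.2.im - w₀.im * (L v).2.2.2.re = 0 := congrArg Prod.snd hM
  have key : ∀ {z w : ℂ}, ‖z‖ = 1 → z.re * w.re + z.im * w.im = 0 →
      z.re * w.im - z.im * w.re = 0 → w = 0 := by
    intro z w hz h1 h2
    have hz' := Complex.sq_norm z
    rw [hz, Complex.normSq_apply] at hz'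
    refine Complex.ext ?_ ?_ <;> simp only [Complex.zero_re, Complex.zero_im]
    · linear_combination z.re * h1 - z.im * h2 + w.re * hz'
    · linear_combination z.im * h1 + z.re * h2 + w.im * hz'
  have e3 : (L v).2.2.1 = 0 := key (n3 0) p3 m1
  have e4 : (L v).2.2.2 = 0 := key (n4 0) p4 m2
  have hLv : L v = 0 := Prod.ext e1 (Prod.ext e2 (Prod.ext e3 e4))
  exact hv0 (hinj 0 (by rw [← hL, hLv, map_zero]))

theorem IsEmbeddedTorus.isCompact_image {k : ℕ} {S : Set PhaseSpace} (h : IsEmbeddedTorus k S) :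
    IsCompact (phaseEmb '' S) := by
  obtain ⟨Ψ, hΨ1, hper, -, hrange⟩ := h
  rw [← hrange]
  have : range Ψ = Ψ '' univ.pi fun _ => Icc 0 (0 + 2 * Real.pi) := by
    refine (image_subset_range _ _).antisymm' ?_
    rintro _ ⟨x, rfl⟩
    have hx : ∀ i, ∃ y ∈ Icc 0 (0 + 2 * Real.pi), (x i : Real.Angle) = (y : Real.Angle) := by
      intro i
      obtain ⟨y, hy, hxy⟩ := (show Function.Periodic (fun x : ℝ => (x : Real.Angle)) (2 * Real.pi)
        from fun x => by simp).exists_mem_Ico Real.two_pi_pos (x i) 0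
      exact ⟨y, Ico_subset_Icc_self hy, hxy⟩
    choose y hy hxy using hx
    exact ⟨y, fun i _ => hy i, ((hper x y).2 hxy).symm⟩
  rw [this]
  exact (isCompact_univ_pi fun _ => isCompact_Icc).image hΨ1.continuous

namespace TruncatedNormalForm

variable (N : TruncatedNormalForm) (δ : ℝ × ℝ)

theorem continuous_ampField : Continuous (N.ampField δ) := by
  unfold ampField bracket₁ bracket₂; fun_prop

/-- The lift of a cycle of the amplitude system is an invariant three-torus. -/
theorem isInvariantTorus_torusLift {C : Set (ℝ × ℝ)} (h : IsCycle (N.ampField δ) C)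
    (hpos : C ⊆ posQuadrant) : N.IsInvariantTorus δ 3 (torusLift C) := by
  refine ⟨isEmbeddedTorus_torusLift (N.continuous_ampField δ) h hpos, fun x₀ hx₀ => ?_⟩
  obtain ⟨c, τ, -, hd, -, -, rfl⟩ := h
  obtain ⟨s, hs⟩ := hx₀.2.2
  have hsh : ∀ t, HasDerivAt (fun t => c (t + s)) (N.ampField δ (c (t + s))) t := fun t => by
    simpa using (hd (t + s)).comp_add_const t s
  refine ⟨N.liftCurve δ x₀.2.2 fun t => c (t + s), fun t _ => ?_,
    N.liftCurve_zero δ hx₀.1 hx₀.2.1 (by simpa [toPhase] using hs), fun t => ?_⟩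
  · exact (N.hasDerivAt_liftCurve δ _ (hsh t) (hpos ⟨_, rfl⟩)).hasDerivWithinAt
  · exact (N.toPhase_liftCurve_mem δ (ρ := fun t => c (t + s)) (t := t) _ (hpos ⟨_, rfl⟩)).2 ⟨_, rfl⟩

/-- The lift of an equilibrium of the amplitude system is an invariant two-torus. -/
theorem isInvariantTorus_torusOver {ρ : ℝ × ℝ} (hρ : ρ ∈ posQuadrant)
    (h1 : N.bracket₁ δ ρ = 0) (h2 : N.bracket₂ δ ρ = 0) :
    N.IsInvariantTorus δ 2 (torusOver ρ) := by
  refine ⟨isEmbeddedTorus_torusOver ρ, fun x₀ hx₀ => ?_⟩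
  rw [torusOver_eq_torusLift hρ] at hx₀ ⊢
  have hd : ∀ t : ℝ, HasDerivAt (fun _ : ℝ => ρ) (N.ampField δ ρ) t := fun t => by
    have : N.ampField δ ρ = 0 := by simp [ampField, h1, h2]
    rw [this]
    exact hasDerivAt_const _ _
  refine ⟨N.liftCurve δ x₀.2.2 fun _ => ρ, fun t _ => ?_,
    N.liftCurve_zero δ hx₀.1 hx₀.2.1 (Eq.symm hx₀.2.2), fun t => ?_⟩
  · exact (N.hasDerivAt_liftCurve δ _ (hd t) hρ).hasDerivWithinAt
  · exact (N.toPhase_liftCurve_mem δ (ρ := fun _ => ρ) (t := t) _ hρ).2 rfl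

/-- The squared amplitudes of a state. -/
def amplitudes (q : PhaseSpace) : ℝ × ℝ := (q.1 ^ 2, q.2.1 ^ 2)

/-- The squared amplitudes along an invariant torus form a compact set that is invariant under the
amplitude system. -/
theorem isCompact_amplitudes_image {k : ℕ} {S : Set PhaseSpace} (h : N.IsInvariantTorus δ k S) :
    IsCompact (amplitudes '' S) := by
  have : amplitudes '' S = (fun w : ℝ × ℝ × ℂ × ℂ => (w.1 ^ 2, w.2.1 ^ 2)) '' (phaseEmb '' S) := by
    rw [image_image]; rfl
  rw [this]
  exact h.1.isCompact_image.image (by fun_prop)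

/-- The squared amplitudes along a trajectory in an invariant set are differentiable at time zero
with the velocity of the amplitude field, also where an amplitude vanishes. -/
theorem exists_curve_amplitudes {S : Set PhaseSpace} (h : N.IsInvariant δ S) {ρ : ℝ × ℝ}
    (hρ : ρ ∈ amplitudes '' S) :
    ∃ x : ℝ → ℝ × ℝ, x 0 = ρ ∧ HasDerivAt x (N.ampField δ ρ) 0 ∧ ∀ t, x t ∈ amplitudes '' S := by
  obtain ⟨⟨r₁, r₂, φ₁, φ₂⟩, hq, rfl⟩ := hρ
  obtain ⟨a, rfl⟩ := φ₁.exists_coe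
  obtain ⟨b, rfl⟩ := φ₂.exists_coe
  obtain ⟨x, hx, h0, hin⟩ := h (r₁, r₂, a, b) hq
  have hd : HasDerivAt x _ 0 := (hx 0 (mem_univ _)).hasDerivAt univ_mem
  have d1 : HasDerivAt (fun t => (x t).1) _ 0 :=
    (ContinuousLinearMap.fst ℝ ℝ (ℝ × ℝ × ℝ)).hasFDerivAt.comp_hasDerivAt 0 hd
  have d2 : HasDerivAt (fun t => (x t).2) _ 0 :=
    (ContinuousLinearMap.snd ℝ ℝ (ℝ × ℝ × ℝ)).hasFDerivAt.comp_hasDerivAt 0 hd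
  have d3 : HasDerivAt (fun t => (x t).2.1) _ 0 :=
    (ContinuousLinearMap.fst ℝ ℝ (ℝ × ℝ)).hasFDerivAt.comp_hasDerivAt 0 d2
  have e1 : HasDerivAt (fun t => (x t).1 ^ 2) _ 0 := d1.pow 2
  have e2 : HasDerivAt (fun t => (x t).2.1 ^ 2) _ 0 := d3.pow 2
  refine ⟨fun t => amplitudes (toPhase (x t)), by simp only [h0]; rfl, ?_, fun t => ⟨_, hin t, rfl⟩⟩
  refine (e1.prodMk e2).congr_deriv ?_
  simp only [h0, amplitudes, ampField, field, ContinuousLinearMap.coe_fst',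
    ContinuousLinearMap.coe_snd']
  refine Prod.ext ?_ ?_ <;> simp <;> ring

end TruncatedNormalForm

/-! ### Linear maps of the plane -/

/-- The linear map of the plane with matrix `!![a, b; c, d]`. -/
def planarMap (a b c d : ℝ) : ℝ × ℝ →L[ℝ] ℝ × ℝ :=
  (a • ContinuousLinearMap.fst ℝ ℝ ℝ + b • ContinuousLinearMap.snd ℝ ℝ ℝ).prod
    (c • ContinuousLinearMap.fst ℝ ℝ ℝ + d • ContinuousLinearMap.snd ℝ ℝ ℝ)

@[simp]
theorem planarMap_apply (a b c d : ℝ) (v : ℝ × ℝ) :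
    planarMap a b c d v = (a * v.1 + b * v.2, c * v.1 + d * v.2) := rfl

theorem charpoly_planarMap (a b c d : ℝ) :
    ((planarMap a b c d : ℝ × ℝ →L[ℝ] ℝ × ℝ) : ℝ × ℝ →ₗ[ℝ] ℝ × ℝ).charpoly =
      Polynomial.X ^ 2 - Polynomial.C (a + d) * Polynomial.X + Polynomial.C (a * d - b * c) := by
  have h : LinearMap.toMatrix (Module.Basis.finTwoProd ℝ) (Module.Basis.finTwoProd ℝ)
      ((planarMap a b c d : ℝ × ℝ →L[ℝ] ℝ × ℝ) : ℝ × ℝ →ₗ[ℝ] ℝ × ℝ) = !![a, b; c, d] := by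
    ext i j
    fin_cases i <;> fin_cases j <;> simp [LinearMap.toMatrix_apply]
  rw [← LinearMap.charpoly_toMatrix _ (Module.Basis.finTwoProd ℝ), h, Matrix.charpoly_fin_two]
  simp [Matrix.trace_fin_two, Matrix.det_fin_two]

theorem isInvertible_planarMap {a b c d : ℝ} (h : a * d - b * c ≠ 0) :
    (planarMap a b c d).IsInvertible := by
  obtain ⟨k, hk⟩ : ∃ k, (a * d - b * c) * k = 1 := ⟨_, mul_inv_cancel₀ h⟩
  refine ContinuousLinearMap.IsInvertible.of_inverse
    (g := planarMap (d * k) (-b * k) (-c * k) (a * k)) ?_ ?_ <;>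
  · ext <;> simp only [planarMap_apply, ContinuousLinearMap.comp_apply,
      ContinuousLinearMap.inl_apply, ContinuousLinearMap.inr_apply, ContinuousLinearMap.coe_id',
      id_eq] <;>
    first
    | ring1
    | linear_combination hk

namespace TruncatedNormalForm

variable (N : TruncatedNormalForm)

/-- Partial derivative of `bracket₁` in `ρ₁`. -/
def d₁₁ (δ ρ : ℝ × ℝ) : ℝ := N.p 0 0 δ + 2 * N.P 0 0 δ * ρ.1 + N.P 0 1 δ * ρ.2
/-- Partial derivative of `bracket₁` in `ρ₂`. -/
def d₁₂ (δ ρ : ℝ × ℝ) : ℝ := N.p 0 1 δ + N.P 0 1 δ * ρ.1 + 2 * N.P 0 2 δ * ρ.2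
/-- Partial derivative of `bracket₂` in `ρ₁`. -/
def d₂₁ (δ ρ : ℝ × ℝ) : ℝ := N.p 1 0 δ + 2 * N.P 1 0 δ * ρ.1 + N.P 1 1 δ * ρ.2
/-- Partial derivative of `bracket₂` in `ρ₂`. -/
def d₂₂ (δ ρ : ℝ × ℝ) : ℝ := N.p 1 1 δ + N.P 1 1 δ * ρ.1 + 2 * N.P 1 2 δ * ρ.2

theorem hasFDerivAt_brackets (δ ρ : ℝ × ℝ) :
    HasFDerivAt (fun ρ => (N.bracket₁ δ ρ, N.bracket₂ δ ρ))
      (planarMap (N.d₁₁ δ ρ) (N.d₁₂ δ ρ) (N.d₂₁ δ ρ) (N.d₂₂ δ ρ)) ρ := by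
  have h1 : HasFDerivAt (fun ρ : ℝ × ℝ => ρ.1) (ContinuousLinearMap.fst ℝ ℝ ℝ) ρ := hasFDerivAt_fst
  have h2 : HasFDerivAt (fun ρ : ℝ × ℝ => ρ.2) (ContinuousLinearMap.snd ℝ ℝ ℝ) ρ := hasFDerivAt_snd
  have key : ∀ k a b c d e : ℝ, HasFDerivAt
      (fun ρ : ℝ × ℝ => k + a * ρ.1 + b * ρ.2 + c * ρ.1 ^ 2 + d * ρ.1 * ρ.2 + e * ρ.2 ^ 2)
      ((a + 2 * c * ρ.1 + d * ρ.2) • ContinuousLinearMap.fst ℝ ℝ ℝ +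
        (b + d * ρ.1 + 2 * e * ρ.2) • ContinuousLinearMap.snd ℝ ℝ ℝ) ρ := by
    intro k a b c d e
    refine ((((((h1.const_mul a).const_add k).add (h2.const_mul b)).add
      ((h1.pow 2).const_mul c)).add ((h1.const_mul d).mul h2)).add
      ((h2.pow 2).const_mul e)).congr_fderiv ?_
    ext <;> simp <;> ring
  exact (key _ _ _ _ _ _).prodMk (key _ _ _ _ _ _)

theorem fderiv_ampField {δ ρ : ℝ × ℝ} (h1 : N.bracket₁ δ ρ = 0) (h2 : N.bracket₂ δ ρ = 0) :
    fderiv ℝ (N.ampField δ) ρ =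
      planarMap (2 * ρ.1 * N.d₁₁ δ ρ) (2 * ρ.1 * N.d₁₂ δ ρ) (2 * ρ.2 * N.d₂₁ δ ρ)
        (2 * ρ.2 * N.d₂₂ δ ρ) := by
  have hb := N.hasFDerivAt_brackets δ ρ
  have b1 : HasFDerivAt (fun ρ => N.bracket₁ δ ρ) _ ρ := hb.fst
  have b2 : HasFDerivAt (fun ρ => N.bracket₂ δ ρ) _ ρ := hb.snd
  have e1 : HasFDerivAt (fun ρ : ℝ × ℝ => ρ.1) (ContinuousLinearMap.fst ℝ ℝ ℝ) ρ := hasFDerivAt_fst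
  have e2 : HasFDerivAt (fun ρ : ℝ × ℝ => ρ.2) (ContinuousLinearMap.snd ℝ ℝ ℝ) ρ := hasFDerivAt_snd
  have h : HasFDerivAt (N.ampField δ) _ ρ :=
    ((e1.const_mul 2).mul b1).prodMk ((e2.const_mul 2).mul b2)
  rw [h.fderiv, h1, h2]
  ext <;> simp

/-- When the brackets have a positive Jacobian determinant, a purely imaginary pair of eigenvalues
means that the equilibrium lies in the quadrant and the trace vanishes. -/
theorem isHopfPoint_iff {δ ρ : ℝ × ℝ} (h1 : N.bracket₁ δ ρ = 0) (h2 : N.bracket₂ δ ρ = 0)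
    (hdet : 0 < N.d₁₁ δ ρ * N.d₂₂ δ ρ - N.d₁₂ δ ρ * N.d₂₁ δ ρ) :
    N.IsHopfPoint δ ρ ↔ ρ ∈ posQuadrant ∧ ρ.1 * N.d₁₁ δ ρ + ρ.2 * N.d₂₂ δ ρ = 0 := by
  rw [IsHopfPoint, N.fderiv_ampField h1 h2, charpoly_planarMap]
  refine and_congr_right fun hρ => ⟨?_, fun h => ?_⟩
  · rintro ⟨ω, -, h⟩
    have := congrArg (fun q => Polynomial.coeff q 1) h
    simp only [Polynomial.coeff_add, Polynomial.coeff_sub, Polynomial.coeff_X_pow,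
      Polynomial.coeff_C_mul, Polynomial.coeff_X, Polynomial.coeff_C] at this
    norm_num at this
    linarith
  · have hpos : 0 < 4 * ρ.1 * ρ.2 * (N.d₁₁ δ ρ * N.d₂₂ δ ρ - N.d₁₂ δ ρ * N.d₂₁ δ ρ) := by
      have := hρ.1
      have := hρ.2
      positivity
    refine ⟨√(4 * ρ.1 * ρ.2 * (N.d₁₁ δ ρ * N.d₂₂ δ ρ - N.d₁₂ δ ρ * N.d₂₁ δ ρ)),
      Real.sqrt_pos.2 hpos, ?_⟩
    rw [Real.sq_sqrt hpos.le, show 2 * ρ.1 * N.d₁₁ δ ρ + 2 * ρ.2 * N.d₂₂ δ ρ = 0 by linarith,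
      map_zero, zero_mul, sub_zero]
    congr 2
    ring

/-- The branch of nontrivial equilibria obtained from the implicit function theorem, with its
derivative at the origin. -/
theorem exists_branch (hp : ∀ j k, ContDiffAt ℝ 1 (N.p j k) 0)
    (hP : ∀ j l, ContDiffAt ℝ 1 (N.P j l) 0)
    (hdet : N.p 0 0 0 * N.p 1 1 0 - N.p 0 1 0 * N.p 1 0 0 ≠ 0) :
    ∃ E : ℝ × ℝ → ℝ × ℝ, N.IsNontrivialBranch E ∧ ContDiffAt ℝ 1 E 0 ∧ E 0 = 0 ∧
      (∀ᶠ δ in 𝓝 0, N.bracket₁ δ (E δ) = 0 ∧ N.bracket₂ δ (E δ) = 0) := by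
  set f : (ℝ × ℝ) × (ℝ × ℝ) → ℝ × ℝ := fun u => (N.bracket₁ u.1 u.2, N.bracket₂ u.1 u.2) with hf
  have cp : ∀ j k, ContDiffAt ℝ 1 (fun u : (ℝ × ℝ) × (ℝ × ℝ) => N.p j k u.1) (0, 0) :=
    fun j k => ContDiffAt.comp (g := N.p j k) (0, 0) (hp j k) contDiffAt_fst
  have cP : ∀ j k, ContDiffAt ℝ 1 (fun u : (ℝ × ℝ) × (ℝ × ℝ) => N.P j k u.1) (0, 0) :=
    fun j k => ContDiffAt.comp (g := N.P j k) (0, 0) (hP j k) contDiffAt_fst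
  have hf1 : ContDiffAt ℝ 1 f (0, 0) := by
    simp only [hf, bracket₁, bracket₂]
    have := cp 0 0; have := cp 0 1; have := cp 1 0; have := cp 1 1
    have := cP 0 0; have := cP 0 1; have := cP 0 2
    have := cP 1 0; have := cP 1 1; have := cP 1 2
    fun_prop
  have hf0 : f (0, 0) = 0 := by simp [hf, bracket₁, bracket₂]
  have hinv : (fderiv ℝ f (0, 0) ∘L .inr ℝ (ℝ × ℝ) (ℝ × ℝ)).IsInvertible := by
    have h1 : HasFDerivAt (fun ρ : ℝ × ℝ => f (0, ρ))
        (fderiv ℝ f (0, 0) ∘L .inr ℝ (ℝ × ℝ) (ℝ × ℝ)) 0 :=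
      HasFDerivAt.comp (g := f) (0 : ℝ × ℝ) (hf1.differentiableAt one_ne_zero).hasFDerivAt
        (hasFDerivAt_prodMk_right 0 0)
    rw [h1.unique (N.hasFDerivAt_brackets 0 0)]
    refine isInvertible_planarMap ?_
    simpa [d₁₁, d₁₂, d₂₁, d₂₂] using hdet
  have hE0 : hf1.implicitFunction one_ne_zero hinv 0 = 0 :=
    hf1.implicitFunction_apply_self one_ne_zero hinv
  have hE1 : ContDiffAt ℝ 1 (hf1.implicitFunction one_ne_zero hinv) 0 :=
    hf1.contDiffAt_implicitFunction one_ne_zero hinv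
  refine ⟨hf1.implicitFunction one_ne_zero hinv, ⟨?_, ?_⟩, hE1, hE0, ?_⟩
  · simpa [ContinuousAt, hE0] using hE1.continuousAt
  · have h := hf1.eventually_apply_eq_iff_implicitFunction one_ne_zero hinv
    rw [nhds_prod_eq] at h
    obtain ⟨pa, ha, pb, hb, hab⟩ := eventually_prod_iff.1 h
    refine ⟨{ρ | pb ρ}, hb, ?_⟩
    filter_upwards [ha] with δ hδ ρ hρ
    have := hab hδ hρ
    rw [hf0] at this
    rw [eq_comm (a := ρ), ← this]
    exact Prod.mk_eq_zero.symm
  · filter_upwards [hf1.eventually_apply_implicitFunction one_ne_zero hinv] with δ hδ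
    rw [hf0] at hδ
    exact Prod.mk_eq_zero.1 hδ

end TruncatedNormalForm

/-! ### Expansions along the branch of equilibria -/

theorem isBigO_one_of_continuousAt {f : ℝ × ℝ → ℝ} (h : ContinuousAt f 0) :
    f =O[𝓝 0] fun _ => (1 : ℝ) := h.isBigO_one ℝ

/-- A quantity with nonzero linear part has near the origin the sign of its linear part. -/
theorem eventually_pos_iff_of_isBigO {φ : ℝ → ℝ} {c : ℝ} (hc : c ≠ 0)
    (h : (fun x => φ x - c * x) =O[𝓝 0] fun x => x ^ 2) : ∀ᶠ x in 𝓝 0, 0 < φ x ↔ 0 < c * x := by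
  have h2 : (fun x => φ x - c * x) =o[𝓝 0] fun x : ℝ => x := by
    refine h.trans_isLittleO ?_
    simpa using isLittleO_pow_pow (𝕜 := ℝ) (one_lt_two)
  have hc2 : 0 < |c| / 2 := by positivity
  filter_upwards [h2.bound hc2] with x hx
  have e : |c| * |x| = |c * x| := (abs_mul _ _).symm
  rw [Real.norm_eq_abs, Real.norm_eq_abs] at hx
  have h3 : |φ x - c * x| ≤ |c * x| / 2 := by linarith
  rw [abs_le] at h3
  constructor
  · intro hφ
    rcases lt_trichotomy (c * x) 0 with h0 | h0 | h0
    · rw [abs_of_neg h0] at h3; linarith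
    · rw [h0] at h3; simp at h3; linarith
    · exact h0
  · intro h0
    rw [abs_of_pos h0] at h3; linarith

namespace TruncatedNormalForm

/-- `E` is a continuously differentiable branch of common zeros of the two brackets, starting at
the origin, of a normal form with continuously differentiable coefficients. -/
structure IsSmoothBranch (N : TruncatedNormalForm) (E : ℝ × ℝ → ℝ × ℝ) : Prop where
  p : ∀ j k, ContDiffAt ℝ 1 (N.p j k) 0
  P : ∀ j l, ContDiffAt ℝ 1 (N.P j l) 0
  contDiffAt : ContDiffAt ℝ 1 E 0
  zero : E 0 = 0
  bracket₁ : ∀ᶠ δ in 𝓝 0, N.bracket₁ δ (E δ) = 0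
  bracket₂ : ∀ᶠ δ in 𝓝 0, N.bracket₂ δ (E δ) = 0

namespace IsSmoothBranch

variable {N : TruncatedNormalForm} {E : ℝ × ℝ → ℝ × ℝ}

theorem isBigO_E (h : N.IsSmoothBranch E) : E =O[𝓝 0] fun δ : ℝ × ℝ => ‖δ‖ := by
  simpa [h.zero] using (h.contDiffAt.differentiableAt one_ne_zero).isBigO_sub.norm_right

theorem isBigO_fst (h : N.IsSmoothBranch E) : (fun δ => (E δ).1) =O[𝓝 0] fun δ : ℝ × ℝ => ‖δ‖ :=
  isBigO_fst_prod.trans h.isBigO_E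

theorem isBigO_snd (h : N.IsSmoothBranch E) : (fun δ => (E δ).2) =O[𝓝 0] fun δ : ℝ × ℝ => ‖δ‖ :=
  isBigO_snd_prod.trans h.isBigO_E

theorem isBigO_p (h : N.IsSmoothBranch E) (j k : Fin 2) :
    (fun δ => N.p j k δ - N.p j k 0) =O[𝓝 0] fun δ : ℝ × ℝ => ‖δ‖ := by
  simpa using ((h.p j k).differentiableAt one_ne_zero).isBigO_sub.norm_right

theorem isBigO_quad (h : N.IsSmoothBranch E) {a b c : ℝ × ℝ → ℝ} (ha : ContinuousAt a 0)
    (hb : ContinuousAt b 0) (hc : ContinuousAt c 0) :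
    (fun δ => a δ * (E δ).1 ^ 2 + b δ * (E δ).1 * (E δ).2 + c δ * (E δ).2 ^ 2) =O[𝓝 0]
      fun δ : ℝ × ℝ => ‖δ‖ ^ 2 := by
  have h1 := h.isBigO_fst
  have h2 := h.isBigO_snd
  have t1 := (isBigO_one_of_continuousAt ha).mul (h1.mul h1)
  have t2 := (isBigO_one_of_continuousAt hb).mul (h1.mul h2)
  have t3 := (isBigO_one_of_continuousAt hc).mul (h2.mul h2)
  refine ((t1.add t2).add t3).congr (fun δ => ?_) fun δ => ?_ <;> ring

/-- The quadratic remainder of the brackets along the branch. -/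
theorem isBigO_rem (h : N.IsSmoothBranch E) (j : Fin 2) :
    (fun δ => N.P j 0 δ * (E δ).1 ^ 2 + N.P j 1 δ * (E δ).1 * (E δ).2 + N.P j 2 δ * (E δ).2 ^ 2)
      =O[𝓝 0] fun δ : ℝ × ℝ => ‖δ‖ ^ 2 :=
  h.isBigO_quad (h.P j 0).continuousAt (h.P j 1).continuousAt (h.P j 2).continuousAt

theorem isBigO_p_mul (h : N.IsSmoothBranch E) (j k : Fin 2) :
    (fun δ => (N.p j k δ - N.p j k 0) * (E δ).1) =O[𝓝 0] (fun δ : ℝ × ℝ => ‖δ‖ ^ 2) ∧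
    (fun δ => (N.p j k δ - N.p j k 0) * (E δ).2) =O[𝓝 0] (fun δ : ℝ × ℝ => ‖δ‖ ^ 2) := by
  simp only [pow_two]
  exact ⟨(h.isBigO_p j k).mul h.isBigO_fst, (h.isBigO_p j k).mul h.isBigO_snd⟩

/-- The linear relations between the parameters and the equilibrium, to first order. -/
theorem isBigO_linear (h : N.IsSmoothBranch E) :
    (fun δ : ℝ × ℝ => δ.1 + N.p 0 0 0 * (E δ).1 + N.p 0 1 0 * (E δ).2) =O[𝓝 0]
      (fun δ : ℝ × ℝ => ‖δ‖ ^ 2) ∧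
    (fun δ : ℝ × ℝ => δ.2 + N.p 1 0 0 * (E δ).1 + N.p 1 1 0 * (E δ).2) =O[𝓝 0]
      (fun δ : ℝ × ℝ => ‖δ‖ ^ 2) := by
  constructor
  · have t := (((h.isBigO_p_mul 0 0).1.add (h.isBigO_p_mul 0 1).2).add (h.isBigO_rem 0)).neg_left
    refine t.congr' ?_ EventuallyEq.rfl
    filter_upwards [h.bracket₁] with δ hδ
    rw [TruncatedNormalForm.bracket₁] at hδ
    linear_combination -hδ
  · have t := (((h.isBigO_p_mul 1 0).1.add (h.isBigO_p_mul 1 1).2).add (h.isBigO_rem 1)).neg_left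
    refine t.congr' ?_ EventuallyEq.rfl
    filter_upwards [h.bracket₂] with δ hδ
    rw [TruncatedNormalForm.bracket₂] at hδ
    linear_combination -hδ

/-- The equilibrium to first order in the parameters. -/
theorem isBigO_equilibrium (h : N.IsSmoothBranch E)
    (hdet : N.p 0 0 0 * N.p 1 1 0 - N.p 0 1 0 * N.p 1 0 0 ≠ 0) :
    (fun δ : ℝ × ℝ => (E δ).1 - (N.p 0 1 0 * δ.2 - N.p 1 1 0 * δ.1) /
      (N.p 0 0 0 * N.p 1 1 0 - N.p 0 1 0 * N.p 1 0 0)) =O[𝓝 0] (fun δ : ℝ × ℝ => ‖δ‖ ^ 2) ∧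
    (fun δ : ℝ × ℝ => (E δ).2 - (N.p 1 0 0 * δ.1 - N.p 0 0 0 * δ.2) /
      (N.p 0 0 0 * N.p 1 1 0 - N.p 0 1 0 * N.p 1 0 0)) =O[𝓝 0] (fun δ : ℝ × ℝ => ‖δ‖ ^ 2) := by
  obtain ⟨l1, l2⟩ := h.isBigO_linear
  set D := N.p 0 0 0 * N.p 1 1 0 - N.p 0 1 0 * N.p 1 0 0 with hD
  constructor
  · refine ((l1.const_mul_left (N.p 1 1 0 / D)).sub (l2.const_mul_left (N.p 0 1 0 / D))).congr_left
      fun δ => ?_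
    field_simp
    rw [hD]; ring
  · refine ((l2.const_mul_left (N.p 0 0 0 / D)).sub (l1.const_mul_left (N.p 1 0 0 / D))).congr_left
      fun δ => ?_
    field_simp
    rw [hD]; ring

/-- Leading part of the equilibrium in the scaled coordinates. -/
theorem isBigO_scaled (h : N.IsSmoothBranch E) (h1 : N.p 0 0 0 ≠ 0) (h2 : N.p 1 1 0 ≠ 0)
    (hdet : N.γ 0 * N.σ 0 ≠ 1) :
    (fun δ : ℝ × ℝ => N.scaled δ (E δ) -
      (Real.sign (N.p 0 0 0) * ((δ.1 - N.γ δ * δ.2) / (N.γ δ * N.σ δ - 1)),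
        -Real.sign (N.p 1 1 0) * ((N.σ δ * δ.1 - δ.2) / (N.γ δ * N.σ δ - 1)))) =O[𝓝 0]
      fun δ : ℝ × ℝ => ‖δ‖ ^ 2 := by
  have c1 := (h.p 0 0).continuousAt
  have c2 := (h.p 1 1).continuousAt
  have cγ : ContinuousAt N.γ 0 := (h.p 0 1).continuousAt.div c2 h2
  have cσ : ContinuousAt N.σ 0 := (h.p 1 0).continuousAt.div c1 h1
  have cD : ContinuousAt (fun δ => N.γ δ * N.σ δ - 1) 0 := (cγ.mul cσ).sub continuousAt_const
  have hD : N.γ 0 * N.σ 0 - 1 ≠ 0 := sub_ne_zero.2 hdet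
  have habs : ∀ {f : ℝ × ℝ → ℝ}, ContinuousAt f 0 → f 0 ≠ 0 →
      ∀ᶠ δ in 𝓝 0, |f δ| = Real.sign (f 0) * f δ := by
    intro f hf hf0
    rcases lt_or_gt_of_ne hf0 with h0 | h0
    · filter_upwards [hf.eventually_lt_const h0] with δ hδ
      rw [Real.sign_of_neg h0, abs_of_neg hδ]; ring
    · filter_upwards [hf.eventually_const_lt h0] with δ hδ
      rw [Real.sign_of_pos h0, abs_of_pos hδ]; ring
  have r1 := h.isBigO_rem 0
  have r2 := h.isBigO_rem 1
  have q1 := isBigO_one_of_continuousAt (continuousAt_const (y := Real.sign (N.p 0 0 0)).div cD hD)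
  have q2 := isBigO_one_of_continuousAt (continuousAt_const (y := Real.sign (N.p 1 1 0)).div cD hD)
  have s1 := q1.mul (r1.sub (((isBigO_one_of_continuousAt cγ).mul r2).congr_right fun δ => one_mul _))
  have s2 := q2.mul (r2.sub (((isBigO_one_of_continuousAt cσ).mul r1).congr_right fun δ => one_mul _))
  simp only [one_mul, Pi.div_apply] at s1 s2
  refine isBigO_prod_left.2 ⟨s1.congr' ?_ EventuallyEq.rfl, s2.congr' ?_ EventuallyEq.rfl⟩
  · filter_upwards [habs c1 h1, h.bracket₁, h.bracket₂, cD.eventually_ne hD, c1.eventually_ne h1,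
      c2.eventually_ne h2] with δ ha e1 e2 hDδ n1 n2
    simp only [scaled, ha]
    rw [TruncatedNormalForm.bracket₁] at e1
    rw [TruncatedNormalForm.bracket₂] at e2
    have g1 : N.p 0 1 δ = N.γ δ * N.p 1 1 δ := by rw [γ]; field_simp
    have g2 : N.p 1 0 δ = N.σ δ * N.p 0 0 δ := by rw [σ]; field_simp
    rw [g1] at e1
    rw [g2] at e2
    field_simp
    linear_combination Real.sign (N.p 0 0 0) * (e1 - N.γ δ * e2)
  · filter_upwards [habs c2 h2, h.bracket₁, h.bracket₂, cD.eventually_ne hD, c1.eventually_ne h1,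
      c2.eventually_ne h2] with δ ha e1 e2 hDδ n1 n2
    simp only [scaled, ha]
    rw [TruncatedNormalForm.bracket₁] at e1
    rw [TruncatedNormalForm.bracket₂] at e2
    have g1 : N.p 0 1 δ = N.γ δ * N.p 1 1 δ := by rw [γ]; field_simp
    have g2 : N.p 1 0 δ = N.σ δ * N.p 0 0 δ := by rw [σ]; field_simp
    rw [g1] at e1
    rw [g2] at e2
    field_simp
    linear_combination Real.sign (N.p 1 1 0) * (e2 - N.σ δ * e1)

/-- The equilibrium lies in the open quadrant for some arbitrarily small parameters. -/
theorem frequently_mem_posQuadrant (h : N.IsSmoothBranch E)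
    (hdet : N.p 0 0 0 * N.p 1 1 0 - N.p 0 1 0 * N.p 1 0 0 ≠ 0) :
    ∃ᶠ δ in 𝓝 (0 : ℝ × ℝ), E δ ∈ posQuadrant := by
  -- along this ray the equilibrium is `(x, x)` to first order
  set v : ℝ → ℝ × ℝ := fun x =>
    (-(N.p 0 0 0 + N.p 0 1 0) * x, -(N.p 1 0 0 + N.p 1 1 0) * x) with hv
  have hvc : Continuous v := by fun_prop
  have hvt : Tendsto v (𝓝 0) (𝓝 0) := by
    have := hvc.tendsto 0
    rwa [show v 0 = 0 by simp [hv]] at this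
  have hvO : (fun x => ‖v x‖ ^ 2) =O[𝓝 0] fun x : ℝ => x ^ 2 := by
    refine IsBigO.pow ?_ 2
    refine IsBigO.norm_left (isBigO_prod_left.2 ⟨?_, ?_⟩)
    · exact (isBigO_refl _ _).const_mul_left _
    · exact (isBigO_refl _ _).const_mul_left _
  obtain ⟨e1, e2⟩ := h.isBigO_equilibrium hdet
  have f1 := eventually_pos_iff_of_isBigO (φ := fun x => (E (v x)).1) one_ne_zero
    (((e1.comp_tendsto hvt).trans hvO).congr_left fun x => by
      simp only [hv, Function.comp]; field_simp; ring)
  have f2 := eventually_pos_iff_of_isBigO (φ := fun x => (E (v x)).2) one_ne_zero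
    (((e2.comp_tendsto hvt).trans hvO).congr_left fun x => by
      simp only [hv, Function.comp]; field_simp; ring)
  have hev : ∀ᶠ x in 𝓝[>] (0 : ℝ), E (v x) ∈ posQuadrant := by
    filter_upwards [nhdsWithin_le_nhds f1, nhdsWithin_le_nhds f2, self_mem_nhdsWithin] with x h1 h2 hx
    exact ⟨h1.2 (by simpa using hx), h2.2 (by simpa using hx)⟩
  exact (hvt.mono_left nhdsWithin_le_nhds).frequently hev.frequently

theorem hasInvariantTwoTori (h : N.IsSmoothBranch E)
    (hdet : N.p 0 0 0 * N.p 1 1 0 - N.p 0 1 0 * N.p 1 0 0 ≠ 0) : N.HasInvariantTwoTori E := by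
  refine ⟨h.frequently_mem_posQuadrant hdet, ?_⟩
  filter_upwards [h.bracket₁, h.bracket₂] with δ h1 h2 hE
  exact N.isInvariantTorus_torusOver δ hE h1 h2

end IsSmoothBranch
end TruncatedNormalForm

/-! ### The Hopf curve -/

namespace TruncatedNormalForm

/-- Half the trace of the linearized amplitude system along the branch. -/
def halfTrace (N : TruncatedNormalForm) (E : ℝ × ℝ → ℝ × ℝ) (δ : ℝ × ℝ) : ℝ :=
  (E δ).1 * N.d₁₁ δ (E δ) + (E δ).2 * N.d₂₂ δ (E δ)

/-- The resonance relations between the cubic coefficients at the origin, in the case where the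
diagonal coefficients have opposite signs. -/
structure IsResonant (N : TruncatedNormalForm) : Prop where
  p12 : N.p 0 1 0 = 2 * N.p 0 0 0
  p21 : N.p 1 0 0 = 2 * N.p 1 1 0
  neg : N.p 0 0 0 * N.p 1 1 0 < 0

namespace IsResonant

variable {N : TruncatedNormalForm}

theorem p11_ne (r : N.IsResonant) : N.p 0 0 0 ≠ 0 := fun h => by simpa [h] using r.neg
theorem p22_ne (r : N.IsResonant) : N.p 1 1 0 ≠ 0 := fun h => by simpa [h] using r.neg

theorem det (r : N.IsResonant) :
    N.p 0 0 0 * N.p 1 1 0 - N.p 0 1 0 * N.p 1 0 0 = -3 * (N.p 0 0 0 * N.p 1 1 0) := by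
  rw [r.p12, r.p21]; ring

theorem det_ne (r : N.IsResonant) : N.p 0 0 0 * N.p 1 1 0 - N.p 0 1 0 * N.p 1 0 0 ≠ 0 := by
  rw [r.det]; have := r.neg; intro h; linarith

theorem γ_mul (r : N.IsResonant) : N.γ 0 * N.p 1 1 0 = 2 * N.p 0 0 0 := by
  rw [γ, r.p12, div_mul_cancel₀ _ r.p22_ne]

theorem σ_mul (r : N.IsResonant) : N.σ 0 * N.p 0 0 0 = 2 * N.p 1 1 0 := by
  rw [σ, r.p21, div_mul_cancel₀ _ r.p11_ne]

theorem γ_neg (r : N.IsResonant) : N.γ 0 < 0 := by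
  have h := r.γ_mul
  have hn := r.neg
  by_contra! h0
  have h2 : N.γ 0 * N.p 1 1 0 ^ 2 = 2 * (N.p 0 0 0 * N.p 1 1 0) := by
    linear_combination N.p 1 1 0 * h
  linarith [mul_nonneg h0 (sq_nonneg (N.p 1 1 0))]

theorem σ_neg (r : N.IsResonant) : N.σ 0 < 0 := by
  have h := r.σ_mul
  have hn := r.neg
  by_contra! h0
  have h2 : N.σ 0 * N.p 0 0 0 ^ 2 = 2 * (N.p 0 0 0 * N.p 1 1 0) := by
    linear_combination N.p 0 0 0 * h
  linarith [mul_nonneg h0 (sq_nonneg (N.p 0 0 0))]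

theorem γ_mul_σ (r : N.IsResonant) : N.γ 0 * N.σ 0 = 4 := by
  have h1 := r.γ_mul
  have h2 := r.σ_mul
  have : (N.γ 0 * N.σ 0 - 4) * (N.p 0 0 0 * N.p 1 1 0) = 0 := by
    linear_combination N.σ 0 * N.p 0 0 0 * h1 + 2 * N.p 0 0 0 * h2
  linarith [(mul_eq_zero.1 this).resolve_right r.neg.ne]

end IsResonant

namespace IsSmoothBranch

variable {N : TruncatedNormalForm} {E : ℝ × ℝ → ℝ × ℝ}

theorem contDiffAt_halfTrace (h : N.IsSmoothBranch E) : ContDiffAt ℝ 1 (N.halfTrace E) 0 := by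
  have := h.p 0 0; have := h.p 1 1; have := h.P 0 0; have := h.P 0 1
  have := h.P 1 1; have := h.P 1 2; have := h.contDiffAt
  unfold halfTrace d₁₁ d₂₂
  fun_prop

/-- The trace to first order in the parameters. -/
theorem isBigO_halfTrace (h : N.IsSmoothBranch E) (r : N.IsResonant) :
    (fun δ : ℝ × ℝ => N.halfTrace E δ - ((1 - N.σ 0) / 3 * δ.1 + (1 - N.γ 0) / 3 * δ.2)) =O[𝓝 0]
      fun δ : ℝ × ℝ => ‖δ‖ ^ 2 := by
  obtain ⟨l1, l2⟩ := h.isBigO_linear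
  have c : ∀ j l, ContinuousAt (N.P j l) 0 := fun j l => (h.P j l).continuousAt
  have q := h.isBigO_quad ((c 0 0).const_mul 2) ((c 0 1).add (c 1 1)) ((c 1 2).const_mul 2)
  have t := ((q.add ((h.isBigO_p_mul 0 0).1.add (h.isBigO_p_mul 1 1).2)).sub
    (l1.const_mul_left ((1 - N.σ 0) / 3))).sub (l2.const_mul_left ((1 - N.γ 0) / 3))
  refine t.congr_left fun δ => ?_
  have h1 := r.γ_mul
  have h2 := r.σ_mul
  simp only [halfTrace, d₁₁, d₂₂, r.p12, r.p21, Pi.add_apply]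
  linear_combination ((E δ).2 / 3 + 2 * (E δ).1 / 3) * h1 + ((E δ).1 / 3 + 2 * (E δ).2 / 3) * h2

/-- The linear part of the trace. -/
theorem hasStrictFDerivAt_halfTrace (h : N.IsSmoothBranch E) (r : N.IsResonant) :
    HasStrictFDerivAt (N.halfTrace E) (((1 - N.σ 0) / 3) • ContinuousLinearMap.fst ℝ ℝ ℝ +
      ((1 - N.γ 0) / 3) • ContinuousLinearMap.snd ℝ ℝ ℝ) 0 := by
  have h1 := h.contDiffAt_halfTrace.hasStrictFDerivAt one_ne_zero
  refine h1.congr_fderiv ?_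
  refine HasFDerivAt.fderiv (.of_isLittleO ?_)
  have h2 : (fun δ : ℝ × ℝ => ‖δ‖ ^ 2) =o[𝓝 0] fun δ : ℝ × ℝ => δ - 0 := by
    simpa using isLittleO_norm_pow_id (E' := ℝ × ℝ) one_lt_two
  refine ((h.isBigO_halfTrace r).trans_isLittleO h2).congr_left fun δ => ?_
  simp [halfTrace, h.zero]

/-- The curve on which the trace vanishes, and the sign of the trace on either side of it. -/
theorem exists_trace_curve (h : N.IsSmoothBranch E) (r : N.IsResonant) :
    ∃ g : ℝ → ℝ, ContDiffAt ℝ 1 g 0 ∧ g 0 = 0 ∧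
      ((fun x => g x - -((N.σ 0 - 1) / (N.γ 0 - 1)) * x) =O[𝓝 0] fun x => x ^ 2) ∧
      ∀ᶠ δ : ℝ × ℝ in 𝓝 0, (0 < N.halfTrace E δ ↔ g δ.1 < δ.2) ∧
        (N.halfTrace E δ = 0 ↔ δ.2 = g δ.1) := by
  have hc : 0 < (1 - N.γ 0) / 3 := by have := r.γ_neg; linarith
  have hγ : N.γ 0 - 1 ≠ 0 := by have := r.γ_neg; linarith
  set c := (1 - N.γ 0) / 3 with hcdef
  have hs := h.hasStrictFDerivAt_halfTrace r
  have ht : ContDiffAt ℝ 1 (N.halfTrace E) ((0 : ℝ), (0 : ℝ)) := h.contDiffAt_halfTrace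
  have ht0 : N.halfTrace E ((0 : ℝ), (0 : ℝ)) = 0 := by
    have := h.zero
    rw [← Prod.mk_zero_zero] at this
    simp [halfTrace, this]
  have hinv : (fderiv ℝ (N.halfTrace E) ((0 : ℝ), (0 : ℝ)) ∘L .inr ℝ ℝ ℝ).IsInvertible := by
    have e : fderiv ℝ (N.halfTrace E) ((0 : ℝ), (0 : ℝ)) = _ := hs.hasFDerivAt.fderiv
    rw [e]
    refine ContinuousLinearMap.IsInvertible.of_inverse (g := c⁻¹ • ContinuousLinearMap.id ℝ ℝ) ?_ ?_
    · ext; simpa [← hcdef] using inv_mul_cancel₀ hc.ne'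
    · ext; simpa [← hcdef] using mul_inv_cancel₀ hc.ne'
  obtain ⟨g, hg⟩ : ∃ g, g = ht.implicitFunction one_ne_zero hinv := ⟨_, rfl⟩
  have hg0 : g 0 = 0 := hg ▸ ht.implicitFunction_apply_self one_ne_zero hinv
  have hg1 : ContDiffAt ℝ 1 g 0 := hg ▸ ht.contDiffAt_implicitFunction one_ne_zero hinv
  have hgt : ∀ᶠ x in 𝓝 (0 : ℝ), N.halfTrace E (x, g x) = 0 := by
    have := ht.eventually_apply_implicitFunction one_ne_zero hinv
    rw [ht0] at this
    exact hg ▸ this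
  have hgO : g =O[𝓝 0] fun x : ℝ => x := by
    simpa [hg0] using (hg1.differentiableAt one_ne_zero).isBigO_sub
  have hgc : Tendsto (fun x : ℝ => (x, g x)) (𝓝 0) (𝓝 (0 : ℝ × ℝ)) := by
    have : ContinuousAt (fun x : ℝ => (x, g x)) 0 := continuousAt_id.prodMk hg1.continuousAt
    rwa [ContinuousAt, hg0] at this
  have hvO : (fun x => ‖(x, g x)‖ ^ 2) =O[𝓝 0] fun x : ℝ => x ^ 2 :=
    (IsBigO.norm_left (isBigO_prod_left.2 ⟨isBigO_refl _ _, hgO⟩)).pow 2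
  refine ⟨g, hg1, hg0, ?_, ?_⟩
  · have hr := ((h.isBigO_halfTrace r).comp_tendsto hgc).trans hvO
    have := (hr.const_mul_left (-c⁻¹))
    refine this.congr' ?_ EventuallyEq.rfl
    filter_upwards [hgt] with x hx
    have h3 : (1 - N.γ 0) ≠ 0 := by intro h0; apply hγ; linarith
    simp only [Function.comp, hx, hcdef]
    field_simp
    ring
  · have ho := hs.isLittleO.comp_tendsto
      (show Tendsto (fun δ : ℝ × ℝ => (δ, (δ.1, g δ.1))) (𝓝 0) (𝓝 ((0 : ℝ × ℝ), (0 : ℝ × ℝ))) from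
        tendsto_id.prodMk_nhds (hgc.comp (by simpa using (continuous_fst (X := ℝ) (Y := ℝ)).tendsto 0)))
    have hfst : Tendsto (fun δ : ℝ × ℝ => δ.1) (𝓝 0) (𝓝 0) := by
      simpa using (continuous_fst (X := ℝ) (Y := ℝ)).tendsto 0
    filter_upwards [ho.bound (half_pos hc), hfst.eventually hgt] with δ hδ h0
    simp only [Function.comp, h0] at hδ
    have e1 : δ - (δ.1, g δ.1) = (0, δ.2 - g δ.1) := by ext <;> simp
    rw [e1] at hδ
    have e2 : ‖((0 : ℝ), δ.2 - g δ.1)‖ = |δ.2 - g δ.1| := by simp [Prod.norm_def]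
    rw [e2] at hδ
    simp only [_root_.add_apply, _root_.smul_apply,
      ContinuousLinearMap.coe_fst', ContinuousLinearMap.coe_snd', smul_eq_mul, mul_zero, zero_add,
      sub_zero, Real.norm_eq_abs] at hδ
    rw [abs_le] at hδ
    obtain ⟨b1, b2⟩ := hδ
    rcases lt_trichotomy δ.2 (g δ.1) with hlt | heq | hgt'
    · rw [abs_of_neg (by linarith)] at b1 b2
      have : N.halfTrace E δ < 0 := by nlinarith
      exact ⟨⟨fun h' => by linarith, fun h' => by linarith⟩,
        ⟨fun h' => by linarith, fun h' => by linarith⟩⟩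
    · rw [heq] at b1 b2
      simp at b1 b2
      have : N.halfTrace E δ = 0 := by linarith
      exact ⟨⟨fun h' => by linarith, fun h' => by linarith⟩, ⟨fun _ => heq, fun _ => this⟩⟩
    · rw [abs_of_pos (by linarith)] at b1 b2
      have : 0 < N.halfTrace E δ := by nlinarith
      exact ⟨⟨fun _ => hgt', fun _ => this⟩, ⟨fun h' => by linarith, fun h' => by linarith⟩⟩

theorem continuousAt_d (h : N.IsSmoothBranch E) :
    ContinuousAt (fun δ => N.d₁₁ δ (E δ)) 0 ∧ ContinuousAt (fun δ => N.d₁₂ δ (E δ)) 0 ∧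
    ContinuousAt (fun δ => N.d₂₁ δ (E δ)) 0 ∧ ContinuousAt (fun δ => N.d₂₂ δ (E δ)) 0 := by
  have := fun j k => (h.p j k).continuousAt
  have := fun j k => (h.P j k).continuousAt
  have := h.contDiffAt.continuousAt
  simp only [d₁₁, d₁₂, d₂₁, d₂₂]
  refine ⟨?_, ?_, ?_, ?_⟩ <;> fun_prop

theorem eventually_det_pos (h : N.IsSmoothBranch E) (r : N.IsResonant) :
    ∀ᶠ δ in 𝓝 0, 0 < N.d₁₁ δ (E δ) * N.d₂₂ δ (E δ) - N.d₁₂ δ (E δ) * N.d₂₁ δ (E δ) := by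
  obtain ⟨c1, c2, c3, c4⟩ := h.continuousAt_d
  have c := (c1.mul c4).sub (c2.mul c3)
  refine c.eventually_const_lt ?_
  simp only [Pi.sub_apply, Pi.mul_apply, d₁₁, d₁₂, d₂₁, d₂₂, h.zero, Prod.fst_zero, Prod.snd_zero, mul_zero, add_zero]
  rw [r.det]
  linarith [r.neg]

theorem sign_cases {a : ℝ} (ha : a ≠ 0) :
    (0 < a ∧ Real.sign a = 1) ∨ (a < 0 ∧ Real.sign a = -1) := by
  rcases lt_or_gt_of_ne ha with h | h
  · exact Or.inr ⟨h, Real.sign_of_neg h⟩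
  · exact Or.inl ⟨h, Real.sign_of_pos h⟩

theorem pos_mul_iff_of_sign {c s : ℝ} (hs : s * s = 1) (h : c * s < 0) (x : ℝ) :
    0 < c * x ↔ s * x < 0 := by
  have e : c * x = (c * s) * (s * x) := by linear_combination -c * x * hs
  rw [e]
  constructor
  · intro h'
    by_contra! h0
    exact absurd h' (not_lt.2 (mul_nonpos_of_nonpos_of_nonneg h.le h0))
  · exact fun h' => mul_pos_of_neg_of_neg h h'

/-- Along the curve of zero trace, the sector conditions and the positivity of the equilibrium
are both decided by the sign of the first parameter. -/
theorem eventually_on_curve (h : N.IsSmoothBranch E) (r : N.IsResonant) {g : ℝ → ℝ}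
    (hg1 : ContDiffAt ℝ 1 g 0) (hg0 : g 0 = 0)
    (hg : (fun x => g x - -((N.σ 0 - 1) / (N.γ 0 - 1)) * x) =O[𝓝 0] fun x => x ^ 2) :
    ∀ᶠ x in 𝓝 (0 : ℝ), (E (x, g x) ∈ posQuadrant ↔ Real.sign (N.p 0 0 0) * x < 0) ∧
      ((0 < Real.sign (N.p 0 0 0) * (x - N.γ (x, g x) * g x) ∧
        0 < Real.sign (N.p 0 0 0) * (N.σ (x, g x) * x - g x)) ↔
          Real.sign (N.p 0 0 0) * x < 0) := by
  have hgO : g =O[𝓝 0] fun x : ℝ => x := by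
    simpa [hg0] using (hg1.differentiableAt one_ne_zero).isBigO_sub
  have hgc : Tendsto (fun x : ℝ => (x, g x)) (𝓝 0) (𝓝 (0 : ℝ × ℝ)) := by
    have : ContinuousAt (fun x : ℝ => (x, g x)) 0 := continuousAt_id.prodMk hg1.continuousAt
    rwa [ContinuousAt, hg0] at this
  have hvO' : (fun x => ‖(x, g x)‖) =O[𝓝 0] fun x : ℝ => x :=
    IsBigO.norm_left (isBigO_prod_left.2 ⟨isBigO_refl _ _, hgO⟩)
  have hvO : (fun x => ‖(x, g x)‖ ^ 2) =O[𝓝 0] fun x : ℝ => x ^ 2 := hvO'.pow 2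
  have hk : N.γ 0 - 1 < 0 := by linarith [r.γ_neg]
  have hγσ := r.γ_mul_σ
  have hγ1 := r.γ_mul
  have hσ1 := r.σ_mul
  have ha := r.p11_ne
  have hb := r.p22_ne
  have hab := r.neg
  have hdet := r.det_ne
  obtain ⟨e1, e2⟩ := h.isBigO_equilibrium hdet
  have hγd : (fun δ => N.γ δ - N.γ 0) =O[𝓝 0] fun δ : ℝ × ℝ => ‖δ‖ := by
    have : ContDiffAt ℝ 1 N.γ 0 := (h.p 0 1).div (h.p 1 1) hb
    simpa using (this.differentiableAt one_ne_zero).isBigO_sub.norm_right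
  have hσd : (fun δ => N.σ δ - N.σ 0) =O[𝓝 0] fun δ : ℝ × ℝ => ‖δ‖ := by
    have : ContDiffAt ℝ 1 N.σ 0 := (h.p 1 0).div (h.p 0 0) ha
    simpa using (this.differentiableAt one_ne_zero).isBigO_sub.norm_right
  set a := N.p 0 0 0 with hadef
  set b := N.p 1 1 0 with hbdef
  set k := N.γ 0 - 1 with hkdef
  set s := Real.sign a with hsdef
  have hs := sign_cases ha
  rw [← hsdef] at hs
  have hs0 : s ≠ 0 := by rcases hs with ⟨-, h⟩ | ⟨-, h⟩ <;> rw [h] <;> norm_num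
  have i1 : b * k + 2 * a * (N.σ 0 - 1) = 3 * b := by
    linear_combination hγ1 + 2 * hσ1 + b * hkdef
  have i2 : 2 * b * k + a * (N.σ 0 - 1) = 3 * a := by
    linear_combination 2 * hγ1 + hσ1 + 2 * b * hkdef
  have i3 : N.γ 0 * (N.σ 0 - 1) = 3 - k := by linear_combination hγσ + hkdef
  have i4 : N.σ 0 * k + (N.σ 0 - 1) = 3 := by linear_combination hγσ + N.σ 0 * hkdef
  have f1 := eventually_pos_iff_of_isBigO (φ := fun x => (E (x, g x)).1) (c := 1 / (a * k))
    (by have := hk.ne; positivity)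
    ((((e1.comp_tendsto hgc).trans hvO).add
      (hg.const_mul_left (N.p 0 1 0 / (a * b - N.p 0 1 0 * N.p 1 0 0)))).congr_left fun x => by
      simp only [Function.comp]
      have hk' := hk.ne
      rw [r.p12, r.p21] at hdet ⊢
      rw [← hadef, ← hbdef] at *
      have hd : a * b - 2 * a * (2 * b) = -3 * (a * b) := by ring
      rw [hd]
      field_simp
      linear_combination -x * i1)
  have f2 := eventually_pos_iff_of_isBigO (φ := fun x => (E (x, g x)).2) (c := -1 / (b * k))
    (by have := hk.ne; exact div_ne_zero (by norm_num) (mul_ne_zero hb this))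
    ((((e2.comp_tendsto hgc).trans hvO).sub
      (hg.const_mul_left (a / (a * b - N.p 0 1 0 * N.p 1 0 0)))).congr_left fun x => by
      simp only [Function.comp]
      have hk' := hk.ne
      rw [r.p12, r.p21] at hdet ⊢
      rw [← hadef, ← hbdef] at *
      have hd : a * b - 2 * a * (2 * b) = -3 * (a * b) := by ring
      rw [hd]
      field_simp
      linear_combination x * i2)
  have f3 := eventually_pos_iff_of_isBigO (φ := fun x => s * (x - N.γ (x, g x) * g x))
    (c := 3 * s / k) (by have := hk.ne; positivity)
    ((((hγd.comp_tendsto hgc).trans hvO').mul hgO |>.const_mul_left (-s) |>.congr_right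
      (fun x => (pow_two x).symm)).add (hg.const_mul_left (-s * N.γ 0)) |>.congr_left fun x => by
      simp only [Function.comp]
      have hk' := hk.ne
      field_simp
      linear_combination -x * i3)
  have f4 := eventually_pos_iff_of_isBigO (φ := fun x => s * (N.σ (x, g x) * x - g x))
    (c := 3 * s / k) (by have := hk.ne; positivity)
    ((((hσd.comp_tendsto hgc).trans hvO').mul (isBigO_refl _ _) |>.const_mul_left s |>.congr_right
      (fun x => (pow_two x).symm)).sub (hg.const_mul_left s) |>.congr_left fun x => by
      simp only [Function.comp]
      have hk' := hk.ne
      field_simp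
      linear_combination -x * i4)
  filter_upwards [f1, f2, f3, f4] with x g1 g2 g3 g4
  have hss : s * s = 1 := by rcases hs with ⟨-, h⟩ | ⟨-, h⟩ <;> rw [h] <;> norm_num
  have hsa : 0 < s * a := by
    rcases hs with ⟨h', h⟩ | ⟨h', h⟩ <;> rw [h] <;> linarith
  have hsb : s * b < 0 := by
    rcases hs with ⟨h', h⟩ | ⟨h', h⟩ <;> rw [h]
    · nlinarith
    · nlinarith
  have s1 : 0 < 1 / (a * k) * x ↔ s * x < 0 := by
    refine pos_mul_iff_of_sign hss ?_ x
    rw [show 1 / (a * k) * s = s * a / (a ^ 2 * k) by field_simp]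
    exact div_neg_of_pos_of_neg hsa (mul_neg_of_pos_of_neg (by positivity) hk)
  have s2 : 0 < -1 / (b * k) * x ↔ s * x < 0 := by
    refine pos_mul_iff_of_sign hss ?_ x
    rw [show -1 / (b * k) * s = -(s * b) / (b ^ 2 * k) by field_simp]
    exact div_neg_of_pos_of_neg (by linarith) (mul_neg_of_pos_of_neg (by positivity) hk)
  have s3 : 0 < 3 * s / k * x ↔ s * x < 0 := by
    refine pos_mul_iff_of_sign hss ?_ x
    rw [show 3 * s / k * s = 3 * (s * s) / k by ring, hss]
    exact div_neg_of_pos_of_neg (by norm_num) hk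
  refine ⟨?_, ?_⟩
  · rw [posQuadrant, mem_ofPred_eq, g1, g2, s1, s2, and_self]
  · rw [g3, g4, s3, and_self]

/-- The part of the curve of zero trace in the sector is the part where the equilibrium lies in the
open quadrant. -/
theorem eventually_mem_hopfCurve_iff (h : N.IsSmoothBranch E) (r : N.IsResonant) {g : ℝ → ℝ}
    (hg1 : ContDiffAt ℝ 1 g 0) (hg0 : g 0 = 0)
    (hg : (fun x => g x - -((N.σ 0 - 1) / (N.γ 0 - 1)) * x) =O[𝓝 0] fun x => x ^ 2)
    (ht : ∀ᶠ δ : ℝ × ℝ in 𝓝 0, N.halfTrace E δ = 0 ↔ δ.2 = g δ.1) :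
    ∀ᶠ δ : ℝ × ℝ in 𝓝 0, δ ∈ N.hopfCurve (Real.sign (N.p 0 0 0)) g ↔
      E δ ∈ posQuadrant ∧ N.halfTrace E δ = 0 := by
  have hfst : Tendsto (fun δ : ℝ × ℝ => δ.1) (𝓝 0) (𝓝 0) := by
    simpa using (continuous_fst (X := ℝ) (Y := ℝ)).tendsto 0
  filter_upwards [ht, hfst.eventually (h.eventually_on_curve r hg1 hg0 hg)] with δ ht' hc
  rw [ht', hopfCurve, mem_ofPred_eq, and_comm (a := E δ ∈ posQuadrant)]
  refine and_congr_right fun e => ?_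
  have e' : (δ.1, g δ.1) = δ := by rw [← e]
  rw [e', ← e] at hc
  rw [hc.1, hc.2]

theorem frequently_mem_hopfCurve (h : N.IsSmoothBranch E) (r : N.IsResonant) {g : ℝ → ℝ}
    (hg1 : ContDiffAt ℝ 1 g 0) (hg0 : g 0 = 0)
    (hg : (fun x => g x - -((N.σ 0 - 1) / (N.γ 0 - 1)) * x) =O[𝓝 0] fun x => x ^ 2) :
    ∃ᶠ δ : ℝ × ℝ in 𝓝 0, δ ∈ N.hopfCurve (Real.sign (N.p 0 0 0)) g := by
  have hgc : Tendsto (fun x : ℝ => (x, g x)) (𝓝 0) (𝓝 (0 : ℝ × ℝ)) := by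
    have : ContinuousAt (fun x : ℝ => (x, g x)) 0 := continuousAt_id.prodMk hg1.continuousAt
    rwa [ContinuousAt, hg0] at this
  have hs : Real.sign (N.p 0 0 0) * Real.sign (N.p 0 0 0) = 1 := by
    rcases sign_cases r.p11_ne with ⟨-, h⟩ | ⟨-, h⟩ <;> rw [h] <;> norm_num
  have hl : Tendsto (fun y : ℝ => -Real.sign (N.p 0 0 0) * y) (𝓝[>] 0) (𝓝 0) := by
    have : Continuous fun y : ℝ => -Real.sign (N.p 0 0 0) * y := by fun_prop
    simpa using (this.tendsto 0).mono_left nhdsWithin_le_nhds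
  have hev := hl.eventually (h.eventually_on_curve r hg1 hg0 hg)
  have : ∀ᶠ y in 𝓝[>] (0 : ℝ), (-Real.sign (N.p 0 0 0) * y, g (-Real.sign (N.p 0 0 0) * y)) ∈
      N.hopfCurve (Real.sign (N.p 0 0 0)) g := by
    filter_upwards [hev, self_mem_nhdsWithin] with y hy hy0
    refine ⟨rfl, hy.2.2 ?_⟩
    have hy0' : 0 < y := hy0
    linear_combination hy0' - y * hs
  exact (hgc.comp hl).frequently this.frequently

end IsSmoothBranch
end TruncatedNormalForm

/-! ### Normal coordinates at an equilibrium of the amplitude system -/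

namespace TruncatedNormalForm

/-- The amplitude field at an equilibrium `ρ` in the coordinates `z` with
`ρ + (z₁ + s z₂, q z₂)`, when these coordinates bring the linear part to the form
`(μ z₁ - ω z₂, ω z₁ + μ z₂)`; `k` stands for `1 / q`. -/
def localJet (N : TruncatedNormalForm) (δ ρ : ℝ × ℝ) (μ ω s q k : ℝ) : CubicJet :=
  let G20 := 2 * ρ.1 * N.P 0 0 δ + 2 * N.d₁₁ δ ρ
  let G11 := 2 * ρ.1 * N.P 0 1 δ + 2 * N.d₁₂ δ ρ
  let G02 := 2 * ρ.1 * N.P 0 2 δ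
  let K20 := 2 * ρ.2 * N.P 1 0 δ
  let K11 := 2 * ρ.2 * N.P 1 1 δ + 2 * N.d₂₁ δ ρ
  let K02 := 2 * ρ.2 * N.P 1 2 δ + 2 * N.d₂₂ δ ρ
  { μ := μ
    ω := ω
    f20 := G20 - s * k * K20
    f11 := 2 * s * G20 + q * G11 - s * k * (2 * s * K20 + q * K11)
    f02 := s ^ 2 * G20 + s * q * G11 + q ^ 2 * G02
      - s * k * (s ^ 2 * K20 + s * q * K11 + q ^ 2 * K02)
    g20 := k * K20
    g11 := k * (2 * s * K20 + q * K11)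
    g02 := k * (s ^ 2 * K20 + s * q * K11 + q ^ 2 * K02)
    f30 := 2 * N.P 0 0 δ
    f21 := 6 * s * N.P 0 0 δ + 2 * q * N.P 0 1 δ - s * k * (2 * q * N.P 1 0 δ)
    f12 := 6 * s ^ 2 * N.P 0 0 δ + 4 * s * q * N.P 0 1 δ + 2 * q ^ 2 * N.P 0 2 δ
      - s * k * (4 * s * q * N.P 1 0 δ + 2 * q ^ 2 * N.P 1 1 δ)
    f03 := 2 * s ^ 3 * N.P 0 0 δ + 2 * s ^ 2 * q * N.P 0 1 δ + 2 * s * q ^ 2 * N.P 0 2 δ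
      - s * k * (2 * s ^ 2 * q * N.P 1 0 δ + 2 * s * q ^ 2 * N.P 1 1 δ + 2 * q ^ 3 * N.P 1 2 δ)
    g30 := 0
    g21 := k * (2 * q * N.P 1 0 δ)
    g12 := k * (4 * s * q * N.P 1 0 δ + 2 * q ^ 2 * N.P 1 1 δ)
    g03 := k * (2 * s ^ 2 * q * N.P 1 0 δ + 2 * s * q ^ 2 * N.P 1 1 δ + 2 * q ^ 3 * N.P 1 2 δ) }

/-- In the basis `(1, 0)`, `(s, q)` the linearization of the amplitude system at an equilibrium `ρ`
is `(z₁, z₂) ↦ (μ z₁ - ω z₂, ω z₁ + μ z₂)`; the four equations are its matrix entries multiplied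
out, and `k = 1 / q`. -/
structure IsNormalFrame (N : TruncatedNormalForm) (δ ρ : ℝ × ℝ) (μ ω s q k : ℝ) : Prop where
  e₁₁ : 2 * ρ.1 * N.d₁₁ δ ρ = μ + ω * s
  e₂₁ : 2 * ρ.2 * N.d₂₁ δ ρ = ω * q
  e₂₂ : 2 * ρ.2 * N.d₂₂ δ ρ = μ - ω * s
  e₁₂ : 2 * ρ.1 * N.d₁₂ δ ρ * q = -ω * (1 + s ^ 2)
  inv : q * k = 1

variable {N : TruncatedNormalForm} {δ ρ : ℝ × ℝ} {μ ω s q k : ℝ}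

/-- Exact Taylor expansion of the cubic amplitude field at an equilibrium in the normal frame. -/
theorem IsNormalFrame.ampField_eq (h : N.IsNormalFrame δ ρ μ ω s q k)
    (h1 : N.bracket₁ δ ρ = 0) (h2 : N.bracket₂ δ ρ = 0) (z : ℝ × ℝ) :
    N.ampField δ (ρ + planarMap 1 s 0 q z) =
      planarMap 1 s 0 q ((N.localJet δ ρ μ ω s q k).field z) := by
  obtain ⟨e11, e21, e22, e12, hk⟩ := h
  obtain ⟨z₁, z₂⟩ := z
  simp only [bracket₁] at h1
  simp only [bracket₂] at h2
  simp only [d₁₁] at e11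
  simp only [d₁₂] at e12
  simp only [d₂₁] at e21
  simp only [d₂₂] at e22
  refine Prod.ext ?_ ?_
  · simp only [ampField, bracket₁, localJet, CubicJet.field, CubicJet.f₂, CubicJet.f₃, CubicJet.g₂,
      CubicJet.g₃, planarMap_apply, Prod.fst_add, Prod.snd_add, d₁₁, d₁₂, d₂₁, d₂₂]
    linear_combination 2 * (ρ.1 + z₁ + s * z₂) * h1 + (z₁ + s * z₂) * e11 + z₂ * e12
  · simp only [ampField, bracket₂, localJet, CubicJet.field, CubicJet.f₂, CubicJet.f₃, CubicJet.g₂,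
      CubicJet.g₃, planarMap_apply, Prod.fst_add, Prod.snd_add, d₁₁, d₁₂, d₂₁, d₂₂]
    linear_combination 2 * (ρ.2 + q * z₂) * h2 + (z₁ + s * z₂) * e21 + q * z₂ * e22 -
      ((2 * ρ.2 * N.P 1 0 δ) * (z₁ + s * z₂) ^ 2 +
        (2 * ρ.2 * N.P 1 1 δ + 2 * (N.p 1 0 δ + 2 * N.P 1 0 δ * ρ.1 + N.P 1 1 δ * ρ.2)) *
          (z₁ + s * z₂) * (q * z₂) +
        (2 * ρ.2 * N.P 1 2 δ + 2 * (N.p 1 1 δ + N.P 1 1 δ * ρ.1 + 2 * N.P 1 2 δ * ρ.2)) *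
          (q * z₂) ^ 2 +
        2 * N.P 1 0 δ * (z₁ + s * z₂) ^ 2 * (q * z₂) +
        2 * N.P 1 1 δ * (z₁ + s * z₂) * (q * z₂) ^ 2 + 2 * N.P 1 2 δ * (q * z₂) ^ 3) * hk

/-- Write `F₁`, `F₂` for the brackets and put
`D = a F₁ + b F₂ + ρ₁ ∂F₁/∂ρ₁ + ρ₂ ∂F₂/∂ρ₂`, which is the divergence of
`ρ₁ ^ (a - 1) ρ₂ ^ (b - 1) (ρ₁ F₁, ρ₂ F₂)` divided by `ρ₁ ^ (a - 1) ρ₂ ^ (b - 1)`. The hypotheses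
`ha`, `hb` say that the gradient of `D` vanishes at the equilibrium. Four times the Lyapunov
coefficient is then the sum of the values of the quadratic form of `D` on the two vectors of the
normal frame. -/
theorem IsNormalFrame.lyap_eq (h : N.IsNormalFrame δ ρ 0 ω s q k) (hω : ω ≠ 0)
    (hρ1 : ρ.1 ≠ 0) (hρ2 : ρ.2 ≠ 0) {a b : ℝ}
    (ha : a * N.d₁₁ δ ρ + b * N.d₂₁ δ ρ =
      -(N.d₁₁ δ ρ + 2 * ρ.1 * N.P 0 0 δ + ρ.2 * N.P 1 1 δ))
    (hb : a * N.d₁₂ δ ρ + b * N.d₂₂ δ ρ =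
      -(N.d₂₂ δ ρ + ρ.1 * N.P 0 1 δ + 2 * ρ.2 * N.P 1 2 δ)) :
    4 * (N.localJet δ ρ 0 ω s q k).lyap =
      ((a + 2) * N.P 0 0 δ + b * N.P 1 0 δ) * (1 + s ^ 2) +
      ((a + 1) * N.P 0 1 δ + (b + 1) * N.P 1 1 δ) * (s * q) +
      (a * N.P 0 2 δ + (b + 2) * N.P 1 2 δ) * q ^ 2 := by
  obtain ⟨e11, e21, e22, e12, hk⟩ := h
  have hq : q ≠ 0 := left_ne_zero_of_mul_eq_one hk
  simp only [localJet, CubicJet.lyap]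
  generalize N.d₁₁ δ ρ = d11 at *
  generalize N.d₁₂ δ ρ = d12 at *
  generalize N.d₂₁ δ ρ = d21 at *
  generalize N.d₂₂ δ ρ = d22 at *
  generalize N.P 0 0 δ = A1 at *
  generalize N.P 0 1 δ = A2 at *
  generalize N.P 0 2 δ = A3 at *
  generalize N.P 1 0 δ = B1 at *
  generalize N.P 1 1 δ = B2 at *
  generalize N.P 1 2 δ = B3 at *
  obtain ⟨x, y⟩ := ρ
  simp only at *
  obtain rfl : k = 1 / q := by field_simp; linarith
  obtain rfl : d11 = ω * s / (2 * x) := by field_simp; linarith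
  obtain rfl : d21 = ω * q / (2 * y) := by field_simp; linarith
  obtain rfl : d22 = -(ω * s) / (2 * y) := by field_simp; linarith
  obtain rfl : d12 = -ω * (1 + s ^ 2) / (2 * x * q) := by field_simp; linarith
  obtain rfl : A1 = -(ω * s / (2 * x) + y * B2 + a * (ω * s / (2 * x)) +
      b * (ω * q / (2 * y))) / (2 * x) := by
    rw [eq_div_iff (by positivity)]; linarith
  obtain rfl : B3 = -(-(ω * s) / (2 * y) + x * A2 + a * (-ω * (1 + s ^ 2) / (2 * x * q)) +
      b * (-(ω * s) / (2 * y))) / (2 * y) := by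
    rw [eq_div_iff (by positivity)]; linarith
  field_simp
  ring

end TruncatedNormalForm

/-! ### Bifurcation of a cycle in a family of planar fields -/

namespace CubicJet

/-- The jet of the time-reversed field in the coordinates `(x, -y)`. -/
def reflect (J : CubicJet) : CubicJet where
  μ := -J.μ
  ω := J.ω
  f20 := -J.f20
  f11 := J.f11
  f02 := -J.f02
  g20 := J.g20
  g11 := -J.g11
  g02 := J.g02
  f30 := -J.f30
  f21 := J.f21
  f12 := -J.f12
  f03 := J.f03
  g30 := J.g30
  g21 := -J.g21
  g12 := J.g12
  g03 := -J.g03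

theorem reflect_field (J : CubicJet) (z : ℝ × ℝ) :
    J.reflect.field (planarMap 1 0 0 (-1) z) = -planarMap 1 0 0 (-1) (J.field z) := by
  refine Prod.ext ?_ ?_ <;>
  · simp only [reflect, field, f₂, f₃, g₂, g₃, planarMap_apply, Prod.fst_neg, Prod.snd_neg]
    ring

theorem lyap_reflect (J : CubicJet) : J.reflect.lyap = -J.lyap := by
  simp only [reflect, lyap]; ring

/-- The sum of the absolute values of the coefficients. -/
def size (J : CubicJet) : ℝ :=
  |J.ω| + (|J.f20| + |J.f11| + |J.f02| + |J.g20| + |J.g11| + |J.g02|) +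
    (|J.f30| + |J.f21| + |J.f12| + |J.f03| + |J.g30| + |J.g21| + |J.g12| + |J.g03|)

theorem bounded_of_size_le {J : CubicJet} {C w : ℝ} (hw : w ≤ J.ω) (hC : J.size ≤ C) :
    J.Bounded C w := by
  have h0 := le_abs_self J.ω
  have h1 := abs_nonneg J.f20
  have h2 := abs_nonneg J.f11
  have h3 := abs_nonneg J.f02
  have h4 := abs_nonneg J.g20
  have h5 := abs_nonneg J.g11
  have h6 := abs_nonneg J.g02
  have h7 := abs_nonneg J.f30
  have h8 := abs_nonneg J.f21
  have h9 := abs_nonneg J.f12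
  have h10 := abs_nonneg J.f03
  have h11 := abs_nonneg J.g30
  have h12 := abs_nonneg J.g21
  have h13 := abs_nonneg J.g12
  have h14 := abs_nonneg J.g03
  have h15 := abs_nonneg J.ω
  rw [size] at hC
  constructor <;> linarith

theorem size_reflect (J : CubicJet) : J.reflect.size = J.size := by
  simp only [reflect, size, abs_neg]

/-- A family of jets whose coefficients depend continuously on the parameter at `δ₀`. -/
structure ContinuousJetAt (J : ℝ × ℝ → CubicJet) (δ₀ : ℝ × ℝ) : Prop where
  μ : ContinuousAt (fun δ => (J δ).μ) δ₀
  ω : ContinuousAt (fun δ => (J δ).ω) δ₀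
  size : ContinuousAt (fun δ => (J δ).size) δ₀
  lyap : ContinuousAt (fun δ => (J δ).lyap) δ₀

theorem ContinuousJetAt.reflect {J : ℝ × ℝ → CubicJet} {δ₀ : ℝ × ℝ} (h : ContinuousJetAt J δ₀) :
    ContinuousJetAt (fun δ => (J δ).reflect) δ₀ :=
  ⟨h.μ.neg, h.ω, by simpa only [size_reflect] using h.size,
    by simp only [lyap_reflect]; exact h.lyap.neg⟩

theorem ContinuousJetAt.exists_bounds {J : ℝ × ℝ → CubicJet} {δ₀ : ℝ × ℝ}
    (h : ContinuousJetAt J δ₀) (hω : 0 < (J δ₀).ω) (hl : (J δ₀).lyap < 0) :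
    ∃ C w l : ℝ, 0 < w ∧ 0 < l ∧ ∀ᶠ δ in 𝓝 δ₀, (J δ).Bounded C w ∧ (J δ).lyap ≤ -l := by
  refine ⟨(J δ₀).size + 1, (J δ₀).ω / 2, -(J δ₀).lyap / 2, by linarith, by linarith, ?_⟩
  filter_upwards [h.ω.eventually_const_lt (show (J δ₀).ω / 2 < (J δ₀).ω by linarith),
    h.size.eventually_lt_const (show (J δ₀).size < (J δ₀).size + 1 by linarith),
    h.lyap.eventually_lt_const (show (J δ₀).lyap < (J δ₀).lyap / 2 by linarith)] with δ h1 h2 h3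
  exact ⟨bounded_of_size_le h1.le h2.le, by linarith⟩

/-- Supercritical side of a Hopf bifurcation with negative Lyapunov coefficient. -/
theorem ContinuousJetAt.eventually_exists_attractingCycle {J : ℝ × ℝ → CubicJet} {δ₀ : ℝ × ℝ}
    (h : ContinuousJetAt J δ₀) (hμ : (J δ₀).μ = 0) (hω : 0 < (J δ₀).ω) (hl : (J δ₀).lyap < 0)
    {ε : ℝ} (hε : 0 < ε) :
    ∀ᶠ δ in 𝓝 δ₀, 0 < (J δ).μ → ∃ S, AttractingCycle (J δ).field S ∧ ∀ y ∈ S, ‖toC y‖ < ε := by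
  obtain ⟨C, w, l, hw, hl', hb⟩ := h.exists_bounds hω hl
  obtain ⟨μ₀, hμ₀, H⟩ := exists_attractingCycle C hw hl' hε
  filter_upwards [hb, h.μ.eventually_lt_const (hμ ▸ hμ₀)] with δ h1 h2 h3
  exact H _ h1.1 h1.2 h3 h2

/-- Subcritical side of a Hopf bifurcation with negative Lyapunov coefficient. -/
theorem ContinuousJetAt.exists_eventually_invariant_subset {J : ℝ × ℝ → CubicJet} {δ₀ : ℝ × ℝ}
    (h : ContinuousJetAt J δ₀) (hω : 0 < (J δ₀).ω) (hl : (J δ₀).lyap < 0) :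
    ∃ r₀ > 0, ∀ᶠ δ in 𝓝 δ₀, (J δ).μ ≤ 0 → ∀ K, IsCompact K → (∀ y ∈ K, ‖toC y‖ < r₀) →
      (∀ y ∈ K, ∃ x : ℝ → ℝ × ℝ, x 0 = y ∧ HasDerivAt x ((J δ).field y) 0 ∧ ∀ t, x t ∈ K) →
      K ⊆ {0} := by
  obtain ⟨C, w, l, hw, hl', hb⟩ := h.exists_bounds hω hl
  obtain ⟨r₀, hr₀, H⟩ := compact_invariant_subset C hw hl'
  refine ⟨r₀, hr₀, ?_⟩
  filter_upwards [hb] with δ h1 h2 K hK hKr hKi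
  exact H _ h1.1 h1.2 h2 K hK hKr hKi

end CubicJet

/-- A neighbourhood of the origin contains a disc. -/
theorem exists_toC_ball_subset {V : Set (ℝ × ℝ)} (hV : V ∈ 𝓝 0) :
    ∃ ε > 0, ∀ y, ‖CubicJet.toC y‖ < ε → y ∈ V := by
  obtain ⟨ε, hε, h⟩ := Metric.mem_nhds_iff.1 hV
  refine ⟨ε, hε, fun y hy => h ?_⟩
  rw [mem_ball_zero_iff]
  refine lt_of_le_of_lt ?_ hy
  have h2 := CubicJet.sq_norm_toC y
  rw [Prod.norm_def, max_le_iff]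
  constructor
  · rw [Real.norm_eq_abs]
    exact abs_le_of_sq_le_sq (by nlinarith [sq_nonneg y.2]) (norm_nonneg _)
  · rw [Real.norm_eq_abs]
    exact abs_le_of_sq_le_sq (by nlinarith [sq_nonneg y.1]) (norm_nonneg _)

/-- The equilibrium `E δ` of the amplitude system, in continuously varying linear coordinates `e`,
is the origin of a cubic field. For `c = 1` the field is the amplitude field, for `c = -1` the
reversed one. -/
structure IsLocalModel (N : TruncatedNormalForm) (c : ℝ) (E : ℝ × ℝ → ℝ × ℝ) (J : ℝ × ℝ → CubicJet)
    (e : ℝ × ℝ → (ℝ × ℝ) ≃L[ℝ] (ℝ × ℝ)) (δ₀ : ℝ × ℝ) : Prop where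
  unit : c * c = 1
  jet : CubicJet.ContinuousJetAt J δ₀
  μ_zero : (J δ₀).μ = 0
  ω_pos : 0 < (J δ₀).ω
  lyap_neg : (J δ₀).lyap < 0
  branch : ContinuousAt E δ₀
  pos : E δ₀ ∈ TruncatedNormalForm.posQuadrant
  frame : ContinuousAt (fun δ => (e δ : (ℝ × ℝ) →L[ℝ] (ℝ × ℝ))) δ₀
  frame_symm : ContinuousAt (fun δ => ((e δ).symm : (ℝ × ℝ) →L[ℝ] (ℝ × ℝ))) δ₀
  field_eq : ∀ᶠ δ in 𝓝 δ₀, ∀ z, c • N.ampField δ (E δ + e δ z) = e δ ((J δ).field z)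

namespace IsLocalModel

variable {N : TruncatedNormalForm} {c : ℝ} {E : ℝ × ℝ → ℝ × ℝ} {J : ℝ × ℝ → CubicJet}
  {e : ℝ × ℝ → (ℝ × ℝ) ≃L[ℝ] (ℝ × ℝ)} {δ₀ : ℝ × ℝ}

/-- On the unstable side of the focus, cycles whose lifts lie in a given neighbourhood of the
two-torus. -/
theorem eventually_exists_cycle (h : IsLocalModel N c E J e δ₀) {U : Set PhaseSpace}
    (hU : U ∈ 𝓝ˢ (TruncatedNormalForm.torusOver (E δ₀))) :
    ∀ᶠ δ in 𝓝 δ₀, 0 < (J δ).μ → ∃ C, AttractingCycle (c • N.ampField δ) C ∧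
      C ⊆ TruncatedNormalForm.posQuadrant ∧ torusLift C ⊆ U := by
  rw [torusOver_eq_torusLift h.pos] at hU
  obtain ⟨V, hV, hVpos, hVU⟩ := exists_nhdsSet_torusLift_subset isCompact_singleton
    (singleton_subset_iff.2 h.pos) hU
  rw [nhdsSet_singleton] at hV
  -- near `δ₀` and the origin, the local coordinates take values in `V`
  have hcont : ContinuousAt (fun p : (ℝ × ℝ) × (ℝ × ℝ) => E p.1 + e p.1 p.2) (δ₀, 0) := by
    have h1 : ContinuousAt (fun p : (ℝ × ℝ) × (ℝ × ℝ) => E p.1) (δ₀, 0) :=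
      ContinuousAt.comp (g := E) h.branch continuousAt_fst
    have h2 : ContinuousAt (fun p : (ℝ × ℝ) × (ℝ × ℝ) => (e p.1 : (ℝ × ℝ) →L[ℝ] (ℝ × ℝ)))
        (δ₀, 0) := ContinuousAt.comp (g := fun δ => (e δ : (ℝ × ℝ) →L[ℝ] (ℝ × ℝ))) h.frame
          continuousAt_fst
    exact h1.add (h2.clm_apply continuousAt_snd)
  have hmem : ∀ᶠ p : (ℝ × ℝ) × (ℝ × ℝ) in 𝓝 (δ₀, 0), E p.1 + e p.1 p.2 ∈ V :=
    hcont.eventually_mem (by simpa using hV)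
  rw [nhds_prod_eq] at hmem
  obtain ⟨pa, ha, pb, hb, hab⟩ := eventually_prod_iff.1 hmem
  obtain ⟨ε, hε, hεb⟩ := exists_toC_ball_subset hb
  filter_upwards [h.jet.eventually_exists_attractingCycle h.μ_zero h.ω_pos h.lyap_neg hε,
    h.field_eq, ha] with δ h1 h2 h3 hμ
  obtain ⟨S, hS, hSε⟩ := h1 hμ
  have hsub : (fun y => E δ + e δ y) '' S ⊆ V := by
    rintro _ ⟨y, hy, rfl⟩
    exact hab h3 (hεb y (hSε y hy))
  exact ⟨_, hS.map (e δ) (E δ) h2, hsub.trans hVpos,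
    fun q hq => hVU ⟨hq.1, hq.2.1, hsub hq.2.2⟩⟩

/-- On the other side there is no three-torus near the two-torus: its amplitudes would form a small
compact invariant set, hence the equilibrium, and a two-torus contains no three-torus. -/
theorem exists_eventually_no_torus (h : IsLocalModel N c E J e δ₀) :
    ∃ U ∈ 𝓝ˢ (TruncatedNormalForm.torusOver (E δ₀)), ∀ᶠ δ in 𝓝 δ₀, (J δ).μ ≤ 0 →
      ∀ S ⊆ U, ¬ N.IsInvariantTorus δ 3 S := by
  obtain ⟨r₀, hr₀, hK⟩ := h.jet.exists_eventually_invariant_subset h.ω_pos h.lyap_neg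
  -- near `δ₀` and `E δ₀`, the local coordinates are smaller than `r₀`
  have hcont : ContinuousAt (fun p : (ℝ × ℝ) × (ℝ × ℝ) => ‖CubicJet.toC ((e p.1).symm (p.2 - E p.1))‖)
      (δ₀, E δ₀) := by
    have h1 : ContinuousAt (fun p : (ℝ × ℝ) × (ℝ × ℝ) => E p.1) (δ₀, E δ₀) :=
      ContinuousAt.comp (g := E) h.branch continuousAt_fst
    have h2 : ContinuousAt (fun p : (ℝ × ℝ) × (ℝ × ℝ) =>
        ((e p.1).symm : (ℝ × ℝ) →L[ℝ] (ℝ × ℝ))) (δ₀, E δ₀) :=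
      ContinuousAt.comp (g := fun δ => ((e δ).symm : (ℝ × ℝ) →L[ℝ] (ℝ × ℝ))) h.frame_symm
        continuousAt_fst
    exact (CubicJet.continuous_toC.continuousAt.comp (h2.clm_apply (continuousAt_snd.sub h1))).norm
  have hmem : ∀ᶠ p : (ℝ × ℝ) × (ℝ × ℝ) in 𝓝 (δ₀, E δ₀),
      ‖CubicJet.toC ((e p.1).symm (p.2 - E p.1))‖ < r₀ :=
    hcont.eventually_lt_const (by simpa [CubicJet.toC] using hr₀)
  rw [nhds_prod_eq] at hmem
  obtain ⟨pa, ha, pb, hb, hab⟩ := eventually_prod_iff.1 hmem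
  have hU : torusLift {ρ | pb ρ} ∈ 𝓝ˢ (TruncatedNormalForm.torusOver (E δ₀)) := by
    rw [torusOver_eq_torusLift h.pos]
    exact torusLift_mem_nhdsSet (by rw [nhdsSet_singleton]; exact hb)
  refine ⟨_, hU, ?_⟩
  have hposE : ∀ᶠ δ in 𝓝 δ₀, E δ ∈ TruncatedNormalForm.posQuadrant :=
    h.branch.eventually_mem (((isOpen_lt continuous_const continuous_fst).inter
      (isOpen_lt continuous_const continuous_snd)).mem_nhds h.pos)
  filter_upwards [hK, h.field_eq, ha, hposE] with δ hK h2 h3 hE hμ S hS hT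
  set A := TruncatedNormalForm.amplitudes '' S with hA
  set φ : ℝ × ℝ → ℝ × ℝ := fun ρ => (e δ).symm (ρ - E δ) with hφ
  have hφinv : ∀ ρ, E δ + e δ (φ ρ) = ρ := fun ρ => by simp [hφ]
  have hφd : ∀ {x : ℝ → ℝ × ℝ} {v : ℝ × ℝ} {t : ℝ}, HasDerivAt x v t →
      HasDerivAt (fun t => φ (x t)) ((e δ).symm v) t := fun {x v t} hx =>
    ((e δ).symm : (ℝ × ℝ) →L[ℝ] (ℝ × ℝ)).hasFDerivAt.comp_hasDerivAt t (hx.sub_const _)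
  have hsub : φ '' A ⊆ {0} := by
    refine hK hμ _ ((N.isCompact_amplitudes_image δ hT).image (by fun_prop)) ?_ ?_
    · rintro _ ⟨ρ, ⟨q, hq, rfl⟩, rfl⟩
      exact hab h3 (hS hq).2.2
    · rintro _ ⟨ρ, hρ, rfl⟩
      obtain ⟨x, hx0, hxd, hxA⟩ := N.exists_curve_amplitudes δ hT.2 hρ
      have hf : (J δ).field (φ ρ) = c • (e δ).symm (N.ampField δ ρ) := by
        have := h2 (φ ρ)
        rw [hφinv] at this
        rw [← map_smul, this, ContinuousLinearEquiv.symm_apply_apply]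
      refine ⟨fun t => φ (x (c * t)), by simp only [mul_zero, hx0], ?_,
        fun t => ⟨_, hxA _, rfl⟩⟩
      rw [hf]
      have hc : HasDerivAt (fun t : ℝ => c * t) c 0 := by
        simpa using (hasDerivAt_id (0 : ℝ)).const_mul c
      have hxd' : HasDerivAt (fun t => φ (x t)) ((e δ).symm (N.ampField δ ρ)) (c * 0) := by
        rw [mul_zero]; exact hφd hxd
      exact hxd'.scomp (0 : ℝ) hc
  have hSE : S ⊆ TruncatedNormalForm.torusOver (E δ) := by
    rw [torusOver_eq_torusLift hE]
    intro q hq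
    refine ⟨(hS hq).1, (hS hq).2.1, ?_⟩
    have h0 : φ (TruncatedNormalForm.amplitudes q) = 0 := hsub ⟨_, ⟨q, hq, rfl⟩, rfl⟩
    have := hφinv (TruncatedNormalForm.amplitudes q)
    rw [h0, map_zero, add_zero] at this
    exact this.symm
  exact not_isEmbeddedTorus_of_subset_torusOver hSE hT.1

end IsLocalModel

/-! ### The sign of the Lyapunov coefficient -/

namespace TruncatedNormalForm

variable {N : TruncatedNormalForm} {E : ℝ × ℝ → ℝ × ℝ}

/-- Determinant of the Jacobian matrix of the two brackets along the branch. -/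
def jacDet (N : TruncatedNormalForm) (E : ℝ × ℝ → ℝ × ℝ) (δ : ℝ × ℝ) : ℝ :=
  N.d₁₁ δ (E δ) * N.d₂₂ δ (E δ) - N.d₁₂ δ (E δ) * N.d₂₁ δ (E δ)

/-- The first of the numbers `a`, `b` for which the divergence of the amplitude field multiplied by
`ρ₁ ^ (a - 1) ρ₂ ^ (b - 1)`, divided by this factor, has a critical point at the equilibrium. -/
def dulac₁ (N : TruncatedNormalForm) (E : ℝ × ℝ → ℝ × ℝ) (δ : ℝ × ℝ) : ℝ :=
  ((N.d₂₂ δ (E δ) + (E δ).1 * N.P 0 1 δ + 2 * (E δ).2 * N.P 1 2 δ) * N.d₂₁ δ (E δ) -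
    (N.d₁₁ δ (E δ) + 2 * (E δ).1 * N.P 0 0 δ + (E δ).2 * N.P 1 1 δ) * N.d₂₂ δ (E δ)) /
      N.jacDet E δ

/-- The second of the numbers `a`, `b` described at `dulac₁`. -/
def dulac₂ (N : TruncatedNormalForm) (E : ℝ × ℝ → ℝ × ℝ) (δ : ℝ × ℝ) : ℝ :=
  ((N.d₁₁ δ (E δ) + 2 * (E δ).1 * N.P 0 0 δ + (E δ).2 * N.P 1 1 δ) * N.d₁₂ δ (E δ) -
    (N.d₂₂ δ (E δ) + (E δ).1 * N.P 0 1 δ + 2 * (E δ).2 * N.P 1 2 δ) * N.d₁₁ δ (E δ)) /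
      N.jacDet E δ

/-- A function of the parameters that is continuous at the origin and equals four times the
Lyapunov coefficient of the equilibrium wherever the trace vanishes. -/
def focalValue (N : TruncatedNormalForm) (E : ℝ × ℝ → ℝ × ℝ) (δ : ℝ × ℝ) : ℝ :=
  ((N.dulac₁ E δ + 2) * N.P 0 0 δ + N.dulac₂ E δ * N.P 1 0 δ) *
      (1 - N.d₁₁ δ (E δ) * N.d₂₂ δ (E δ) / N.jacDet E δ) +
    ((N.dulac₁ E δ + 1) * N.P 0 1 δ + (N.dulac₂ E δ + 1) * N.P 1 1 δ) *
      (N.d₁₁ δ (E δ) * N.d₂₁ δ (E δ) / N.jacDet E δ) -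
    (N.dulac₁ E δ * N.P 0 2 δ + (N.dulac₂ E δ + 2) * N.P 1 2 δ) *
      (N.d₁₁ δ (E δ) * N.d₂₁ δ (E δ) ^ 2 / (N.d₂₂ δ (E δ) * N.jacDet E δ))

theorem IsSmoothBranch.d_zero (h : N.IsSmoothBranch E) :
    N.d₁₁ 0 (E 0) = N.p 0 0 0 ∧ N.d₁₂ 0 (E 0) = N.p 0 1 0 ∧ N.d₂₁ 0 (E 0) = N.p 1 0 0 ∧
      N.d₂₂ 0 (E 0) = N.p 1 1 0 := by
  simp [d₁₁, d₁₂, d₂₁, d₂₂, h.zero]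

/-- The value of the focal function at the origin is a multiple of `l₁₀`. -/
theorem IsSmoothBranch.focalValue_zero (h : N.IsSmoothBranch E) (r : N.IsResonant)
    (hγ : N.γ 0 ≠ 1) (hσ : N.σ 0 ≠ 1) :
    9 * (N.σ 0 - 1) * N.focalValue E 0 =
      -2 * (N.p 0 0 0 * N.p 1 1 0) * (N.γ 0 - 1) * N.l₁₀ := by
  obtain ⟨z1, z2, z3, z4⟩ := h.d_zero
  have ha := r.p11_ne
  have hb := r.p22_ne
  have hD := r.det
  rw [γ, r.p12] at hγ
  rw [σ, r.p21] at hσ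
  simp only [focalValue, dulac₁, dulac₂, jacDet, z1, z2, z3, z4, hD]
  simp only [l₁₀, γ, σ, Γ₁, Γ₂, Γ₃, S₁, S₂, S₃, h.zero, r.p12, r.p21, Prod.fst_zero, Prod.snd_zero, zero_mul, mul_zero, add_zero]
  generalize N.p 0 0 0 = a at *
  generalize N.p 1 1 0 = b at *
  have h1 : 2 * a - b ≠ 0 := fun h0 => hγ (by rw [div_eq_one_iff_eq hb]; linarith)
  have h2 : 2 * b - a ≠ 0 := fun h0 => hσ (by rw [div_eq_one_iff_eq ha]; linarith)
  have h3 : 2 * a / b - 1 ≠ 0 := sub_ne_zero.2 hγ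
  have e1 : 2 * a / b - 1 = (2 * a - b) / b := by field_simp
  have e2 : 2 * b / a - 1 = (2 * b - a) / a := by field_simp
  rw [e1, e2]
  field_simp
  ring

theorem IsSmoothBranch.continuousAt_focalValue (h : N.IsSmoothBranch E) (r : N.IsResonant) :
    ContinuousAt (N.focalValue E) 0 := by
  obtain ⟨c1, c2, c3, c4⟩ := h.continuousAt_d
  obtain ⟨z1, z2, z3, z4⟩ := h.d_zero
  have cP := fun j k => (h.P j k).continuousAt
  have cE := h.contDiffAt.continuousAt
  have hD : ContinuousAt (N.jacDet E) 0 := (c1.mul c4).sub (c2.mul c3)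
  have hD0 : N.jacDet E 0 ≠ 0 := by
    rw [jacDet, z1, z2, z3, z4]; exact r.det_ne
  have h40 : N.d₂₂ 0 (E 0) ≠ 0 := by rw [z4]; exact r.p22_ne
  have hq : ContinuousAt (N.dulac₁ E) 0 := by
    refine ContinuousAt.div ?_ hD hD0
    fun_prop
  have hr : ContinuousAt (N.dulac₂ E) 0 := by
    refine ContinuousAt.div ?_ hD hD0
    fun_prop
  have k1 : ContinuousAt (fun δ => N.d₁₁ δ (E δ) * N.d₂₂ δ (E δ) / N.jacDet E δ) 0 :=
    (c1.mul c4).div hD hD0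
  have k2 : ContinuousAt (fun δ => N.d₁₁ δ (E δ) * N.d₂₁ δ (E δ) / N.jacDet E δ) 0 :=
    (c1.mul c3).div hD hD0
  have k3 : ContinuousAt
      (fun δ => N.d₁₁ δ (E δ) * N.d₂₁ δ (E δ) ^ 2 / (N.d₂₂ δ (E δ) * N.jacDet E δ)) 0 :=
    (c1.mul (c3.pow 2)).div (c4.mul hD) (mul_ne_zero h40 hD0)
  unfold focalValue
  fun_prop

/-- Near the origin the focal function has the sign of `l₁₀`. -/
theorem IsSmoothBranch.eventually_focalValue_sign (h : N.IsSmoothBranch E) (r : N.IsResonant)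
    (hγ : N.γ 0 ≠ 1) (hσ : N.σ 0 ≠ 1) :
    ∀ᶠ δ in 𝓝 0, (N.l₁₀ < 0 → N.focalValue E δ < 0) ∧ (0 < N.l₁₀ → 0 < N.focalValue E δ) := by
  have hc := h.continuousAt_focalValue r
  have hz := h.focalValue_zero r hγ hσ
  have hγ' : N.γ 0 - 1 < 0 := by linarith [r.γ_neg]
  have hσ' : N.σ 0 - 1 < 0 := by linarith [r.σ_neg]
  have hm : 0 < N.p 0 0 0 * N.p 1 1 0 * (N.γ 0 - 1) := mul_pos_of_neg_of_neg r.neg hγ'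
  rcases lt_trichotomy N.l₁₀ 0 with hl | hl | hl
  · have : N.focalValue E 0 < 0 := by
      by_contra! h0
      nlinarith [mul_pos_of_neg_of_neg (neg_neg_of_pos hm) hl, mul_nonneg h0 (neg_pos.2 hσ').le]
    filter_upwards [hc.eventually_lt_const this] with δ hδ
    exact ⟨fun _ => hδ, fun h' => absurd h' hl.not_gt⟩
  · simp [hl]
  · have : 0 < N.focalValue E 0 := by
      by_contra! h0
      nlinarith [mul_pos hm hl, mul_nonneg (neg_nonneg.2 h0) (neg_pos.2 hσ').le]
    filter_upwards [hc.eventually_const_lt this] with δ hδ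
    exact ⟨fun h' => absurd h' hl.not_gt, fun _ => hδ⟩

/-! ### The local model at a point of the Hopf curve -/

/-- A parameter at which the branch has a nonhyperbolic focus in the open quadrant, together with
the continuity of all data there. -/
structure IsHopfParameter (N : TruncatedNormalForm) (E : ℝ × ℝ → ℝ × ℝ) (δ₀ : ℝ × ℝ) : Prop where
  p : ∀ j k, ContinuousAt (N.p j k) δ₀
  P : ∀ j l, ContinuousAt (N.P j l) δ₀
  branch : ContinuousAt E δ₀
  bracket₁ : ∀ᶠ δ in 𝓝 δ₀, N.bracket₁ δ (E δ) = 0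
  bracket₂ : ∀ᶠ δ in 𝓝 δ₀, N.bracket₂ δ (E δ) = 0
  pos : E δ₀ ∈ posQuadrant
  trace : N.halfTrace E δ₀ = 0
  det : 0 < N.jacDet E δ₀
  d21 : N.d₂₁ δ₀ (E δ₀) ≠ 0
  d22 : N.d₂₂ δ₀ (E δ₀) ≠ 0

/-- Imaginary part of the eigenvalues along the branch; it is zero where the eigenvalues are
real. -/
def freq (N : TruncatedNormalForm) (E : ℝ × ℝ → ℝ × ℝ) (δ : ℝ × ℝ) : ℝ :=
  √(4 * (E δ).1 * (E δ).2 * N.jacDet E δ - N.halfTrace E δ ^ 2)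

/-- First component of the second vector of the normal frame. -/
def shear (N : TruncatedNormalForm) (E : ℝ × ℝ → ℝ × ℝ) (δ : ℝ × ℝ) : ℝ :=
  (2 * (E δ).1 * N.d₁₁ δ (E δ) - N.halfTrace E δ) / N.freq E δ

/-- Second component of the second vector of the normal frame. -/
def stretch (N : TruncatedNormalForm) (E : ℝ × ℝ → ℝ × ℝ) (δ : ℝ × ℝ) : ℝ :=
  2 * (E δ).2 * N.d₂₁ δ (E δ) / N.freq E δ

/-- The amplitude field along the branch in the normal frame. -/
def branchJet (N : TruncatedNormalForm) (E : ℝ × ℝ → ℝ × ℝ) (δ : ℝ × ℝ) : CubicJet :=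
  N.localJet δ (E δ) (N.halfTrace E δ) (N.freq E δ) (N.shear E δ) (N.stretch E δ)
    (N.stretch E δ)⁻¹

theorem isNormalFrame_of_freq_pos {δ : ℝ × ℝ} (hω : 0 < N.freq E δ) (hq : N.stretch E δ ≠ 0) :
    N.IsNormalFrame δ (E δ) (N.halfTrace E δ) (N.freq E δ) (N.shear E δ) (N.stretch E δ)
      (N.stretch E δ)⁻¹ := by
  have hs : N.freq E δ * N.shear E δ = 2 * (E δ).1 * N.d₁₁ δ (E δ) - N.halfTrace E δ :=
    mul_div_cancel₀ _ hω.ne'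
  have hr : N.freq E δ * N.stretch E δ = 2 * (E δ).2 * N.d₂₁ δ (E δ) := mul_div_cancel₀ _ hω.ne'
  have hsq : N.freq E δ ^ 2 =
      4 * (E δ).1 * (E δ).2 * N.jacDet E δ - N.halfTrace E δ ^ 2 :=
    Real.sq_sqrt (Real.sqrt_pos.1 hω).le
  have ht : N.halfTrace E δ = (E δ).1 * N.d₁₁ δ (E δ) + (E δ).2 * N.d₂₂ δ (E δ) := rfl
  refine ⟨by linarith, by linarith, by linarith, ?_, mul_inv_cancel₀ hq⟩
  refine mul_left_cancel₀ hω.ne' ?_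
  have h2 : (N.freq E δ * N.shear E δ) ^ 2 =
      (2 * (E δ).1 * N.d₁₁ δ (E δ) - N.halfTrace E δ) ^ 2 := by rw [hs]
  rw [jacDet] at hsq
  linear_combination (2 * (E δ).1 * N.d₁₂ δ (E δ)) * hr + hsq + h2 +
    (-4 * (E δ).1 * N.d₁₁ δ (E δ)) * ht

/-- The linear isomorphism `z ↦ (z₁ + s z₂, q z₂)`, and the identity for `q = 0`. -/
def shearEquiv (s q : ℝ) : (ℝ × ℝ) ≃L[ℝ] (ℝ × ℝ) :=
  if h : q ≠ 0 then
    ContinuousLinearEquiv.equivOfInverse (planarMap 1 s 0 q) (planarMap 1 (-s * q⁻¹) 0 q⁻¹)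
      (fun z => by
        ext
        · simp only [planarMap_apply]
          field_simp
          ring
        · simp [h])
      (fun z => by
        ext
        · simp only [planarMap_apply]
          field_simp
          ring
        · simp [h])
  else ContinuousLinearEquiv.refl ℝ (ℝ × ℝ)

theorem coe_shearEquiv {s q : ℝ} (h : q ≠ 0) :
    (shearEquiv s q : (ℝ × ℝ) →L[ℝ] (ℝ × ℝ)) = planarMap 1 s 0 q := by
  rw [shearEquiv, dif_pos h]; rfl

theorem coe_shearEquiv_symm {s q : ℝ} (h : q ≠ 0) :
    ((shearEquiv s q).symm : (ℝ × ℝ) →L[ℝ] (ℝ × ℝ)) = planarMap 1 (-s * q⁻¹) 0 q⁻¹ := by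
  rw [shearEquiv, dif_pos h]; rfl

theorem _root_.ContinuousAt.planarMap {X : Type*} [TopologicalSpace X] {a b c d : X → ℝ} {x : X}
    (ha : ContinuousAt a x) (hb : ContinuousAt b x) (hc : ContinuousAt c x)
    (hd : ContinuousAt d x) :
    ContinuousAt (fun x => planarMap (a x) (b x) (c x) (d x)) x := by
  have e : ∀ x, _root_.planarMap (a x) (b x) (c x) (d x) =
      a x • _root_.planarMap 1 0 0 0 + b x • _root_.planarMap 0 1 0 0 +
        c x • _root_.planarMap 0 0 1 0 + d x • _root_.planarMap 0 0 0 1 := by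
    intro x
    ext <;> simp
  simp only [e]
  fun_prop

/-- Equilibria in the quadrant with vanishing trace are nonhyperbolic foci. -/
theorem IsSmoothBranch.eventually_isHopfParameter (h : N.IsSmoothBranch E) (r : N.IsResonant) :
    ∀ᶠ δ in 𝓝 0, E δ ∈ posQuadrant → N.halfTrace E δ = 0 → N.IsHopfParameter E δ := by
  obtain ⟨-, -, c3, c4⟩ := h.continuousAt_d
  obtain ⟨-, -, z3, z4⟩ := h.d_zero
  have n3 : N.d₂₁ 0 (E 0) ≠ 0 := by
    rw [z3, r.p21]; exact mul_ne_zero two_ne_zero r.p22_ne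
  have n4 : N.d₂₂ 0 (E 0) ≠ 0 := by rw [z4]; exact r.p22_ne
  have ep : ∀ᶠ δ in 𝓝 0, ∀ j k, ContinuousAt (N.p j k) δ :=
    eventually_all.2 fun j => eventually_all.2 fun k =>
      ((h.p j k).eventually (by simp)).mono fun _ hδ => hδ.continuousAt
  have eP : ∀ᶠ δ in 𝓝 0, ∀ j k, ContinuousAt (N.P j k) δ :=
    eventually_all.2 fun j => eventually_all.2 fun k =>
      ((h.P j k).eventually (by simp)).mono fun _ hδ => hδ.continuousAt
  filter_upwards [ep, eP, h.contDiffAt.eventually (by simp), h.bracket₁.eventually_nhds,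
    h.bracket₂.eventually_nhds, h.eventually_det_pos r, c3.eventually_ne n3,
    c4.eventually_ne n4] with δ a1 a2 a3 a4 a5 a6 a7 a8 a9 a10
  exact ⟨a1, a2, a3.continuousAt, a4, a5, a9, a10, a6, a7, a8⟩

namespace IsHopfParameter

variable {δ₀ : ℝ × ℝ}

theorem continuousAt_d (h : N.IsHopfParameter E δ₀) :
    ContinuousAt (fun δ => N.d₁₁ δ (E δ)) δ₀ ∧ ContinuousAt (fun δ => N.d₁₂ δ (E δ)) δ₀ ∧
    ContinuousAt (fun δ => N.d₂₁ δ (E δ)) δ₀ ∧ ContinuousAt (fun δ => N.d₂₂ δ (E δ)) δ₀ := by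
  have := h.p
  have := h.P
  have := h.branch
  simp only [d₁₁, d₁₂, d₂₁, d₂₂]
  refine ⟨?_, ?_, ?_, ?_⟩ <;> fun_prop

theorem continuousAt_halfTrace (h : N.IsHopfParameter E δ₀) :
    ContinuousAt (N.halfTrace E) δ₀ := by
  obtain ⟨c1, c2, c3, c4⟩ := h.continuousAt_d
  have := h.branch
  unfold halfTrace
  fun_prop

theorem continuousAt_freq (h : N.IsHopfParameter E δ₀) : ContinuousAt (N.freq E) δ₀ := by
  obtain ⟨c1, c2, c3, c4⟩ := h.continuousAt_d
  have := h.branch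
  have := h.continuousAt_halfTrace
  unfold freq jacDet
  fun_prop

theorem freq_pos (h : N.IsHopfParameter E δ₀) : 0 < N.freq E δ₀ := by
  refine Real.sqrt_pos.2 ?_
  have h1 := h.pos.1
  have h2 := h.pos.2
  have h3 := h.det
  rw [h.trace]
  simp only [ne_eq, OfNat.ofNat_ne_zero, not_false_eq_true, zero_pow, sub_zero]
  positivity

theorem stretch_ne (h : N.IsHopfParameter E δ₀) : N.stretch E δ₀ ≠ 0 :=
  div_ne_zero (mul_ne_zero (mul_ne_zero two_ne_zero h.pos.2.ne') h.d21) h.freq_pos.ne'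

theorem continuousAt_shear (h : N.IsHopfParameter E δ₀) : ContinuousAt (N.shear E) δ₀ := by
  obtain ⟨c1, c2, c3, c4⟩ := h.continuousAt_d
  have := h.branch
  have := h.continuousAt_halfTrace
  exact ContinuousAt.div (by fun_prop) h.continuousAt_freq h.freq_pos.ne'

theorem continuousAt_stretch (h : N.IsHopfParameter E δ₀) : ContinuousAt (N.stretch E) δ₀ := by
  obtain ⟨c1, c2, c3, c4⟩ := h.continuousAt_d
  have := h.branch
  exact ContinuousAt.div (by fun_prop) h.continuousAt_freq h.freq_pos.ne'

theorem continuousJetAt (h : N.IsHopfParameter E δ₀) :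
    CubicJet.ContinuousJetAt (N.branchJet E) δ₀ := by
  obtain ⟨c1, c2, c3, c4⟩ := h.continuousAt_d
  have hE := h.branch
  have hP := h.P
  have hω := h.continuousAt_freq
  have hs := h.continuousAt_shear
  have hq := h.continuousAt_stretch
  have hk : ContinuousAt (fun δ => (N.stretch E δ)⁻¹) δ₀ := hq.inv₀ h.stretch_ne
  refine ⟨h.continuousAt_halfTrace, hω, ?_, ?_⟩
  · simp only [CubicJet.size, branchJet, localJet]
    fun_prop
  · have h8 : 8 * N.freq E δ₀ ≠ 0 := mul_ne_zero (by norm_num) h.freq_pos.ne'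
    simp only [CubicJet.lyap, branchJet, localJet]
    refine ContinuousAt.add (by fun_prop) (ContinuousAt.div (by fun_prop) (by fun_prop) h8)

/-- The Lyapunov coefficient at a Hopf parameter. -/
theorem lyap_eq (h : N.IsHopfParameter E δ₀) :
    4 * (N.branchJet E δ₀).lyap = N.focalValue E δ₀ := by
  have hf := isNormalFrame_of_freq_pos h.freq_pos h.stretch_ne
  have hD : N.jacDet E δ₀ ≠ 0 := h.det.ne'
  have hD' := hD
  rw [branchJet]
  rw [h.trace] at hf ⊢
  have key := hf.lyap_eq h.freq_pos.ne' h.pos.1.ne' h.pos.2.ne' (a := N.dulac₁ E δ₀)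
    (b := N.dulac₂ E δ₀)
    (by
      rw [dulac₁, dulac₂]
      field_simp
      rw [jacDet]; ring)
    (by
      rw [dulac₁, dulac₂]
      field_simp
      rw [jacDet]; ring)
  rw [key, focalValue]
  have hω := h.freq_pos.ne'
  have h1 := h.pos.1.ne'
  have h2 := h.pos.2.ne'
  have hJ : 4 * (E δ₀).1 * (E δ₀).2 * N.jacDet E δ₀ = N.freq E δ₀ ^ 2 := by
    have : N.freq E δ₀ ^ 2 =
        4 * (E δ₀).1 * (E δ₀).2 * N.jacDet E δ₀ - N.halfTrace E δ₀ ^ 2 :=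
      Real.sq_sqrt (Real.sqrt_pos.1 h.freq_pos).le
    rw [this, h.trace]; ring
  obtain ⟨e11, e21, e22, -, -⟩ := hf
  have hd22 := h.d22
  have q1 : 1 - N.d₁₁ δ₀ (E δ₀) * N.d₂₂ δ₀ (E δ₀) / N.jacDet E δ₀ = 1 + N.shear E δ₀ ^ 2 := by
    rw [sub_eq_iff_eq_add, ← sub_eq_iff_eq_add', eq_div_iff hD]
    have h4 : (4 * (E δ₀).1 * (E δ₀).2) ≠ 0 := by positivity
    refine mul_left_cancel₀ h4 ?_
    linear_combination (1 - (1 + N.shear E δ₀ ^ 2)) * hJ -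
      2 * (E δ₀).1 * N.d₁₁ δ₀ (E δ₀) * e22 + N.freq E δ₀ * N.shear E δ₀ * e11
  have q2 : N.d₁₁ δ₀ (E δ₀) * N.d₂₁ δ₀ (E δ₀) / N.jacDet E δ₀ =
      N.shear E δ₀ * N.stretch E δ₀ := by
    rw [div_eq_iff hD]
    have h4 : (4 * (E δ₀).1 * (E δ₀).2) ≠ 0 := by positivity
    refine mul_left_cancel₀ h4 ?_
    linear_combination -(N.shear E δ₀ * N.stretch E δ₀) * hJ +
      2 * (E δ₀).1 * N.d₁₁ δ₀ (E δ₀) * e21 + N.freq E δ₀ * N.stretch E δ₀ * e11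
  have q3 : N.d₁₁ δ₀ (E δ₀) * N.d₂₁ δ₀ (E δ₀) ^ 2 / (N.d₂₂ δ₀ (E δ₀) * N.jacDet E δ₀) =
      -N.stretch E δ₀ ^ 2 := by
    rw [div_eq_iff (mul_ne_zero hd22 hD)]
    have h4 : (4 * (E δ₀).1 * (E δ₀).2) ≠ 0 := by positivity
    have h5 : (2 * (E δ₀).2) ≠ 0 := by positivity
    refine mul_left_cancel₀ h4 (mul_left_cancel₀ h5 ?_)
    linear_combination (4 * (E δ₀).2 ^ 2 * N.d₂₁ δ₀ (E δ₀) ^ 2) * e11 +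
      (N.freq E δ₀ * N.shear E δ₀ * (2 * (E δ₀).2 * N.d₂₁ δ₀ (E δ₀) +
        N.freq E δ₀ * N.stretch E δ₀)) * e21 +
      (2 * (E δ₀).2 * N.d₂₂ δ₀ (E δ₀) * N.stretch E δ₀ ^ 2) * hJ +
      N.stretch E δ₀ ^ 2 * N.freq E δ₀ ^ 2 * e22
  rw [q1, q2, q3]
  ring

theorem eventually_frame (h : N.IsHopfParameter E δ₀) :
    ∀ᶠ δ in 𝓝 δ₀, N.stretch E δ ≠ 0 ∧ ∀ z, N.ampField δ (E δ + planarMap 1 (N.shear E δ) 0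
      (N.stretch E δ) z) = planarMap 1 (N.shear E δ) 0 (N.stretch E δ)
        ((N.branchJet E δ).field z) := by
  filter_upwards [h.bracket₁, h.bracket₂, h.continuousAt_freq.eventually_const_lt h.freq_pos,
    h.continuousAt_stretch.eventually_ne h.stretch_ne] with δ b1 b2 hω hq
  exact ⟨hq, (isNormalFrame_of_freq_pos hω hq).ampField_eq b1 b2⟩

theorem isLocalModel_of_neg (h : N.IsHopfParameter E δ₀) (hl : N.focalValue E δ₀ < 0) :
    IsLocalModel N 1 E (N.branchJet E)
      (fun δ => shearEquiv (N.shear E δ) (N.stretch E δ)) δ₀ where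
  unit := one_mul 1
  jet := h.continuousJetAt
  μ_zero := h.trace
  ω_pos := h.freq_pos
  lyap_neg := by linarith [h.lyap_eq]
  branch := h.branch
  pos := h.pos
  frame := by
    refine (ContinuousAt.planarMap (continuousAt_const (y := 1)) h.continuousAt_shear (continuousAt_const (y := 0))
      h.continuousAt_stretch).congr ?_
    filter_upwards [h.eventually_frame] with δ hδ
    exact (coe_shearEquiv hδ.1).symm
  frame_symm := by
    have hk := h.continuousAt_stretch.inv₀ h.stretch_ne
    refine (ContinuousAt.planarMap (continuousAt_const (y := 1)) (h.continuousAt_shear.neg.mul hk)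
      (continuousAt_const (y := 0)) hk).congr ?_
    filter_upwards [h.eventually_frame] with δ hδ
    exact (coe_shearEquiv_symm hδ.1).symm
  field_eq := by
    filter_upwards [h.eventually_frame] with δ hδ z
    have e : ∀ z, shearEquiv (N.shear E δ) (N.stretch E δ) z =
        planarMap 1 (N.shear E δ) 0 (N.stretch E δ) z := fun z =>
      DFunLike.congr_fun (coe_shearEquiv hδ.1) z
    rw [one_smul, e, e, hδ.2]

/-- A positive Lyapunov coefficient becomes negative on reversing time; the reflection in the second
local coordinate keeps the frequency positive. -/
theorem isLocalModel_of_pos (h : N.IsHopfParameter E δ₀) (hl : 0 < N.focalValue E δ₀) :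
    IsLocalModel N (-1) E (fun δ => (N.branchJet E δ).reflect)
      (fun δ => shearEquiv (-N.shear E δ) (-N.stretch E δ)) δ₀ where
  unit := by norm_num
  jet := h.continuousJetAt.reflect
  μ_zero := by
    show -N.halfTrace E δ₀ = 0
    rw [h.trace, neg_zero]
  ω_pos := h.freq_pos
  lyap_neg := by rw [CubicJet.lyap_reflect]; linarith [h.lyap_eq]
  branch := h.branch
  pos := h.pos
  frame := by
    refine (ContinuousAt.planarMap (continuousAt_const (y := 1)) h.continuousAt_shear.neg (continuousAt_const (y := 0))
      h.continuousAt_stretch.neg).congr ?_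
    filter_upwards [h.eventually_frame] with δ hδ
    exact (coe_shearEquiv (neg_ne_zero.2 hδ.1)).symm
  frame_symm := by
    have hk := h.continuousAt_stretch.neg.inv₀ (neg_ne_zero.2 h.stretch_ne)
    refine (ContinuousAt.planarMap (continuousAt_const (y := 1)) (h.continuousAt_shear.neg.neg.mul hk)
      (continuousAt_const (y := 0)) hk).congr ?_
    filter_upwards [h.eventually_frame] with δ hδ
    exact (coe_shearEquiv_symm (neg_ne_zero.2 hδ.1)).symm
  field_eq := by
    filter_upwards [h.eventually_frame] with δ hδ z
    have e : ∀ z, shearEquiv (-N.shear E δ) (-N.stretch E δ) z =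
        planarMap 1 (N.shear E δ) 0 (N.stretch E δ) (planarMap 1 0 0 (-1) z) := fun z => by
      refine (DFunLike.congr_fun (coe_shearEquiv (neg_ne_zero.2 hδ.1)) z).trans ?_
      ext <;> simp
    have hR : ∀ z, planarMap 1 0 0 (-1) (planarMap 1 0 0 (-1) z) = z := fun z => by
      ext <;> simp
    have h3 := (N.branchJet E δ).reflect_field (planarMap 1 0 0 (-1) z)
    rw [hR] at h3
    rw [e, e, hδ.2, h3, map_neg, hR, map_neg, neg_smul, one_smul]

end IsHopfParameter
end TruncatedNormalForm

/-! ### Three-tori near the Hopf curve -/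

namespace TruncatedNormalForm

variable {N : TruncatedNormalForm} {E : ℝ × ℝ → ℝ × ℝ}

/-- With a negative Lyapunov coefficient, a stable torus appears as the trace becomes positive. -/
theorem IsHopfParameter.threeTorusAppears_of_neg {δ₀ : ℝ × ℝ} (h : N.IsHopfParameter E δ₀)
    (hl : N.focalValue E δ₀ < 0) {A B : Set (ℝ × ℝ)}
    (hA : ∀ᶠ δ in 𝓝 δ₀, δ ∈ A → 0 < N.halfTrace E δ)
    (hB : ∀ᶠ δ in 𝓝 δ₀, δ ∈ B → N.halfTrace E δ ≤ 0) :
    N.ThreeTorusAppears (torusOver (E δ₀)) δ₀ B A N.IsAsymptoticallyStable := by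
  have hm := h.isLocalModel_of_neg hl
  refine ⟨fun U hU => ?_, ?_⟩
  · rw [eventually_nhdsWithin_iff]
    filter_upwards [hm.eventually_exists_cycle hU, hA] with δ h1 h2 hδ
    obtain ⟨C, hC, hpos, hCU⟩ := h1 (h2 hδ)
    rw [one_smul] at hC
    exact ⟨_, hCU, N.isInvariantTorus_torusLift δ hC.orbit hpos,
      N.isAsymptoticallyStable_torusLift δ hC hpos⟩
  · obtain ⟨U, hU, hno⟩ := hm.exists_eventually_no_torus
    refine ⟨U, hU, ?_⟩
    rw [eventually_nhdsWithin_iff]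
    filter_upwards [hno, hB] with δ h1 h2 hδ
    exact h1 (h2 hδ)

/-- With a positive Lyapunov coefficient, an unstable torus appears as the trace becomes
negative. -/
theorem IsHopfParameter.threeTorusAppears_of_pos {δ₀ : ℝ × ℝ} (h : N.IsHopfParameter E δ₀)
    (hl : 0 < N.focalValue E δ₀) {A B : Set (ℝ × ℝ)}
    (hA : ∀ᶠ δ in 𝓝 δ₀, δ ∈ A → N.halfTrace E δ < 0)
    (hB : ∀ᶠ δ in 𝓝 δ₀, δ ∈ B → 0 ≤ N.halfTrace E δ) :
    N.ThreeTorusAppears (torusOver (E δ₀)) δ₀ B A fun δ S => ¬ N.IsLyapunovStable δ S := by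
  have hm := h.isLocalModel_of_pos hl
  refine ⟨fun U hU => ?_, ?_⟩
  · rw [eventually_nhdsWithin_iff]
    filter_upwards [hm.eventually_exists_cycle hU, hA] with δ h1 h2 hδ
    obtain ⟨C, hC, hpos, hCU⟩ := h1 (neg_pos.2 (h2 hδ))
    rw [neg_one_smul] at hC
    exact ⟨_, hCU, N.isInvariantTorus_torusLift δ (IsCycle.reverse hC.orbit) hpos,
      N.not_isLyapunovStable_torusLift δ hC hpos⟩
  · obtain ⟨U, hU, hno⟩ := hm.exists_eventually_no_torus
    refine ⟨U, hU, ?_⟩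
    rw [eventually_nhdsWithin_iff]
    filter_upwards [hno, hB] with δ h1 h2 hδ
    exact h1 (neg_nonpos.2 (h2 hδ))

end TruncatedNormalForm

end

theorem theorem2p3 (N : TruncatedNormalForm)
    (hp : ∀ j k, ContDiffAt ℝ 1 (N.p j k) 0)
    (hP : ∀ j l, ContDiffAt ℝ 1 (N.P j l) 0)
    (h12 : N.p 0 1 0 = 2 * N.p 0 0 0)
    (h21 : N.p 1 0 0 = 2 * N.p 1 1 0)
    (h3 : N.H3) :
    (0 < N.p 0 0 0 * N.p 1 1 0 →
      ∃ E : ℝ × ℝ → ℝ × ℝ, N.IsNontrivialBranch E ∧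
        ((fun δ => N.scaled δ (E δ) - (-Real.sign (N.p 0 0 0)) • N.leadSimple δ)
          =O[𝓝 0] fun δ => ‖δ‖ ^ 2) ∧
        N.HasInvariantTwoTori E) ∧
    (N.p 0 0 0 * N.p 1 1 0 < 0 →
      ∃ E : ℝ × ℝ → ℝ × ℝ, N.IsNontrivialBranch E ∧
        ((fun δ => N.scaled δ (E δ) - Real.sign (N.p 0 0 0) • N.leadDifficult δ)
          =O[𝓝 0] fun δ => ‖δ‖ ^ 2) ∧
        N.HasInvariantTwoTori E ∧
        (N.γ 0 ≠ 1 → N.σ 0 ≠ 1 → N.l₁₀ ≠ 0 →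
          ∃ h : ℝ → ℝ, ContDiffAt ℝ 1 h 0 ∧
            ((fun x => h x - -((N.σ 0 - 1) / (N.γ 0 - 1)) * x) =O[𝓝 0] fun x => x ^ 2) ∧
            (∀ᶠ δ in 𝓝 (0 : ℝ × ℝ), N.IsHopfPoint δ (E δ) ↔
              δ ∈ N.hopfCurve (Real.sign (N.p 0 0 0)) h) ∧
            (∃ᶠ δ in 𝓝 (0 : ℝ × ℝ), δ ∈ N.hopfCurve (Real.sign (N.p 0 0 0)) h) ∧
            ∀ᶠ δ₀ in 𝓝 (0 : ℝ × ℝ), δ₀ ∈ N.hopfCurve (Real.sign (N.p 0 0 0)) h →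
              (N.l₁₀ < 0 →
                N.ThreeTorusAppears (TruncatedNormalForm.torusOver (E δ₀)) δ₀
                  {δ | δ.2 ≤ h δ.1} {δ | h δ.1 < δ.2} N.IsAsymptoticallyStable) ∧
              (0 < N.l₁₀ →
                N.ThreeTorusAppears (TruncatedNormalForm.torusOver (E δ₀)) δ₀
                  {δ | h δ.1 ≤ δ.2} {δ | δ.2 < h δ.1}
                  fun δ S => ¬ N.IsLyapunovStable δ S))) := by
  obtain ⟨E, hE, hE1, hE0, hb⟩ := N.exists_branch hp hP h3.2
  have h : N.IsSmoothBranch E :=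
    ⟨hp, hP, hE1, hE0, hb.mono fun _ hδ => hδ.1, hb.mono fun _ hδ => hδ.2⟩
  have hn1 := h3.1 0 0
  have hn2 := h3.1 1 1
  have hγσ : N.γ 0 * N.σ 0 ≠ 1 := by
    rw [TruncatedNormalForm.γ, TruncatedNormalForm.σ, h12, h21]
    field_simp
    norm_num
  have hO := h.isBigO_scaled hn1 hn2 hγσ
  refine ⟨fun hpos => ⟨E, hE, ?_, h.hasInvariantTwoTori h3.2⟩,
    fun hneg => ⟨E, hE, ?_, h.hasInvariantTwoTori h3.2, fun hγ hσ _ => ?_⟩⟩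
  · have hs : Real.sign (N.p 1 1 0) = Real.sign (N.p 0 0 0) := by
      rcases pos_and_pos_or_neg_and_neg_of_mul_pos hpos with ⟨h1, h2⟩ | ⟨h1, h2⟩
      · rw [Real.sign_of_pos h1, Real.sign_of_pos h2]
      · rw [Real.sign_of_neg h1, Real.sign_of_neg h2]
    refine hO.congr_left fun δ => ?_
    rw [hs]
    congr 1
    refine Prod.ext ?_ ?_ <;> simp [TruncatedNormalForm.leadSimple]
  · have hs : Real.sign (N.p 1 1 0) = -Real.sign (N.p 0 0 0) := by
      rcases mul_neg_iff.1 hneg with ⟨h1, h2⟩ | ⟨h1, h2⟩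
      · rw [Real.sign_of_pos h1, Real.sign_of_neg h2]
      · rw [Real.sign_of_neg h1, Real.sign_of_pos h2, neg_neg]
    refine hO.congr_left fun δ => ?_
    rw [hs, neg_neg]
    congr 1
  · have r : N.IsResonant := ⟨h12, h21, hneg⟩
    obtain ⟨g, hg1, hg0, hgO, ht⟩ := h.exists_trace_curve r
    have hH := h.eventually_mem_hopfCurve_iff r hg1 hg0 hgO (ht.mono fun _ hδ => hδ.2)
    refine ⟨g, hg1, hgO, ?_, h.frequently_mem_hopfCurve r hg1 hg0 hgO, ?_⟩
    · filter_upwards [hH, h.bracket₁, h.bracket₂, h.eventually_det_pos r] with δ hδ b1 b2 hd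
      rw [N.isHopfPoint_iff b1 b2 hd, hδ]
      rfl
    · filter_upwards [hH, h.eventually_isHopfParameter r, h.eventually_focalValue_sign r hγ hσ,
        ht.eventually_nhds] with δ₀ h1 h2 h3 ht₀ hδ₀
      have hpar := h2 (h1.1 hδ₀).1 (h1.1 hδ₀).2
      refine ⟨fun hl => hpar.threeTorusAppears_of_neg (h3.1 hl) ?_ ?_,
        fun hl => hpar.threeTorusAppears_of_pos (h3.2 hl) ?_ ?_⟩
      · filter_upwards [ht₀] with δ hδ hA
        exact hδ.1.2 hA
      · filter_upwards [ht₀] with δ hδ hB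
        exact not_lt.1 fun h0 => absurd (hδ.1.1 h0) (not_lt.2 hB)
      · filter_upwards [ht₀] with δ hδ hA
        have hA' : δ.2 < g δ.1 := hA
        exact lt_of_le_of_ne (not_lt.1 fun h0 => absurd (hδ.1.1 h0) hA'.not_gt)
          fun h0 => hA'.ne (hδ.2.1 h0)
      · filter_upwards [ht₀] with δ hδ hB
        rcases lt_or_eq_of_le (show g δ.1 ≤ δ.2 from hB) with h0 | h0
        · exact (hδ.1.2 h0).le
        · exact (hδ.2.2 h0.symm).ge
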